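/- Let $b$ be a prime, $\alpha\ge 2$, $d\ge 1$ integers, and let $\gamma=(\gamma_u)$ be non-negative weights indexed by the finite subsets $u$ of $\mathbb N$, with $\gamma_\emptyset>0$. Write $I_s=\{1,\dots,s\}$, $\mu=\min(\alpha,d)$. **Error.** For $s\ge1$ let $H_s=H_{s,\alpha,\gamma}$ be the weighted unanchored Sobolev space of functions on $[0,1)^s$ whose mixed partial derivatives of order up to $\alpha$ in each variable are square integrable, with $$\|f\|^2=\sum_{u\subseteq I_s}\gamma_u^{-1}\sum_{v\subseteq u}\ \sum_{r\in\{1,\dots,\alpha-1\}^{u\setminus v}}\int_{[0,1)^{|v|}}\Big(\int_{[0,1)^{s-|v|}}f^{(r_{u\setminus v},\alpha_v,0)}(x)\,dx_{-v}\Big)^2dx_v ,$$ where $0/0=0$ and the inner double sum is required to vanish if $\gamma_u=0$. For points $P=\{x_0,\dots,x_{N-1}\}$ put $e(P)=\sup_{\|f\|\le1}\big|\int f-\frac1N\sum_n f(x_n)\big|$, let $e_0(s)=\sup_{\|f\|\le1}|\int f|$ be the initial error, and let $\tilde e(P)^2=\int_{[0,1)^s}e(P\oplus\sigma)^2\,d\sigma$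 be the mean square worst-case error under a random digital shift, $\oplus$ being digitwise addition modulo $b$. **Point sets.** For $m\ge1$, $p\in\mathbb F_b[x]$ of degree $m$ and $q=(q_1,\dots,q_{ds})\in\mathbb F_b[x]^{ds}$, let $y_n=\big(v_m(n(x)q_i(x)/p(x))\big)_{i\le ds}$, $0\le n<b^m$, be the polynomial lattice point set; here $n(x)$ is the polynomial whose coefficients are the $b$-adic digits of $n$, and $v_m(\sum_l t_lx^{-l})=\sum_{l=1}^m t_lb^{-l}$. The interlaced net $P_{b^m}\subset[0,1)^s$ consists of the points whose $j$-th coordinate is obtained by interlacing the $b$-adic digits of $y_{n,d(j-1)+1},\dots,y_{n,dj}$. The polynomials are found component by component: $p$ is irreducible of degree $m$, $q_1=1$, and for $t=2,\dots,ds$ the polynomial $q_t$ minimizes, over all nonzero polynomials of degree less than $m$, $$B\big((q_1,\dots,q_t),p\big)=\sum_{\emptyset\ne w\subseteq I_t}\gamma_{\phi(w)}\tilde D^{|\phi(w)|}\sum_{l_w}\prod_{i\in w}b^{-2\mu\,\mu_1(l_i)-\alpha},$$ where $l_w$ runs over the vectors of positive integers with $\sum_{i\in w}\mathrm{tr}_m(l_i)\,q_i\equiv0\pmod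 p$, $\mathrm{tr}_m(l)$ is the polynomial whose coefficients are the lowest $m$ digits of $l$, $\mu_1(l)$ is the number of $b$-adic digits of $l$, and $\phi(w)=\{\lceil i/d\rceil:i\in w\}$. The constants are, with $c=1+\frac1b+\frac1{b(b+1)}$ and $\theta=2\sin(\pi/b)$: $C_1=\theta^{-1}$, $C_\tau=c^{\tau-2}\theta^{-\tau}$ for $\tau\ge2$, $$\tilde D=b^{(2d-1)\alpha}\max_{1\le\nu\le\alpha}\Big(\sum_{\tau=\nu}^{\alpha}C_\tau^2b^{-2(\tau-\nu)}+2c^{2\alpha-2}\theta^{-2\alpha}\,b^{-2(\alpha-\nu)}\Big).$$ For a choice of such a $P_{b^m}$ for every $m\ge1$, let $N(\varepsilon,s)$ be the least $b^m$, $m\ge1$, with $\tilde e(P_{b^m})\le\varepsilon\,e_0(s)$ ($\infty$ if there is none). **Claim.** For $\lambda\in(1/(2\mu),1]$ put $$G_\lambda=\tilde D^{\lambda}\big(-1+(1+C_{(\lambda)})^d\big),\quad C_{(\lambda)}=b^{-\alpha\lambda}\max\Big\{\Big(\tfrac{b-1}{b^{2\mu}-b}\Big)^{\lambda},\tfrac{b-1}{b^{2\lambda\mu}-b}\Big\},\quad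 S_\lambda(s)=\sum_{\emptyset\ne u\subseteq I_s}\gamma_u^{\lambda}G_\lambda^{|u|}.$$ 1. If $\lim_{s\to\infty}S_\lambda(s)<\infty$ for some $\lambda\in(1/(2\mu),1]$, then $N(\varepsilon,s)$ is bounded independently of the dimension: there are constants $C,\kappa$ with $N(\varepsilon,s)\le C(1+\varepsilon^{-1})^{\kappa}$ for all $\varepsilon>0$, all $s\ge1$ and all outcomes of the construction. 2. If $\limsup_{s\to\infty}s^{-Q}S_\lambda(s)<\infty$ for some $\lambda\in(1/(2\mu),1]$ and some $Q>0$, then $N(\varepsilon,s)$ depends polynomially on the dimension: there are constants $C,\kappa,t$ with $N(\varepsilon,s)\le C(1+\varepsilon^{-1})^{\kappa}s^{t}$ for all $\varepsilon>0$, all $s\ge1$ and all outcomes of the construction. -/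

import Mathlib

open MeasureTheory Filter Topology Polynomial
open scoped NNReal ENNReal

noncomputable section

namespace InterlacedQMC

/-! Coordinates are numbered from `0`: the index set `I_s` is `{0, …, s - 1}`, the `ds` components
of a polynomial lattice point set are numbered `0, …, ds - 1`, and the components
`d * j, …, d * j + d - 1` belong to the coordinate `j`. Weights are indexed by finite subsets
of `ℕ`. -/

/-! ### The weighted unanchored Sobolev space -/

/-- The half-open unit cube `[0,1)^s`. -/
def cube (s : ℕ) : Set (Fin s → ℝ) := Set.univ.pi fun _ => Set.Ico 0 1

/-- Lebesgue measure on `[0,1)^s`. -/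
def cubeMeasure (s : ℕ) : Measure (Fin s → ℝ) := volume.restrict (cube s)

/-- `g` is the weak partial derivative of `f` in the direction of the `j`-th coordinate on the
open unit cube. -/
def IsWeakPartial {s : ℕ} (j : Fin s) (f g : (Fin s → ℝ) → ℝ) : Prop :=
  ∀ φ : (Fin s → ℝ) → ℝ, ContDiff ℝ (⊤ : ℕ∞) φ → HasCompactSupport φ →
    tsupport φ ⊆ Set.univ.pi (fun _ => Set.Ioo (0 : ℝ) 1) →
    ∫ x, f x * fderiv ℝ φ x (Pi.single j 1) ∂(cubeMeasure s) =
      - ∫ x, g x * φ x ∂(cubeMeasure s)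

/-- A function of smoothness `α` on `[0,1)^s`, together with (representatives of) its weak mixed
partial derivatives of order at most `α` in each variable, all of which are square integrable.
The function itself is `deriv 0`; it is the continuous representative, so that point values
make sense. The other derivatives are determined by it almost everywhere. -/
structure SobolevFunction (s α : ℕ) where
  /-- The mixed derivative `f^{(r)}` for the multi-index `r`. -/
  deriv : (Fin s → ℕ) → (Fin s → ℝ) → ℝ
  continuousOn : ContinuousOn (deriv 0) (cube s)
  memLp : ∀ r : Fin s → ℕ, (∀ j, r j ≤ α) → MemLp (deriv r) 2 (cubeMeasure s)
  weak : ∀ r : Fin s → ℕ, (∀ i, r i ≤ α) → ∀ j, r j < α →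
    IsWeakPartial j (deriv r) (deriv (Function.update r j (r j + 1)))

instance (s α : ℕ) : CoeFun (SobolevFunction s α) (fun _ => (Fin s → ℝ) → ℝ) :=
  ⟨fun f => f.deriv 0⟩

/-- The multi-indices `(r_{u \ v}, α_v, 0)` with `r_{u \ v} ∈ {1, …, α - 1}^{|u \ v|}`. -/
def multiIndices {s : ℕ} (α : ℕ) (u v : Finset (Fin s)) : Finset (Fin s → ℕ) :=
  Fintype.piFinset fun j =>
    if j ∈ v then {α} else if j ∈ u then Finset.Icc 1 (α - 1) else {0}

/-- `∫_{[0,1)^{|v|}} (∫_{[0,1)^{s-|v|}} g(x) dx_{-v})² dx_v`. Both integrals are written over the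
whole unit cube, whose superfluous coordinates integrate to `1`. -/
def sectionNormSq {s : ℕ} (v : Finset (Fin s)) (g : (Fin s → ℝ) → ℝ) : ℝ≥0∞ :=
  ∫⁻ x, ENNReal.ofReal ((∫ y, g (v.piecewise x y) ∂(cubeMeasure s)) ^ 2) ∂(cubeMeasure s)

/-- The squared norm of `f` in the weighted space. In `ℝ≥0∞` one has `0 / 0 = 0` and `t / 0 = ∞`
for `t ≠ 0`, so that a finite norm forces the inner double sum to vanish whenever `γ u = 0`. -/
def SobolevFunction.normSq {s α : ℕ} (γ : Finset ℕ → ℝ≥0) (f : SobolevFunction s α) : ℝ≥0∞ :=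
  ∑ u : Finset (Fin s),
    (∑ v ∈ u.powerset, ∑ r ∈ multiIndices α u v, sectionNormSq v (f.deriv r)) /
      (γ (u.map Fin.valEmbedding) : ℝ≥0∞)

/-- The worst-case error of the QMC rule with the points `x 0, …, x (N - 1)` over the unit ball
of the weighted Sobolev space. -/
def worstCaseError (α : ℕ) (γ : Finset ℕ → ℝ≥0) {s N : ℕ} (x : Fin N → Fin s → ℝ) : ℝ≥0∞ :=
  ⨆ (f : SobolevFunction s α) (_ : f.normSq γ ≤ 1),
    ENNReal.ofReal |∫ y, f y ∂(cubeMeasure s) - (1 / (N : ℝ)) * ∑ n, f (x n)|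

/-- The initial error. It does not involve any points, so it is not affected by a random shift. -/
def initialError (α : ℕ) (γ : Finset ℕ → ℝ≥0) (s : ℕ) : ℝ≥0∞ :=
  ⨆ (f : SobolevFunction s α) (_ : f.normSq γ ≤ 1),
    ENNReal.ofReal |∫ y, f y ∂(cubeMeasure s)|

/-! ### Digital shifts, interlacing and polynomial lattice point sets -/

section Digital

variable (b : ℕ) [NeZero b]

/-- Digitwise addition modulo `b` of two points of `[0,1)`. -/
def digitAdd (x y : ℝ) : ℝ :=
  Real.ofDigits fun i => Real.digits x b i + Real.digits y b i

/-- The mean square worst-case error with respect to a random digital shift. -/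
def meanSquareError (α : ℕ) (γ : Finset ℕ → ℝ≥0) {s N : ℕ} (x : Fin N → Fin s → ℝ) : ℝ≥0∞ :=
  ∫⁻ σ, worstCaseError α γ (fun n j => digitAdd b (x n j) (σ j)) ^ 2 ∂(cubeMeasure s)

/-- The square root of the mean square worst-case error. -/
def rootMeanSquareError (α : ℕ) (γ : Finset ℕ → ℝ≥0) {s N : ℕ} (x : Fin N → Fin s → ℝ) :
    ℝ≥0∞ :=
  meanSquareError b α γ x ^ (1 / 2 : ℝ)

/-- Digit interlacing of `y 0, …, y (d - 1)`: the digit number `a * d + r` of the result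
(counted from `0`, with `r < d`) is the digit number `a` of `y r`. -/
def interlace (d : ℕ) (y : ℕ → ℝ) : ℝ :=
  Real.ofDigits fun i => Real.digits (y (i % d)) b (i / d)

end Digital

section Lattice

variable (b : ℕ) [Fact b.Prime]

/-- The polynomial `k(x)` whose coefficients are the `b`-adic digits of `k`. -/
def natPoly (k : ℕ) : (ZMod b)[X] := Nat.ofDigits X (Nat.digits b k)

/-- The truncation `tr_m(k)(x)`: only the `m` lowest digits of `k` are kept. -/
def truncPoly (m k : ℕ) : (ZMod b)[X] := Nat.ofDigits X ((Nat.digits b k).take m)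

/-- The embedding of `F_b[x]` into the field `F_b((x⁻¹))` of formal Laurent series in `x⁻¹`: the
variable of `LaurentSeries` plays the role of `x⁻¹`, and `x` is sent to its inverse. -/
def embedLaurent (f : (ZMod b)[X]) : LaurentSeries (ZMod b) :=
  aeval (HahnSeries.single (-1 : ℤ) (1 : ZMod b) : LaurentSeries (ZMod b)) f

/-- The map `v_m : F_b((x⁻¹)) → [0,1)`. -/
def vMap (m : ℕ) (L : LaurentSeries (ZMod b)) : ℝ :=
  ∑ l ∈ Finset.Icc 1 m, ((L.coeff (l : ℤ)).val : ℝ) / (b : ℝ) ^ l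

/-- The `i`-th component of the `n`-th point of the polynomial lattice point set with modulus
`p` and generating vector `q`. -/
def latticePoint (m : ℕ) (p : (ZMod b)[X]) (q : ℕ → (ZMod b)[X]) (n i : ℕ) : ℝ :=
  vMap b m (embedLaurent b (natPoly b n * q i) / embedLaurent b p)

/-- The higher order digital net of `b ^ m` points in `[0,1)^s` obtained by interlacing the
polynomial lattice point set in dimension `d * s` with modulus `p` and generating vector
`q 0, …, q (d * s - 1)`. -/
def interlacedNet (m s d : ℕ) (p : (ZMod b)[X]) (q : ℕ → (ZMod b)[X]) :
    Fin (b ^ m) → Fin s → ℝ :=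
  fun n j => interlace b d fun r => latticePoint b m p q n (d * (j : ℕ) + r)

/-- The dual net of the polynomial lattice point set with generating vector
`q 0, …, q (t - 1)`. -/
def dualNet (m t : ℕ) (p : (ZMod b)[X]) (q : ℕ → (ZMod b)[X]) : Set (Fin t → ℕ) :=
  {k | p ∣ ∑ i, truncPoly b m (k i) * q i}

/-! ### The constants and the quality criterion -/

/-- The constants `C_{τ,b}`, for `τ ≥ 1`. -/
def constC (b τ : ℕ) : ℝ :=
  if τ = 1 then (2 * Real.sin (Real.pi / b))⁻¹
  else (1 + 1 / (b : ℝ) + 1 / ((b : ℝ) * (b + 1))) ^ (τ - 2) / (2 * Real.sin (Real.pi / b)) ^ τ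

/-- The constant `C'_{α,b,ν}`. -/
def constC' (b α ν : ℕ) : ℝ :=
  ∑ τ ∈ Finset.Icc ν α, constC b τ ^ 2 * ((b : ℝ) ^ (2 * (τ - ν)))⁻¹

/-- The constant `C̃_{2α,b}`. -/
def constCTilde (b α : ℕ) : ℝ :=
  2 * (1 + 1 / (b : ℝ) + 1 / ((b : ℝ) * (b + 1))) ^ (2 * α - 2) /
    (2 * Real.sin (Real.pi / b)) ^ (2 * α)

/-- The constant `D_{α,b}`, a maximum over `1 ≤ ν ≤ α`. -/
def constD (b α : ℕ) : ℝ :=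
  ⨆ ν : Finset.Icc 1 α, (constC' b α ν + constCTilde b α * ((b : ℝ) ^ (2 * (α - (ν : ℕ))))⁻¹)

/-- The constant `D̃_{α,b,d} = b^{(2d-1)α} D_{α,b}`. -/
def constDTilde (b α d : ℕ) : ℝ := (b : ℝ) ^ ((2 * d - 1) * α) * constD b α

/-- The constant `C_{α,d,λ}`. -/
def constCLam (b α d : ℕ) (lam : ℝ) : ℝ :=
  1 / (b : ℝ) ^ ((α : ℝ) * lam) *
    max ((((b : ℝ) - 1) / ((b : ℝ) ^ (2 * min α d) - b)) ^ lam)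
      (((b : ℝ) - 1) / ((b : ℝ) ^ (2 * lam * ((min α d : ℕ) : ℝ)) - b))

/-- The constant `G_{α,d,λ,a}`. -/
def constG (b α d : ℕ) (lam : ℝ) (a : ℕ) : ℝ :=
  constDTilde b α d ^ lam * (-1 + (1 + constCLam b α d lam) ^ a)

/-- The function `r_{α,d}`. The weight `μ_1(l)` of `l ≥ 1` is the position of its leading
`b`-adic digit, that is, the number of its digits. -/
def rFun (b α d l : ℕ) : ℝ :=
  if l = 0 then 1 else ((b : ℝ) ^ (2 * min α d * (Nat.digits b l).length + α))⁻¹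

/-- The vector `(l_w, 0)`, which extends `l_w` by zero. -/
def zeroExtend {t : ℕ} (w : Finset (Fin t)) (l : w → ℕ+) (i : Fin t) : ℕ :=
  if h : i ∈ w then (l ⟨i, h⟩ : ℕ) else 0

/-- The map `φ`: the coordinates to which the components in `w` belong. -/
def phi (d : ℕ) {t : ℕ} (w : Finset (Fin t)) : Finset ℕ := w.image fun i : Fin t => (i : ℕ) / d

/-- The quality criterion `B_{α,d,γ}((q 0, …, q (t - 1)), p)`. -/
def criterion (m α d : ℕ) (γ : Finset ℕ → ℝ≥0) (t : ℕ) (p : (ZMod b)[X])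
    (q : ℕ → (ZMod b)[X]) : ℝ≥0∞ :=
  ∑ w ∈ (Finset.univ : Finset (Fin t)).powerset.erase ∅,
    ENNReal.ofReal (γ (phi d w) * constDTilde b α d ^ (phi d w).card) *
      ∑' l : {l : w → ℕ+ // zeroExtend w l ∈ dualNet b m t p q},
        ENNReal.ofReal (∏ i, rFun b α d (l.1 i))

/-! ### The component-by-component construction and the number of points -/

/-- The set `R_{b,m}` of nonzero polynomials of degree less than `m`. -/
def genSet (m : ℕ) : Set (ZMod b)[X] := {f | f.degree < (m : ℕ) ∧ f ≠ 0}

/-- `p` and `q 0, …, q (d * s - 1)` are a possible outcome of the component-by-component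
construction. -/
structure IsCBC (m s α d : ℕ) (γ : Finset ℕ → ℝ≥0) (p : (ZMod b)[X])
    (q : ℕ → (ZMod b)[X]) : Prop where
  irreducible : Irreducible p
  natDegree_eq : p.natDegree = m
  first : q 0 = 1
  mem : ∀ t, 1 ≤ t → t < d * s → q t ∈ genSet b m
  minimal : ∀ t, 1 ≤ t → t < d * s → ∀ f ∈ genSet b m,
    criterion b m α d γ (t + 1) p q ≤ criterion b m α d γ (t + 1) p (Function.update q t f)

/-- The minimal number `b ^ m`, `m ≥ 1`, of points for which the root mean square worst-case
error of the interlaced net with modulus `p m` and generating vector `q m` is at most `ε` times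
the initial error; it is `∞` if there is no such `m`. -/
def minPoints (s α d : ℕ) (γ : Finset ℕ → ℝ≥0) (p : ℕ → (ZMod b)[X])
    (q : ℕ → ℕ → (ZMod b)[X]) (ε : ℝ) : ℝ≥0∞ :=
  ⨅ (m : ℕ) (_ : 1 ≤ m)
    (_ : rootMeanSquareError b α γ (interlacedNet b m s d (p m) (q m)) ≤
      ENNReal.ofReal ε * initialError α γ s), (b : ℝ≥0∞) ^ m

/-- The sum `∑_{∅ ≠ u ⊆ I_s} γ_u^λ G_{α,d,λ,d}^{|u|}`. -/
def weightSum (α d : ℕ) (γ : Finset ℕ → ℝ≥0) (lam : ℝ) (s : ℕ) : ℝ :=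
  ∑ u ∈ (Finset.range s).powerset.erase ∅, (γ u : ℝ) ^ lam * constG b α d lam d ^ u.card

end Lattice

end InterlacedQMC

end

/-!
The statement only asks for some exponents `κ` and `t`, so it is enough to show that the mean square
error of a constructed net is at most `S · (2 / (b ^ m - 1)) ^ δ` for some fixed `δ > 0`, where
`S = ∑ γ_u G ^ |u|` and `G` is the constant that belongs to `λ = 1`. No sharp decay of Walsh
coefficients is needed for that.

* **Representation.** Integration by parts against products of one-variable kernels writes `f` as
  `∑_a ∫ ∏_j K_{a_j}(x_j, y_j) f^{(a)}(y) dy`, the sum over all multi-indices `a ≤ α`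
  (`SobolevFunction.eq_sum_integral`). By Cauchy-Schwarz the squared worst-case error is at most
  `∑_{a ≠ 0} γ_{supp a} ∫ (N⁻¹ ∑_n ∏_j K_{a_j}(x_{n,j}, y_j))² dy` (`worstCaseError_sq_le`).
* **Trivial bound.** A shifted point is uniformly distributed, so the mean over the shifts of the
  terms with support `u` is at most `(1 / 9) ^ |u|` (`sum_shiftedIndexError_le_pow`).
* **Bound by the merit.** The kernels have mean zero and are Lipschitz in `x`. They are expanded in
  differences of their means over `b`-adic cells, and a product of such differences is integrated
  exactly by the net unless a linear form in the digits of the net has a nonvanishing character sum;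
  such a linear form yields an element of the dual net. So the terms with support `u` are at most
  `K ^ |u| X_u ^ (1 / A)`, where `X_u` is the part of the quality criterion that belongs to `u` and
  `A`, `K` depend on `b`, `α`, `d` only (`abs_average_prod_le`, `le_projectionMerit`,
  `sum_shiftedIndexError_le_merit`).
* **Construction.** Averaging over the last component shows that the criterion of a constructed
  vector is at most `2 / (b ^ m - 1)` times its value without the condition defining the dual net
  (`sub_one_mul_criterion_le`), which is at most `S` (`tsum_indexMerit_le`).
* **Interpolation.** The two bounds are interpolated with exponents `1 - θ` and `θ`. Since `G` is
  strictly larger than `1 / 9` (`one_div_nine_lt_constG`), a small `θ` keeps the base of the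
  geometric factor below `G`, and Hölder's inequality for the sum over `u` gives the claim with
  `δ = θ / A` (`exists_meanSquareError_le`).

Jensen's inequality gives `S ≤ S_λ ^ (1 / λ)` (`baseSum_le`), and the initial error is at least
`√γ_∅` because of the constant functions (`le_initialError`).
-/

noncomputable section

namespace InterlacedQMC

/-! ### One-variable kernels -/

/-- The square of `∫ f g` is at most `∫ f² ∫ g²`. -/
lemma sq_integral_mul_le {X : Type*} [MeasurableSpace X] {μ : Measure X} {f g : X → ℝ}
    (hf : Integrable (fun x => f x ^ 2) μ) (hg : Integrable (fun x => g x ^ 2) μ)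
    (hfg : Integrable (fun x => f x * g x) μ) :
    (∫ x, f x * g x ∂μ) ^ 2 ≤ (∫ x, f x ^ 2 ∂μ) * ∫ x, g x ^ 2 ∂μ := by
  have h : ∀ t : ℝ, 0 ≤ (∫ x, g x ^ 2 ∂μ) * (t * t) + (2 * ∫ x, f x * g x ∂μ) * t
      + ∫ x, f x ^ 2 ∂μ := by
    intro t
    have h0 : 0 ≤ ∫ x, (g x * t + f x) ^ 2 ∂μ := integral_nonneg fun x => sq_nonneg _
    have h1 : ∀ x, (g x * t + f x) ^ 2 = t * t * g x ^ 2 + 2 * t * (f x * g x) + f x ^ 2 := by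
      intro x; ring
    simp_rw [h1] at h0
    have h2 : Integrable (fun x => t * t * g x ^ 2 + 2 * t * (f x * g x)) μ :=
      (hg.const_mul _).add (hfg.const_mul _)
    rw [integral_add h2 hf, integral_add (hg.const_mul _) (hfg.const_mul _), integral_const_mul,
      integral_const_mul] at h0
    linarith
  have := discrim_le_zero h
  rw [discrim] at this
  nlinarith

/-- Lebesgue measure on `[0,1)`. -/
def unitMeasure : Measure ℝ := volume.restrict (Set.Ico 0 1)

instance : IsProbabilityMeasure unitMeasure := ⟨by simp [unitMeasure]⟩

lemma ae_unitMeasure : ∀ᵐ x ∂unitMeasure, x ∈ Set.Ico (0 : ℝ) 1 :=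
  ae_restrict_mem measurableSet_Ico

/-- An integral over `[0,1)` as an interval integral. -/
lemma integral_unitMeasure (f : ℝ → ℝ) : ∫ x, f x ∂unitMeasure = ∫ x in (0 : ℝ)..1, f x := by
  rw [intervalIntegral.integral_of_le zero_le_one, unitMeasure, integral_Ico_eq_integral_Ioc]

lemma integrable_of_bound {f : ℝ → ℝ} (hf : AEStronglyMeasurable f unitMeasure) {C : ℝ}
    (h : ∀ x ∈ Set.Ico (0 : ℝ) 1, |f x| ≤ C) : Integrable f unitMeasure :=
  Integrable.of_bound hf C (ae_unitMeasure.mono fun x hx => by simpa using h x hx)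

lemma abs_integral_le_of_bound {f : ℝ → ℝ} {C : ℝ}
    (h : ∀ x ∈ Set.Ico (0 : ℝ) 1, |f x| ≤ C) : |∫ x, f x ∂unitMeasure| ≤ C := by
  have := norm_integral_le_of_norm_le_const (μ := unitMeasure) (f := f) (C := C)
    (ae_unitMeasure.mono fun x hx => by simpa using h x hx)
  simpa using this

/-- The kernel for which `f x - ∫ f = ∫ k(x, y) f'(y) dy` on the unit interval. -/
def baseKernel (x y : ℝ) : ℝ := y - if x < y then 1 else 0

/-- The iterated kernel: `kernel a` is the kernel of the `(a + 1)`-st power of the integral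
operator with kernel `baseKernel`. -/
def kernel : ℕ → ℝ → ℝ → ℝ
  | 0 => baseKernel
  | a + 1 => fun x y => ∫ t, baseKernel t y * kernel a x t ∂unitMeasure

lemma abs_baseKernel_le {x y : ℝ} (hy : y ∈ Set.Ico (0 : ℝ) 1) : |baseKernel x y| ≤ 1 := by
  obtain ⟨h0, h1⟩ := hy
  unfold baseKernel
  split_ifs <;> rw [abs_le] <;> constructor <;> linarith

lemma measurable_baseKernel : Measurable fun p : ℝ × ℝ => baseKernel p.1 p.2 :=
  measurable_snd.sub (Measurable.ite (measurableSet_lt measurable_fst measurable_snd)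
    measurable_const measurable_const)

lemma stronglyMeasurable_kernel (a : ℕ) :
    StronglyMeasurable fun p : ℝ × ℝ => kernel a p.1 p.2 := by
  induction a with
  | zero => exact measurable_baseKernel.stronglyMeasurable
  | succ a ih =>
    apply StronglyMeasurable.integral_prod_right
      (f := fun (p : ℝ × ℝ) t => baseKernel t p.2 * kernel a p.1 t)
    have h1 : StronglyMeasurable fun q : (ℝ × ℝ) × ℝ => baseKernel q.2 q.1.2 :=
      (measurable_baseKernel.comp
        (measurable_snd.prodMk (measurable_snd.comp measurable_fst))).stronglyMeasurable
    have h2 : StronglyMeasurable fun q : (ℝ × ℝ) × ℝ => kernel a q.1.1 q.2 :=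
      ih.comp_measurable ((measurable_fst.comp measurable_fst).prodMk measurable_snd)
    exact h1.mul h2

lemma measurable_kernel_right (a : ℕ) (x : ℝ) : Measurable (kernel a x) :=
  ((stronglyMeasurable_kernel a).comp_measurable measurable_prodMk_left).measurable

lemma measurable_kernel_left (a : ℕ) (y : ℝ) : Measurable fun x => kernel a x y :=
  ((stronglyMeasurable_kernel a).comp_measurable measurable_prodMk_right).measurable

lemma measurable_baseKernel_left (y : ℝ) : Measurable fun x => baseKernel x y :=
  measurable_kernel_left 0 y

lemma abs_kernel_le (a : ℕ) (x : ℝ) {y : ℝ} (hy : y ∈ Set.Ico (0 : ℝ) 1) :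
    |kernel a x y| ≤ 1 := by
  induction a generalizing y with
  | zero => exact abs_baseKernel_le hy
  | succ a ih =>
    refine abs_integral_le_of_bound fun t ht => ?_
    rw [abs_mul]
    exact mul_le_one₀ (abs_baseKernel_le hy) (abs_nonneg _) (ih ht)

lemma integrable_kernel (a : ℕ) (x : ℝ) : Integrable (kernel a x) unitMeasure :=
  integrable_of_bound (measurable_kernel_right a x).aestronglyMeasurable
    fun _ hy => abs_kernel_le a x hy

/-- The first moments of the kernels over their second argument. -/
def kernelMean (a : ℕ) (x : ℝ) : ℝ := ∫ y, kernel a x y ∂unitMeasure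

lemma measurable_kernelMean (a : ℕ) : Measurable (kernelMean a) :=
  ((stronglyMeasurable_kernel a).integral_prod_right).measurable

lemma abs_kernelMean_le (a : ℕ) (x : ℝ) : |kernelMean a x| ≤ 1 :=
  abs_integral_le_of_bound fun _ hy => abs_kernel_le a x hy

lemma integrable_baseKernel_mul {h : ℝ → ℝ} (hh : Integrable h unitMeasure) {y : ℝ}
    (hy : y ∈ Set.Ico (0 : ℝ) 1) : Integrable (fun t => baseKernel t y * h t) unitMeasure :=
  hh.bdd_mul (measurable_baseKernel_left y).aestronglyMeasurable (c := 1)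
    (Eventually.of_forall fun t => by simpa using abs_baseKernel_le hy)

/-- The kernels are Lipschitz in their first argument, in the mean over the second. -/
lemma integral_abs_kernel_sub_le (a : ℕ) {x x' : ℝ} (hx : x ∈ Set.Ico (0 : ℝ) 1)
    (hx' : x' ∈ Set.Ico (0 : ℝ) 1) :
    ∫ y, |kernel a x y - kernel a x' y| ∂unitMeasure ≤ |x - x'| := by
  induction a with
  | zero =>
    wlog hxx : x' ≤ x generalizing x x'
    · have := this hx' hx (le_of_not_ge hxx)
      simp_rw [abs_sub_comm] at this ⊢
      exact this
    have h1 : ∀ y, |kernel 0 x y - kernel 0 x' y| = (Set.Ioc x' x).indicator 1 y := by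
      intro y
      simp only [kernel, baseKernel, Set.indicator, Set.mem_Ioc, Pi.one_apply]
      split_ifs <;> simp_all <;> linarith
    simp_rw [h1]
    rw [integral_indicator_one measurableSet_Ioc, unitMeasure,
      measureReal_restrict_apply measurableSet_Ioc]
    calc _ ≤ volume.real (Set.Ioc x' x) := measureReal_mono Set.inter_subset_left
          measure_Ioc_lt_top.ne
      _ = |x - x'| := by
        rw [Real.volume_real_Ioc_of_le hxx, abs_of_nonneg (sub_nonneg.2 hxx)]
  | succ a ih =>
    have key : ∀ y ∈ Set.Ico (0 : ℝ) 1, |kernel (a + 1) x y - kernel (a + 1) x' y| ≤ |x - x'| := by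
      intro y hy
      have hi := integrable_baseKernel_mul (integrable_kernel a x) hy
      have hi' := integrable_baseKernel_mul (integrable_kernel a x') hy
      simp only [kernel]
      rw [← integral_sub hi hi']
      refine (abs_integral_le_integral_abs).trans (le_trans ?_ ih)
      refine integral_mono_of_nonneg (Eventually.of_forall fun _ => abs_nonneg _)
        ((integrable_kernel a x).sub (integrable_kernel a x')).abs
        (Eventually.of_forall fun t => ?_)
      simp only [← mul_sub, abs_mul]
      exact mul_le_of_le_one_left (abs_nonneg _) (abs_baseKernel_le hy)
    refine (le_abs_self _).trans (abs_integral_le_of_bound fun y hy => ?_)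
    rw [abs_abs]
    exact key y hy

lemma abs_kernel_succ_sub_le (a : ℕ) {x x' y : ℝ} (hx : x ∈ Set.Ico (0 : ℝ) 1)
    (hx' : x' ∈ Set.Ico (0 : ℝ) 1) (hy : y ∈ Set.Ico (0 : ℝ) 1) :
    |kernel (a + 1) x y - kernel (a + 1) x' y| ≤ |x - x'| := by
  have hi := integrable_baseKernel_mul (integrable_kernel a x) hy
  have hi' := integrable_baseKernel_mul (integrable_kernel a x') hy
  simp only [kernel]
  rw [← integral_sub hi hi']
  refine (abs_integral_le_integral_abs).trans (le_trans ?_ (integral_abs_kernel_sub_le a hx hx'))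
  refine integral_mono_of_nonneg (Eventually.of_forall fun _ => abs_nonneg _)
    ((integrable_kernel a x).sub (integrable_kernel a x')).abs
    (Eventually.of_forall fun t => ?_)
  simp only [← mul_sub, abs_mul]
  exact mul_le_of_le_one_left (abs_nonneg _) (abs_baseKernel_le hy)

lemma abs_kernelMean_sub_le (a : ℕ) {x x' : ℝ} (hx : x ∈ Set.Ico (0 : ℝ) 1)
    (hx' : x' ∈ Set.Ico (0 : ℝ) 1) : |kernelMean a x - kernelMean a x'| ≤ |x - x'| := by
  rw [kernelMean, kernelMean, ← integral_sub (integrable_kernel a x) (integrable_kernel a x')]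
  exact (abs_integral_le_integral_abs).trans (integral_abs_kernel_sub_le a hx hx')

lemma integral_baseKernel_left {y : ℝ} (hy : y ∈ Set.Ico (0 : ℝ) 1) :
    ∫ x, baseKernel x y ∂unitMeasure = 0 := by
  have h1 : ∀ x, baseKernel x y = y - (Set.Iio y).indicator 1 x := by
    intro x
    simp [baseKernel, Set.indicator]
  have h2 : Integrable ((Set.Iio y).indicator (1 : ℝ → ℝ)) unitMeasure :=
    (integrable_const (1 : ℝ)).indicator measurableSet_Iio
  simp_rw [h1]
  rw [integral_sub (integrable_const _) h2, integral_const,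
    integral_indicator_one measurableSet_Iio, unitMeasure,
    measureReal_restrict_apply measurableSet_Iio]
  have : Set.Iio y ∩ Set.Ico 0 1 = Set.Ico 0 y := by
    ext t; simp only [Set.mem_inter_iff, Set.mem_Iio, Set.mem_Ico]
    exact ⟨fun h => ⟨h.2.1, h.1⟩, fun h => ⟨h.2, h.1, h.2.trans hy.2⟩⟩
  rw [this, Real.volume_real_Ico_of_le hy.1]
  simp

/-- Bounded jointly measurable functions on the unit square may be integrated in either order. -/
lemma integral_unit_swap {F : ℝ → ℝ → ℝ} (hF : StronglyMeasurable fun p : ℝ × ℝ => F p.1 p.2)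
    {C : ℝ} (h : ∀ x ∈ Set.Ico (0 : ℝ) 1, ∀ y ∈ Set.Ico (0 : ℝ) 1, |F x y| ≤ C) :
    ∫ x, ∫ y, F x y ∂unitMeasure ∂unitMeasure = ∫ y, ∫ x, F x y ∂unitMeasure ∂unitMeasure := by
  apply integral_integral_swap
  refine Integrable.of_bound hF.aestronglyMeasurable C ?_
  have h1 : ∀ᵐ p ∂(unitMeasure.prod unitMeasure), p ∈ Set.Ico (0 : ℝ) 1 ×ˢ Set.Ico (0 : ℝ) 1 := by
    rw [unitMeasure, Measure.prod_restrict]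
    exact ae_restrict_mem (measurableSet_Ico.prod measurableSet_Ico)
  filter_upwards [h1] with p hp
  exact h _ hp.1 _ hp.2

/-- Every kernel has mean zero over its first argument. -/
lemma integral_kernel_left (a : ℕ) {y : ℝ} (hy : y ∈ Set.Ico (0 : ℝ) 1) :
    ∫ x, kernel a x y ∂unitMeasure = 0 := by
  induction a generalizing y with
  | zero => exact integral_baseKernel_left hy
  | succ a ih =>
    simp only [kernel]
    rw [integral_unit_swap (C := 1)]
    · rw [integral_congr_ae (g := fun _ => 0)]
      · simp
      · filter_upwards [ae_unitMeasure] with t ht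
        rw [integral_const_mul, ih ht, mul_zero]
    · exact ((measurable_baseKernel_left y).comp measurable_snd).stronglyMeasurable.mul
        (stronglyMeasurable_kernel a)
    · intro x _ t ht
      rw [abs_mul]
      exact mul_le_one₀ (abs_baseKernel_le hy) (abs_nonneg _) (abs_kernel_le a x ht)

lemma integral_kernelMean (a : ℕ) : ∫ x, kernelMean a x ∂unitMeasure = 0 := by
  simp only [kernelMean]
  rw [integral_unit_swap (stronglyMeasurable_kernel a) (C := 1)
    fun x _ y hy => abs_kernel_le a x hy, integral_congr_ae (g := fun _ => 0)]
  · simp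
  · filter_upwards [ae_unitMeasure] with t ht
    exact integral_kernel_left a ht

/-- The squared Hilbert–Schmidt norm of the kernels. -/
def kernelSq (a : ℕ) : ℝ := ∫ x, ∫ y, kernel a x y ^ 2 ∂unitMeasure ∂unitMeasure

/-- The squared norm of the kernel means. -/
def kernelMeanSq (a : ℕ) : ℝ := ∫ x, kernelMean a x ^ 2 ∂unitMeasure

lemma abs_kernel_sq_le (a : ℕ) (x : ℝ) {y : ℝ} (hy : y ∈ Set.Ico (0 : ℝ) 1) :
    |kernel a x y ^ 2| ≤ 1 := by
  rw [abs_pow]; exact pow_le_one₀ (abs_nonneg _) (abs_kernel_le a x hy)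

lemma integrable_kernel_sq (a : ℕ) (x : ℝ) :
    Integrable (fun y => kernel a x y ^ 2) unitMeasure :=
  integrable_of_bound ((measurable_kernel_right a x).pow_const 2).aestronglyMeasurable
    fun _ hy => abs_kernel_sq_le a x hy

lemma integrable_integral_kernel_sq (a : ℕ) :
    Integrable (fun x => ∫ y, kernel a x y ^ 2 ∂unitMeasure) unitMeasure := by
  refine integrable_of_bound (C := 1)
    ((stronglyMeasurable_kernel a).pow 2).integral_prod_right.aestronglyMeasurable fun x _ => ?_
  exact abs_integral_le_of_bound fun y hy => abs_kernel_sq_le a x hy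

lemma integral_baseKernel_sq_left {y : ℝ} (hy : y ∈ Set.Ico (0 : ℝ) 1) :
    ∫ x, baseKernel x y ^ 2 ∂unitMeasure = y - y ^ 2 := by
  have h1 : ∀ x, baseKernel x y ^ 2 = (1 - 2 * y) * (y - baseKernel x y) + y ^ 2 := by
    intro x
    unfold baseKernel
    split_ifs <;> ring
  have hi : Integrable (fun x => baseKernel x y) unitMeasure :=
    integrable_of_bound (measurable_baseKernel_left y).aestronglyMeasurable
      fun _ _ => abs_baseKernel_le hy
  have hi' : Integrable (fun x => y - baseKernel x y) unitMeasure := (integrable_const _).sub hi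
  simp_rw [h1]
  rw [integral_add (hi'.const_mul _) (integrable_const _),
    integral_const_mul, integral_sub (integrable_const _) hi, integral_baseKernel_left hy]
  simp
  ring

lemma integral_sub_sq_unit : ∫ y, (y - y ^ 2) ∂unitMeasure = 1 / 6 := by
  rw [integral_unitMeasure, intervalIntegral.integral_sub
    (Continuous.intervalIntegrable (by fun_prop) _ _)
    (Continuous.intervalIntegrable (by fun_prop) _ _), integral_pow, integral_id]
  norm_num

lemma kernelSq_zero : kernelSq 0 = 1 / 6 := by
  rw [kernelSq, integral_unit_swap ((stronglyMeasurable_kernel 0).pow 2) (C := 1)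
    fun x _ y hy => abs_kernel_sq_le 0 x hy, ← integral_sub_sq_unit]
  refine integral_congr_ae ?_
  filter_upwards [ae_unitMeasure] with y hy
  exact integral_baseKernel_sq_left hy

lemma kernelSq_nonneg (a : ℕ) : 0 ≤ kernelSq a :=
  integral_nonneg fun _ => integral_nonneg fun _ => sq_nonneg _

lemma kernelSq_succ_le (a : ℕ) : kernelSq (a + 1) ≤ 1 / 6 * kernelSq a := by
  have key : ∀ x, ∫ y, kernel (a + 1) x y ^ 2 ∂unitMeasure ≤
      1 / 6 * ∫ y, kernel a x y ^ 2 ∂unitMeasure := by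
    intro x
    rw [← integral_sub_sq_unit, ← integral_mul_const]
    refine integral_mono_ae (integrable_kernel_sq _ _) ?_ ?_
    · refine Integrable.mul_const ?_ _
      refine integrable_of_bound (C := 1) (by fun_prop) fun y hy => ?_
      rw [abs_le]; constructor <;> nlinarith [hy.1, hy.2]
    · filter_upwards [ae_unitMeasure] with y hy
      rw [← integral_baseKernel_sq_left hy]
      refine sq_integral_mul_le ?_ (integrable_kernel_sq a x)
        (integrable_baseKernel_mul (integrable_kernel a x) hy)
      exact integrable_of_bound ((measurable_baseKernel_left y).pow_const 2).aestronglyMeasurable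
        fun t _ => abs_kernel_sq_le 0 t hy
  rw [kernelSq, kernelSq, ← integral_const_mul]
  exact integral_mono (integrable_integral_kernel_sq _)
    ((integrable_integral_kernel_sq _).const_mul _) key

lemma kernelMean_zero {x : ℝ} (hx : x ∈ Set.Ico (0 : ℝ) 1) : kernelMean 0 x = x - 1 / 2 := by
  have h1 : ∀ y, kernel 0 x y = y - (Set.Ioi x).indicator 1 y := by
    intro y
    simp [kernel, baseKernel, Set.indicator]
  have h2 : Integrable ((Set.Ioi x).indicator (1 : ℝ → ℝ)) unitMeasure :=
    (integrable_const (1 : ℝ)).indicator measurableSet_Ioi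
  have h3 : Integrable (fun y : ℝ => y) unitMeasure :=
    integrable_of_bound (C := 1) (by fun_prop) fun y hy => by
      rw [abs_le]; constructor <;> linarith [hy.1, hy.2]
  rw [kernelMean]
  simp_rw [h1]
  rw [integral_sub h3 h2,
    integral_indicator_one measurableSet_Ioi, integral_unitMeasure, unitMeasure,
    measureReal_restrict_apply measurableSet_Ioi]
  have : Set.Ioi x ∩ Set.Ico 0 1 = Set.Ioo x 1 := by
    ext t; simp only [Set.mem_inter_iff, Set.mem_Ioi, Set.mem_Ico, Set.mem_Ioo]
    exact ⟨fun h => ⟨h.1, h.2.2⟩, fun h => ⟨h.1, hx.1.trans h.1.le, h.2⟩⟩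
  rw [this, Real.volume_real_Ioo_of_le hx.2.le]
  simp
  ring

lemma kernelMeanSq_zero : kernelMeanSq 0 = 1 / 12 := by
  have h : kernelMeanSq 0 = ∫ x, (x - 1 / 2) ^ 2 ∂unitMeasure := by
    refine integral_congr_ae ?_
    filter_upwards [ae_unitMeasure] with y hy
    simp only [kernelMean_zero hy]
  rw [h, integral_unitMeasure, intervalIntegral.integral_comp_sub_right (fun x => x ^ 2),
    integral_pow]
  norm_num

lemma kernelMean_succ (a : ℕ) (x : ℝ) :
    kernelMean (a + 1) x = ∫ t, kernelMean 0 t * kernel a x t ∂unitMeasure := by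
  simp only [kernelMean, kernel]
  rw [integral_unit_swap (F := fun y t => baseKernel t y * kernel a x t) (C := 1)]
  · simp_rw [integral_mul_const]
  · exact (measurable_baseKernel.comp measurable_swap).stronglyMeasurable.mul
      ((measurable_kernel_right a x).comp measurable_snd).stronglyMeasurable
  · intro y hy t ht
    rw [abs_mul]
    exact mul_le_one₀ (abs_baseKernel_le hy) (abs_nonneg _) (abs_kernel_le a x ht)

lemma integrable_kernelMean_sq (a : ℕ) :
    Integrable (fun x => kernelMean a x ^ 2) unitMeasure := by
  refine integrable_of_bound (C := 1)
    ((measurable_kernelMean a).pow_const 2).aestronglyMeasurable fun x _ => ?_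
  rw [abs_pow]; exact pow_le_one₀ (abs_nonneg _) (abs_kernelMean_le a x)

lemma kernelMeanSq_succ_le (a : ℕ) : kernelMeanSq (a + 1) ≤ 1 / 12 * kernelSq a := by
  have key : ∀ x, kernelMean (a + 1) x ^ 2 ≤ 1 / 12 * ∫ y, kernel a x y ^ 2 ∂unitMeasure := by
    intro x
    rw [kernelMean_succ, ← kernelMeanSq_zero]
    refine sq_integral_mul_le (integrable_kernelMean_sq 0) (integrable_kernel_sq a x) ?_
    refine (integrable_kernel a x).bdd_mul (measurable_kernelMean 0).aestronglyMeasurable (c := 1)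
      (Eventually.of_forall fun t => by simpa using abs_kernelMean_le 0 t)
  rw [kernelMeanSq, kernelSq, ← integral_const_mul]
  exact integral_mono (integrable_kernelMean_sq _)
    ((integrable_integral_kernel_sq _).const_mul _) key

lemma kernelSq_le (a : ℕ) : kernelSq a ≤ (1 / 6) ^ (a + 1) := by
  induction a with
  | zero => rw [kernelSq_zero]; norm_num
  | succ a ih =>
    refine (kernelSq_succ_le a).trans ?_
    rw [pow_succ' _ (a + 1)]
    gcongr

/-- The kernels of the representation of a function by its derivatives of order at most `α`: the
derivative of order `a` enters by the integral against `sobolevKernel α a x`. -/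
def sobolevKernel (α : ℕ) : ℕ → ℝ → ℝ → ℝ
  | 0 => fun _ _ => 1
  | a + 1 => fun x y => if a + 1 < α then kernelMean a x else kernel a x y

lemma measurable_sobolevKernel (α a : ℕ) :
    Measurable fun p : ℝ × ℝ => sobolevKernel α a p.1 p.2 := by
  cases a with
  | zero => exact measurable_const
  | succ a =>
    simp only [sobolevKernel]
    split_ifs
    · exact (measurable_kernelMean a).comp measurable_fst
    · exact (stronglyMeasurable_kernel a).measurable

lemma abs_sobolevKernel_le (α a : ℕ) (x : ℝ) {y : ℝ} (hy : y ∈ Set.Ico (0 : ℝ) 1) :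
    |sobolevKernel α a x y| ≤ 1 := by
  cases a with
  | zero => simp [sobolevKernel]
  | succ a =>
    simp only [sobolevKernel]
    split_ifs
    · exact abs_kernelMean_le a x
    · exact abs_kernel_le a x hy

lemma abs_sobolevKernel_sub_le {α : ℕ} (hα : 2 ≤ α) (a : ℕ) {x x' y : ℝ}
    (hx : x ∈ Set.Ico (0 : ℝ) 1) (hx' : x' ∈ Set.Ico (0 : ℝ) 1) (hy : y ∈ Set.Ico (0 : ℝ) 1) :
    |sobolevKernel α a x y - sobolevKernel α a x' y| ≤ |x - x'| := by
  match a with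
  | 0 => simp [sobolevKernel]
  | 1 =>
    simp only [sobolevKernel, if_pos (show 0 + 1 < α by lia)]
    exact abs_kernelMean_sub_le 0 hx hx'
  | a + 2 =>
    simp only [sobolevKernel]
    split_ifs
    · exact abs_kernelMean_sub_le _ hx hx'
    · exact abs_kernel_succ_sub_le a hx hx' hy

lemma integral_sobolevKernel_left (α : ℕ) {a : ℕ} (ha : a ≠ 0) {y : ℝ}
    (hy : y ∈ Set.Ico (0 : ℝ) 1) : ∫ x, sobolevKernel α a x y ∂unitMeasure = 0 := by
  obtain ⟨a, rfl⟩ := Nat.exists_eq_succ_of_ne_zero ha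
  simp only [sobolevKernel]
  split_ifs
  · exact integral_kernelMean a
  · exact integral_kernel_left a hy

/-- The squared Hilbert–Schmidt norm of `sobolevKernel`. -/
def sobolevKernelSq (α a : ℕ) : ℝ≥0∞ :=
  ∫⁻ x, ∫⁻ y, ENNReal.ofReal (sobolevKernel α a x y ^ 2) ∂unitMeasure ∂unitMeasure

lemma sobolevKernelSq_zero (α : ℕ) : sobolevKernelSq α 0 = 1 := by
  simp [sobolevKernelSq, sobolevKernel]

lemma sobolevKernelSq_succ (α a : ℕ) : sobolevKernelSq α (a + 1) =
    ENNReal.ofReal (if a + 1 < α then kernelMeanSq a else kernelSq a) := by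
  simp only [sobolevKernelSq, sobolevKernel]
  split_ifs
  · simp only [lintegral_const, measure_univ, mul_one]
    exact (ofReal_integral_eq_lintegral_ofReal (integrable_kernelMean_sq a)
      (Eventually.of_forall fun _ => sq_nonneg _)).symm
  · rw [kernelSq, ofReal_integral_eq_lintegral_ofReal (integrable_integral_kernel_sq a)
      (Eventually.of_forall fun _ => integral_nonneg fun _ => sq_nonneg _)]
    refine lintegral_congr fun x => ?_
    exact (ofReal_integral_eq_lintegral_ofReal (integrable_kernel_sq a x)
      (Eventually.of_forall fun _ => sq_nonneg _)).symm

/-- The total mass of the kernels of positive order is at most `1 / 9`. -/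
lemma sum_sobolevKernelSq_le {α : ℕ} (hα : 2 ≤ α) :
    ∑ a ∈ Finset.Icc 1 α, sobolevKernelSq α a ≤ ENNReal.ofReal (1 / 9) := by
  obtain ⟨n, rfl⟩ := Nat.exists_eq_add_of_le hα
  have h1 : ∑ a ∈ Finset.Icc 1 (2 + n), sobolevKernelSq (2 + n) a =
      ∑ a ∈ Finset.range (n + 2), ENNReal.ofReal
        (if a + 1 < 2 + n then kernelMeanSq a else kernelSq a) := by
    rw [← Finset.Ico_add_one_right_eq_Icc, Finset.sum_Ico_eq_sum_range]
    refine Finset.sum_congr (by congr 1; lia) fun a _ => ?_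
    rw [add_comm 1 a, sobolevKernelSq_succ]
  have hmean : ∀ a, 0 ≤ kernelMeanSq a := fun a => integral_nonneg fun _ => sq_nonneg _
  rw [h1, ← ENNReal.ofReal_sum_of_nonneg fun a _ => by
    split_ifs
    exacts [hmean a, kernelSq_nonneg a]]
  refine ENNReal.ofReal_le_ofReal ?_
  rw [Finset.sum_range_succ, if_neg (by lia), Finset.sum_congr rfl fun a ha => if_pos
    (show a + 1 < 2 + n by have := Finset.mem_range.1 ha; lia)]
  -- the partial sums of the geometric series that dominates the norms of the kernel means
  have h2 : ∑ a ∈ Finset.range (n + 1), kernelMeanSq a ≤ 1 / 10 * (1 - (1 / 6) ^ (n + 1)) := by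
    induction n with
    | zero => rw [Finset.sum_range_one, kernelMeanSq_zero]; norm_num
    | succ n ih =>
      rw [Finset.sum_range_succ]
      have h3 := ih (by lia) (by
        rw [← Finset.Ico_add_one_right_eq_Icc, Finset.sum_Ico_eq_sum_range]
        refine Finset.sum_congr (by congr 1; lia) fun a _ => ?_
        rw [add_comm 1 a, sobolevKernelSq_succ])
      have h4 := kernelMeanSq_succ_le n
      have h5 := kernelSq_le n
      rw [pow_succ _ (n + 1)]
      linarith
  have h5 := kernelSq_le (n + 1)
  have h6 : (1 / 6 : ℝ) ^ n ≤ 1 := pow_le_one₀ (by norm_num) (by norm_num)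
  rw [pow_succ, pow_succ] at h5
  rw [pow_succ] at h2
  linarith

/-! ### Integration by parts against products of smooth functions -/

lemma cubeMeasure_eq_pi (s : ℕ) : cubeMeasure s = Measure.pi fun _ => unitMeasure := by
  rw [cubeMeasure, cube, volume_pi, Measure.restrict_pi_pi]
  rfl

instance (s : ℕ) : IsProbabilityMeasure (cubeMeasure s) := by
  rw [cubeMeasure_eq_pi]; infer_instance

lemma measurableSet_cube (s : ℕ) : MeasurableSet (cube s) :=
  MeasurableSet.univ_pi fun _ => measurableSet_Ico

lemma ae_cubeMeasure (s : ℕ) : ∀ᵐ x ∂cubeMeasure s, x ∈ cube s :=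
  ae_restrict_mem (measurableSet_cube s)

lemma mem_cube {s : ℕ} {x : Fin s → ℝ} : x ∈ cube s ↔ ∀ i, x i ∈ Set.Ico (0 : ℝ) 1 := by
  simp [cube, Set.mem_pi]

lemma ae_cubeMeasure_pos (s : ℕ) : ∀ᵐ x ∂cubeMeasure s, ∀ i, x i ∈ Set.Ioo (0 : ℝ) 1 := by
  rw [cubeMeasure_eq_pi, ae_all_iff]
  intro i
  have h : ∀ᵐ t ∂unitMeasure, t ∈ Set.Ioo (0 : ℝ) 1 := by
    rw [unitMeasure, Measure.restrict_congr_set Ioo_ae_eq_Ico.symm]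
    exact ae_restrict_mem measurableSet_Ioo
  exact (Measure.quasiMeasurePreserving_eval (fun _ : Fin s => unitMeasure) i).ae h

/-- A bound for the derivative of the smooth transition function, which lives on `[0,1]`. -/
lemma exists_deriv_smoothTransition_bound : ∃ B : ℝ, 0 ≤ B ∧ ∀ t : ℝ, -1 ≤ t →
    |(t + 1) * deriv Real.smoothTransition t| ≤ B := by
  have hc : Continuous (fun t => (t + 1) * deriv Real.smoothTransition t) :=
    (continuous_id.add continuous_const).mul
      (Real.smoothTransition.contDiff.continuous_deriv (n := 1) le_rfl)
  obtain ⟨B, hB⟩ := isCompact_Icc.exists_bound_of_continuousOn (s := Set.Icc (-1 : ℝ) 1)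
    hc.continuousOn
  refine ⟨max B 0, le_max_right _ _, fun t ht => ?_⟩
  rcases le_or_gt t 1 with h | h
  · exact (hB t ⟨ht, h⟩).trans (le_max_left _ _)
  · have : deriv Real.smoothTransition t = 0 := by
      have h1 : Real.smoothTransition =ᶠ[𝓝 t] fun _ => 1 := by
        filter_upwards [lt_mem_nhds h] with x hx
        exact Real.smoothTransition.one_of_one_le hx.le
      rw [h1.deriv_eq, deriv_const]
    simp [this]

/-- Smooth cut-off functions exhausting the open unit interval. -/
def cutoff (n : ℕ) (y : ℝ) : ℝ :=
  Real.smoothTransition ((n + 1) * y - 1) * Real.smoothTransition ((n + 1) * (1 - y) - 1)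

lemma contDiff_cutoff (n : ℕ) : ContDiff ℝ (⊤ : ℕ∞) (cutoff n) :=
  (Real.smoothTransition.contDiff.comp (by fun_prop)).mul
    (Real.smoothTransition.contDiff.comp (by fun_prop))

lemma tsupport_cutoff (n : ℕ) :
    tsupport (cutoff n) ⊆ Set.Icc (1 / ((n : ℝ) + 1)) (1 - 1 / ((n : ℝ) + 1)) := by
  refine closure_minimal (fun y hy => ?_) isClosed_Icc
  have hn : (0 : ℝ) < n + 1 := by positivity
  have h := Function.mem_support.1 hy
  have h1 : 0 < (n + 1) * y - 1 := by
    by_contra hc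
    exact h (by simp [cutoff, Real.smoothTransition.zero_of_nonpos (not_lt.1 hc)])
  have h2 : 0 < (n + 1) * (1 - y) - 1 := by
    by_contra hc
    exact h (by simp [cutoff, Real.smoothTransition.zero_of_nonpos (not_lt.1 hc)])
  constructor
  · rw [div_le_iff₀ hn]; linarith
  · have : 1 / ((n : ℝ) + 1) ≤ 1 - y := by rw [div_le_iff₀ hn]; linarith
    linarith

lemma abs_cutoff_le (n : ℕ) (y : ℝ) : |cutoff n y| ≤ 1 := by
  rw [cutoff, abs_mul, abs_of_nonneg (Real.smoothTransition.nonneg _),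
    abs_of_nonneg (Real.smoothTransition.nonneg _)]
  exact mul_le_one₀ (Real.smoothTransition.le_one _) (Real.smoothTransition.nonneg _)
    (Real.smoothTransition.le_one _)

lemma eventually_cutoff_eq {y : ℝ} (hy : y ∈ Set.Ioo (0 : ℝ) 1) :
    ∀ᶠ n : ℕ in atTop, cutoff n =ᶠ[𝓝 y] fun _ => 1 := by
  have h1 : ∀ᶠ n : ℕ in atTop, 2 < ((n : ℝ) + 1) * y :=
    ((tendsto_natCast_atTop_atTop.atTop_add tendsto_const_nhds).atTop_mul_const
      hy.1).eventually_gt_atTop 2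
  have h2 : ∀ᶠ n : ℕ in atTop, 2 < ((n : ℝ) + 1) * (1 - y) :=
    ((tendsto_natCast_atTop_atTop.atTop_add tendsto_const_nhds).atTop_mul_const
      (sub_pos.2 hy.2)).eventually_gt_atTop 2
  filter_upwards [h1, h2] with n hn1 hn2
  have c1 : Continuous fun z : ℝ => ((n : ℝ) + 1) * z := by fun_prop
  have c2 : Continuous fun z : ℝ => ((n : ℝ) + 1) * (1 - z) := by fun_prop
  filter_upwards [(c1.tendsto y).eventually (lt_mem_nhds hn1),
    (c2.tendsto y).eventually (lt_mem_nhds hn2)] with z hz1 hz2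
  rw [cutoff, Real.smoothTransition.one_of_one_le (by linarith),
    Real.smoothTransition.one_of_one_le (by linarith), one_mul]

lemma tendsto_cutoff {y : ℝ} (hy : y ∈ Set.Ioo (0 : ℝ) 1) :
    Tendsto (fun n => cutoff n y) atTop (𝓝 1) :=
  tendsto_const_nhds.congr' ((eventually_cutoff_eq hy).mono fun _ h => h.eq_of_nhds.symm)

lemma tendsto_deriv_cutoff {y : ℝ} (hy : y ∈ Set.Ioo (0 : ℝ) 1) :
    Tendsto (fun n => deriv (cutoff n) y) atTop (𝓝 0) :=
  tendsto_const_nhds.congr' ((eventually_cutoff_eq hy).mono fun _ h => by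
    simp only [h.deriv_eq, deriv_const])

/-- Although the derivatives of the cut-off functions are unbounded near the end points, their
products with a function that vanishes there are bounded. -/
lemma exists_deriv_cutoff_bound : ∃ B : ℝ, 0 ≤ B ∧ ∀ (n : ℕ) (y : ℝ) (C v : ℝ),
    y ∈ Set.Icc (0 : ℝ) 1 → |v| ≤ C * y → |v| ≤ C * (1 - y) → 0 ≤ C →
    |v * deriv (cutoff n) y| ≤ C * B := by
  obtain ⟨B, hB0, hB⟩ := exists_deriv_smoothTransition_bound
  refine ⟨B + B, by positivity, fun n y C v hy hv1 hv2 hC => ?_⟩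
  have hn : (0 : ℝ) < n + 1 := by positivity
  have hd : ∀ t, HasDerivAt Real.smoothTransition (deriv Real.smoothTransition t) t := fun t =>
    ((Real.smoothTransition.contDiff (n := 1)).differentiable one_ne_zero t).hasDerivAt
  have e1 : HasDerivAt (fun y : ℝ => ((n : ℝ) + 1) * y - 1) (n + 1) y := by
    simpa using ((hasDerivAt_id y).const_mul ((n : ℝ) + 1)).sub_const 1
  have e2 : HasDerivAt (fun y : ℝ => ((n : ℝ) + 1) * (1 - y) - 1) (-(n + 1)) y := by
    simpa using (((hasDerivAt_id y).const_sub 1).const_mul ((n : ℝ) + 1)).sub_const 1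
  have h1 := ((hd _).comp y e1).mul ((hd _).comp y e2)
  have h2 : deriv (cutoff n) y = _ := h1.deriv
  have b1 := hB ((n + 1) * y - 1) (by nlinarith [hy.1])
  have b2 := hB ((n + 1) * (1 - y) - 1) (by nlinarith [hy.2])
  rw [sub_add_cancel] at b1 b2
  rw [h2]
  set p := deriv Real.smoothTransition ((n + 1) * y - 1)
  set q := deriv Real.smoothTransition ((n + 1) * (1 - y) - 1)
  have f1 : |v * ((n + 1) * p)| ≤ C * B := by
    rw [abs_mul]
    calc _ ≤ C * y * |(n + 1) * p| := by gcongr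
      _ = C * |(n + 1) * y * p| := by
        rw [abs_mul, abs_mul, abs_mul, abs_of_nonneg hy.1]; ring
      _ ≤ C * B := by gcongr
  have f2 : |v * ((n + 1) * q)| ≤ C * B := by
    rw [abs_mul]
    calc _ ≤ C * (1 - y) * |(n + 1) * q| := by gcongr
      _ = C * |(n + 1) * (1 - y) * q| := by
        rw [abs_mul, abs_mul, abs_mul, abs_of_nonneg (sub_nonneg.2 hy.2)]; ring
      _ ≤ C * B := by gcongr
  simp only [Function.comp]
  have s1 : ∀ t, |Real.smoothTransition t| ≤ 1 := fun t => by
    rw [abs_of_nonneg (Real.smoothTransition.nonneg _)]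
    exact Real.smoothTransition.le_one _
  set S1 := Real.smoothTransition ((n + 1) * y - 1)
  set S2 := Real.smoothTransition ((n + 1) * (1 - y) - 1)
  calc |v * (p * (n + 1) * S2 + S1 * (q * -(n + 1)))|
      = |v * ((n + 1) * p) * S2 - v * ((n + 1) * q) * S1| := by ring_nf
    _ ≤ |v * ((n + 1) * p) * S2| + |v * ((n + 1) * q) * S1| := abs_sub _ _
    _ ≤ C * B * 1 + C * B * 1 := by
      rw [abs_mul _ S2, abs_mul _ S1]
      gcongr
      · exact s1 _
      · exact s1 _
    _ = C * (B + B) := by ring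

/-- The integral of `g` against a product of functions of one variable. -/
def pairing {s : ℕ} (g : (Fin s → ℝ) → ℝ) (χ : Fin s → ℝ → ℝ) : ℝ :=
  ∫ x, g x * ∏ i, χ i (x i) ∂cubeMeasure s

lemma pairing_update {s : ℕ} (g : (Fin s → ℝ) → ℝ) (χ : Fin s → ℝ → ℝ) (j : Fin s) (h : ℝ → ℝ) :
    pairing g (Function.update χ j h) =
      ∫ x, g x * (h (x j) * ∏ i ∈ Finset.univ.erase j, χ i (x i)) ∂cubeMeasure s := by
  refine integral_congr_ae (Eventually.of_forall fun x => ?_)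
  simp only
  rw [← Finset.mul_prod_erase Finset.univ _ (Finset.mem_univ j), Function.update_self]
  congr 2
  refine Finset.prod_congr rfl fun i hi => ?_
  rw [Function.update_of_ne (Finset.ne_of_mem_erase hi)]

lemma fderiv_prod_single {s : ℕ} {χ : Fin s → ℝ → ℝ} (hχ : ∀ i, Differentiable ℝ (χ i))
    (x : Fin s → ℝ) (j : Fin s) :
    fderiv ℝ (fun x => ∏ i, χ i (x i)) x (Pi.single j 1) =
      deriv (χ j) (x j) * ∏ i ∈ Finset.univ.erase j, χ i (x i) := by
  have h : ∀ i ∈ Finset.univ, HasFDerivAt (fun x : Fin s → ℝ => χ i (x i))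
      (deriv (χ i) (x i) • ContinuousLinearMap.proj (R := ℝ) (φ := fun _ => ℝ) i) x := by
    intro i _
    exact (hχ i (x i)).hasDerivAt.comp_hasFDerivAt x (hasFDerivAt_apply i x)
  rw [(HasFDerivAt.finsetProd h).fderiv]
  simp only [sum_apply, smul_apply,
    ContinuousLinearMap.proj_apply, smul_eq_mul]
  rw [Finset.sum_eq_single j]
  · simp; ring
  · intro i _ hij
    simp [Pi.single_eq_of_ne hij]
  · simp

lemma exists_bound_on_unit {h : ℝ → ℝ} (hh : Continuous h) :
    ∃ C : ℝ, 0 ≤ C ∧ ∀ y ∈ Set.Icc (0 : ℝ) 1, |h y| ≤ C := by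
  obtain ⟨C, hC⟩ := isCompact_Icc.exists_bound_of_continuousOn (s := Set.Icc (0 : ℝ) 1)
    hh.continuousOn
  exact ⟨max C 0, le_max_right _ _, fun y hy => (hC y hy).trans (le_max_left _ _)⟩

/-- A smooth function that vanishes at the end points of the unit interval is dominated by the
distance to each of them. -/
lemma exists_linear_bound {Θ : ℝ → ℝ} (hΘ : ContDiff ℝ (⊤ : ℕ∞) Θ) (h0 : Θ 0 = 0)
    (h1 : Θ 1 = 0) : ∃ C : ℝ, 0 ≤ C ∧ ∀ y ∈ Set.Icc (0 : ℝ) 1,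
      |Θ y| ≤ C * y ∧ |Θ y| ≤ C * (1 - y) := by
  obtain ⟨C, hC0, hC⟩ := exists_bound_on_unit (hΘ.continuous_deriv (by simp))
  refine ⟨C, hC0, fun y hy => ?_⟩
  have hd : ∀ z ∈ Set.Icc (0 : ℝ) 1, DifferentiableAt ℝ Θ z :=
    fun z _ => hΘ.differentiable (by simp) z
  have a := (convex_Icc (0 : ℝ) 1).norm_image_sub_le_of_norm_deriv_le hd hC
    (Set.left_mem_Icc.2 zero_le_one) hy
  have b := (convex_Icc (0 : ℝ) 1).norm_image_sub_le_of_norm_deriv_le hd hC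
    hy (Set.right_mem_Icc.2 zero_le_one)
  rw [h0] at a
  rw [h1] at b
  simp only [sub_zero, zero_sub, Real.norm_eq_abs, abs_neg, abs_of_nonneg hy.1,
    abs_of_nonneg (sub_nonneg.2 hy.2)] at a b
  exact ⟨a, b⟩

/-- The weak derivative may be tested against products of smooth functions whose factor in the
direction of differentiation vanishes at the end points; the other factors are arbitrary. -/
lemma IsWeakPartial.integral_eq {s : ℕ} {j : Fin s} {g g' : (Fin s → ℝ) → ℝ}
    (hw : IsWeakPartial j g g') (hg : Integrable g (cubeMeasure s))
    (hg' : Integrable g' (cubeMeasure s)) {χ : Fin s → ℝ → ℝ}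
    (hχ : ∀ i, ContDiff ℝ (⊤ : ℕ∞) (χ i)) (h0 : χ j 0 = 0) (h1 : χ j 1 = 0) :
    pairing g (Function.update χ j (deriv (χ j))) = - pairing g' χ := by
  set ψ : ℕ → Fin s → ℝ → ℝ := fun n i y => cutoff n y * χ i y with hψ
  have hψs : ∀ n i, ContDiff ℝ (⊤ : ℕ∞) (ψ n i) := fun n i => (contDiff_cutoff n).mul (hχ i)
  have hts : ∀ n i, tsupport (ψ n i) ⊆ Set.Icc (1 / ((n : ℝ) + 1)) (1 - 1 / ((n : ℝ) + 1)) :=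
    fun n i => (tsupport_mul_subset_left).trans (tsupport_cutoff n)
  choose C hC0 hC using fun i => exists_bound_on_unit (hχ i).continuous
  obtain ⟨D, hD0, hD⟩ := exists_bound_on_unit ((hχ j).continuous_deriv (by simp))
  obtain ⟨E, hE0, hE⟩ := exists_linear_bound (hχ j) h0 h1
  obtain ⟨B, hB0, hB⟩ := exists_deriv_cutoff_bound
  have bψ : ∀ n i, ∀ y ∈ Set.Icc (0 : ℝ) 1, |ψ n i y| ≤ C i := fun n i y hy => by
    rw [hψ]; simp only [abs_mul]
    exact (mul_le_of_le_one_left (abs_nonneg _) (abs_cutoff_le n y)).trans (hC i y hy)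
  have dψ : ∀ n y, deriv (ψ n j) y = deriv (cutoff n) y * χ j y + cutoff n y * deriv (χ j) y :=
    fun n y => deriv_fun_mul ((contDiff_cutoff n).differentiable (by simp) y)
      ((hχ j).differentiable (by simp) y)
  have bdψ : ∀ n, ∀ y ∈ Set.Icc (0 : ℝ) 1, |deriv (ψ n j) y| ≤ E * B + D := fun n y hy => by
    rw [dψ]
    refine (abs_add_le _ _).trans (add_le_add ?_ ?_)
    · rw [mul_comm]
      exact hB n y E _ hy (hE y hy).1 (hE y hy).2 hE0
    · rw [abs_mul]
      exact (mul_le_of_le_one_left (abs_nonneg _) (abs_cutoff_le n y)).trans (hD y hy)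
  have key : ∀ n, ∫ x, g x * (deriv (ψ n j) (x j) * ∏ i ∈ Finset.univ.erase j, ψ n i (x i))
      ∂cubeMeasure s = - ∫ x, g' x * ∏ i, ψ n i (x i) ∂cubeMeasure s := by
    intro n
    have hsub : tsupport (fun x : Fin s → ℝ => ∏ i, ψ n i (x i)) ⊆
        Set.univ.pi fun _ => Set.Icc (1 / ((n : ℝ) + 1)) (1 - 1 / ((n : ℝ) + 1)) := by
      refine closure_minimal (fun x hx i _ => ?_) (isClosed_set_pi fun _ _ => isClosed_Icc)
      refine hts n i (subset_tsupport _ ?_)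
      exact Finset.prod_ne_zero_iff.1 hx i (Finset.mem_univ i)
    have := hw (fun x => ∏ i, ψ n i (x i))
      (contDiff_prod fun i _ => (hψs n i).comp (contDiff_apply ℝ ℝ i))
      (HasCompactSupport.of_support_subset_isCompact
        (isCompact_univ_pi fun _ => isCompact_Icc) ((subset_tsupport _).trans hsub))
      (hsub.trans (Set.pi_mono fun i _ y hy => ?_))
    · rw [← this]
      simp_rw [fderiv_prod_single (fun i => (hψs n i).differentiable (by simp))]
    · have : (0 : ℝ) < 1 / ((n : ℝ) + 1) := by positivity
      exact ⟨by linarith [hy.1], by linarith [hy.2]⟩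
  have lim1 : Tendsto (fun n => ∫ x, g x * (deriv (ψ n j) (x j) *
      ∏ i ∈ Finset.univ.erase j, ψ n i (x i)) ∂cubeMeasure s) atTop
      (𝓝 (pairing g (Function.update χ j (deriv (χ j))))) := by
    rw [pairing_update]
    refine tendsto_integral_of_dominated_convergence
      (fun x => |g x| * ((E * B + D) * ∏ i ∈ Finset.univ.erase j, C i)) (fun n => ?_)
      (hg.abs.mul_const _) (fun n => ?_) ?_
    · refine hg.aestronglyMeasurable.mul (Continuous.aestronglyMeasurable ?_)
      refine (((hψs n j).continuous_deriv (by simp)).comp (continuous_apply j)).mul ?_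
      exact continuous_finsetProd _ fun i _ => (hψs n i).continuous.comp (continuous_apply i)
    · filter_upwards [ae_cubeMeasure s] with x hx
      have hx' := fun i => Set.Ico_subset_Icc_self (mem_cube.1 hx i)
      rw [Real.norm_eq_abs, abs_mul, abs_mul, Finset.abs_prod]
      gcongr with i
      · exact bdψ n _ (hx' j)
      · exact bψ n i _ (hx' i)
    · filter_upwards [ae_cubeMeasure_pos s] with x hx
      refine tendsto_const_nhds.mul (Tendsto.mul ?_ (tendsto_finsetProd _ fun i _ => ?_))
      · simp_rw [dψ]
        simpa using ((tendsto_deriv_cutoff (hx j)).mul_const (χ j (x j))).add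
          ((tendsto_cutoff (hx j)).mul_const (deriv (χ j) (x j)))
      · simpa using (tendsto_cutoff (hx i)).mul_const (χ i (x i))
  have lim2 : Tendsto (fun n => ∫ x, g' x * ∏ i, ψ n i (x i) ∂cubeMeasure s) atTop
      (𝓝 (pairing g' χ)) := by
    refine tendsto_integral_of_dominated_convergence
      (fun x => |g' x| * ∏ i, C i) (fun n => ?_) (hg'.abs.mul_const _) (fun n => ?_) ?_
    · refine hg'.aestronglyMeasurable.mul (Continuous.aestronglyMeasurable ?_)
      exact continuous_finsetProd _ fun i _ => (hψs n i).continuous.comp (continuous_apply i)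
    · filter_upwards [ae_cubeMeasure s] with x hx
      have hx' := fun i => Set.Ico_subset_Icc_self (mem_cube.1 hx i)
      rw [Real.norm_eq_abs, abs_mul, Finset.abs_prod]
      gcongr with i
      exact bψ n i _ (hx' i)
    · filter_upwards [ae_cubeMeasure_pos s] with x hx
      refine tendsto_const_nhds.mul (tendsto_finsetProd _ fun i _ => ?_)
      simpa using (tendsto_cutoff (hx i)).mul_const (χ i (x i))
  simp_rw [key] at lim1
  exact tendsto_nhds_unique lim1 lim2.neg

/-! ### The representation of a Sobolev function by its derivatives -/

/-- The adjoint form of the integral operator with kernel `baseKernel`: it maps smooth functions on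
the line to smooth functions on the line. -/
def smoothOp (h : ℝ → ℝ) (y : ℝ) : ℝ := y * (∫ t in (0 : ℝ)..1, h t) - ∫ t in (0 : ℝ)..y, h t

lemma hasDerivAt_smoothOp {h : ℝ → ℝ} (hh : Continuous h) (y : ℝ) :
    HasDerivAt (smoothOp h) ((∫ t in (0 : ℝ)..1, h t) - h y) y := by
  have h1 := (hasDerivAt_id y).mul_const (∫ t in (0 : ℝ)..1, h t)
  have h2 := (hh.integral_hasStrictDerivAt 0 y).hasDerivAt
  rw [one_mul] at h1
  exact h1.sub h2

lemma contDiff_smoothOp {h : ℝ → ℝ} (hh : ContDiff ℝ (⊤ : ℕ∞) h) :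
    ContDiff ℝ (⊤ : ℕ∞) (smoothOp h) := by
  rw [contDiff_infty_iff_deriv]
  refine ⟨fun y => (hasDerivAt_smoothOp hh.continuous y).differentiableAt, ?_⟩
  have : deriv (smoothOp h) = fun y => (∫ t in (0 : ℝ)..1, h t) - h y :=
    funext fun y => (hasDerivAt_smoothOp hh.continuous y).deriv
  rw [this]
  exact contDiff_const.sub hh

lemma contDiff_iterate_smoothOp {h : ℝ → ℝ} (hh : ContDiff ℝ (⊤ : ℕ∞) h) (n : ℕ) :
    ContDiff ℝ (⊤ : ℕ∞) (smoothOp^[n] h) := by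
  induction n with
  | zero => exact hh
  | succ n ih => rw [Function.iterate_succ_apply']; exact contDiff_smoothOp ih

lemma smoothOp_eq_integral {h : ℝ → ℝ} (hh : Continuous h) {y : ℝ} (hy : y ∈ Set.Ico (0 : ℝ) 1) :
    smoothOp h y = ∫ t, baseKernel t y * h t ∂unitMeasure := by
  have hi : Integrable h unitMeasure := by
    obtain ⟨C, -, hC⟩ := exists_bound_on_unit hh
    exact integrable_of_bound hh.aestronglyMeasurable
      fun x hx => hC x (Set.Ico_subset_Icc_self hx)
  have h1 : ∀ t, baseKernel t y * h t = y * h t - (Set.Iio y).indicator h t := by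
    intro t
    by_cases ht : t < y
    · simp [baseKernel, Set.indicator, ht]; ring
    · simp [baseKernel, Set.indicator, ht]
  simp_rw [h1]
  rw [integral_sub (hi.const_mul _) (hi.indicator measurableSet_Iio), integral_const_mul,
    integral_unitMeasure, smoothOp, integral_indicator measurableSet_Iio, unitMeasure,
    Measure.restrict_restrict measurableSet_Iio]
  have : Set.Iio y ∩ Set.Ico 0 1 = Set.Ico 0 y := by
    ext t; simp only [Set.mem_inter_iff, Set.mem_Iio, Set.mem_Ico]
    exact ⟨fun h => ⟨h.2.1, h.1⟩, fun h => ⟨h.2, h.1, h.2.trans hy.2⟩⟩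
  rw [this, intervalIntegral.integral_of_le hy.1, integral_Ico_eq_integral_Ioc]

lemma abs_smoothOp_le {h : ℝ → ℝ} (hh : Continuous h)
    (hb : ∫ t, |h t| ∂unitMeasure ≤ 1) {y : ℝ} (hy : y ∈ Set.Ico (0 : ℝ) 1) :
    |smoothOp h y| ≤ 1 := by
  obtain ⟨C, -, hC⟩ := exists_bound_on_unit hh
  have hi : Integrable h unitMeasure := integrable_of_bound hh.aestronglyMeasurable
    fun x hx => hC x (Set.Ico_subset_Icc_self hx)
  rw [smoothOp_eq_integral hh hy]
  refine abs_integral_le_integral_abs.trans (le_trans ?_ hb)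
  refine integral_mono_of_nonneg (Eventually.of_forall fun _ => abs_nonneg _) hi.abs
    (Eventually.of_forall fun t => ?_)
  simp only [abs_mul]
  exact mul_le_of_le_one_left (abs_nonneg _) (abs_baseKernel_le hy)

lemma integrable_mul_prod {s : ℕ} {g : (Fin s → ℝ) → ℝ} (hg : Integrable g (cubeMeasure s))
    {χ : Fin s → ℝ → ℝ} (hχ : ∀ i, Measurable (χ i)) {C : Fin s → ℝ}
    (hC : ∀ i, ∀ y ∈ Set.Ico (0 : ℝ) 1, |χ i y| ≤ C i) :
    Integrable (fun x => g x * ∏ i, χ i (x i)) (cubeMeasure s) := by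
  refine hg.mul_bdd (c := ∏ i, C i) ?_ ?_
  · exact (Finset.measurable_prod _ fun i _ =>
      (hχ i).comp (measurable_pi_apply i)).aestronglyMeasurable
  · filter_upwards [ae_cubeMeasure s] with x hx
    rw [Real.norm_eq_abs, Finset.abs_prod]
    gcongr with i
    exact hC i _ (mem_cube.1 hx i)

/-- The weak form of the identity `f = ∫ f + ∫ k f'` in the direction of one coordinate. -/
lemma IsWeakPartial.pairing_eq {s : ℕ} {j : Fin s} {g g' : (Fin s → ℝ) → ℝ}
    (hw : IsWeakPartial j g g') (hg : Integrable g (cubeMeasure s))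
    (hg' : Integrable g' (cubeMeasure s)) {χ : Fin s → ℝ → ℝ}
    (hχ : ∀ i, ContDiff ℝ (⊤ : ℕ∞) (χ i)) :
    pairing g χ = pairing g (Function.update χ j fun _ => ∫ t in (0 : ℝ)..1, χ j t) +
      pairing g' (Function.update χ j (smoothOp (χ j))) := by
  set Θ := smoothOp (χ j) with hΘ
  set c := ∫ t in (0 : ℝ)..1, χ j t with hc
  have hΘs : ContDiff ℝ (⊤ : ℕ∞) Θ := contDiff_smoothOp (hχ j)
  have hd : deriv Θ = fun y => c - χ j y :=
    funext fun y => (hasDerivAt_smoothOp (hχ j).continuous y).deriv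
  have h := hw.integral_eq hg hg' (χ := Function.update χ j Θ) (fun i => by
    rcases eq_or_ne i j with rfl | hij
    · simpa using hΘs
    · simpa [Function.update_of_ne hij] using hχ i)
    (by simp [hΘ, smoothOp]) (by simp [hΘ, smoothOp])
  rw [Function.update_self, Function.update_idem, hd] at h
  choose C hC0 hC using fun i => exists_bound_on_unit (hχ i).continuous
  have i1 : Integrable (fun x => g x * ∏ i, χ i (x i)) (cubeMeasure s) :=
    integrable_mul_prod hg (fun i => (hχ i).continuous.measurable) (C := C)
      fun i y hy => hC i y (Set.Ico_subset_Icc_self hy)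
  have i2 : Integrable (fun x => g x * ∏ i, (Function.update χ j fun _ => c) i (x i))
      (cubeMeasure s) := by
    refine integrable_mul_prod hg (C := Function.update C j |c|) (fun i => ?_) fun i y hy => ?_
    · rcases eq_or_ne i j with rfl | hij
      · simp
      · simpa [Function.update_of_ne hij] using (hχ i).continuous.measurable
    · rcases eq_or_ne i j with rfl | hij
      · simp
      · simpa [Function.update_of_ne hij] using hC i y (Set.Ico_subset_Icc_self hy)
  have h2 : pairing g (Function.update χ j fun y => c - χ j y) =
      pairing g (Function.update χ j fun _ => c) - pairing g χ := by
    rw [pairing, pairing, pairing, ← integral_sub i2 i1]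
    refine integral_congr_ae (Eventually.of_forall fun x => ?_)
    simp only [← Finset.mul_prod_erase Finset.univ _ (Finset.mem_univ j), Function.update_self]
    have e : ∀ w : ℝ → ℝ, ∏ i ∈ Finset.univ.erase j, Function.update χ j w i (x i) =
        ∏ i ∈ Finset.univ.erase j, χ i (x i) := fun w => Finset.prod_congr rfl fun i hi => by
      rw [Function.update_of_ne (Finset.ne_of_mem_erase hi)]
    rw [e, e]
    ring
  rw [h2] at h
  linarith

lemma SobolevFunction.integrable {s α : ℕ} (f : SobolevFunction s α) {r : Fin s → ℕ}
    (hr : ∀ j, r j ≤ α) : Integrable (f.deriv r) (cubeMeasure s) :=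
  (f.memLp r hr).integrable (by norm_num)

/-- The operators dual to the kernels `sobolevKernel α a`. -/
def dualOp (α a : ℕ) (h : ℝ → ℝ) : ℝ → ℝ :=
  if a < α then fun _ => ∫ t in (0 : ℝ)..1, smoothOp^[a] h t else smoothOp^[a] h

lemma contDiff_dualOp {h : ℝ → ℝ} (hh : ContDiff ℝ (⊤ : ℕ∞) h) (α a : ℕ) :
    ContDiff ℝ (⊤ : ℕ∞) (dualOp α a h) := by
  unfold dualOp
  split_ifs
  · exact contDiff_const
  · exact contDiff_iterate_smoothOp hh a

lemma contDiff_update {s : ℕ} {χ : Fin s → ℝ → ℝ} (hχ : ∀ i, ContDiff ℝ (⊤ : ℕ∞) (χ i))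
    (j : Fin s) {h : ℝ → ℝ} (hh : ContDiff ℝ (⊤ : ℕ∞) h) (i : Fin s) :
    ContDiff ℝ (⊤ : ℕ∞) (Function.update χ j h i) := by
  rcases eq_or_ne i j with rfl | hij
  · simpa using hh
  · simpa [Function.update_of_ne hij] using hχ i

/-- The expansion up to order `α` in the direction of one coordinate. -/
lemma SobolevFunction.pairing_expand {s α : ℕ} (f : SobolevFunction s α) {r : Fin s → ℕ}
    (hr : ∀ i, r i ≤ α) {j : Fin s} (hj : r j = 0) {χ : Fin s → ℝ → ℝ}
    (hχ : ∀ i, ContDiff ℝ (⊤ : ℕ∞) (χ i)) :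
    pairing (f.deriv r) χ = ∑ a ∈ Finset.range (α + 1),
      pairing (f.deriv (Function.update r j a)) (Function.update χ j (dualOp α a (χ j))) := by
  have key : ∀ n ≤ α, pairing (f.deriv r) χ =
      ∑ a ∈ Finset.range n, pairing (f.deriv (Function.update r j a))
        (Function.update χ j fun _ => ∫ t in (0 : ℝ)..1, smoothOp^[a] (χ j) t) +
      pairing (f.deriv (Function.update r j n)) (Function.update χ j (smoothOp^[n] (χ j))) := by
    intro n
    induction n with
    | zero =>
      intro _
      have : Function.update r j 0 = r := by rw [← hj, Function.update_eq_self]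
      simp [this]
    | succ n ih =>
      intro hn
      have hle : ∀ c ≤ α, ∀ i, Function.update r j c i ≤ α := fun c hc i => by
        rcases eq_or_ne i j with rfl | hij
        · simpa using hc
        · simpa [Function.update_of_ne hij] using hr i
      have hw := f.weak (Function.update r j n) (hle n (by lia)) j (by simpa using hn)
      rw [Function.update_idem, Function.update_self] at hw
      rw [ih (by lia), Finset.sum_range_succ, add_assoc]
      congr 1
      rw [hw.pairing_eq (f.integrable (hle n (by lia))) (f.integrable (hle (n + 1) hn))
        (contDiff_update hχ j (contDiff_iterate_smoothOp (hχ j) n))]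
      simp only [Function.update_idem, Function.update_self, Function.iterate_succ_apply']
  rw [key α le_rfl, Finset.sum_range_succ]
  congr 1
  · refine Finset.sum_congr rfl fun a ha => ?_
    rw [dualOp, if_pos (Finset.mem_range.1 ha)]
  · rw [dualOp, if_neg (lt_irrefl _)]

/-- The multi-indices with entries at most `α`, supported in `S`. -/
def indexBox {s : ℕ} (α : ℕ) (S : Finset (Fin s)) : Finset (Fin s → ℕ) :=
  Fintype.piFinset fun j => if j ∈ S then Finset.range (α + 1) else {0}

lemma mem_indexBox {s α : ℕ} {S : Finset (Fin s)} {a : Fin s → ℕ} :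
    a ∈ indexBox α S ↔ (∀ j, a j ≤ α) ∧ ∀ j ∉ S, a j = 0 := by
  simp only [indexBox, Fintype.mem_piFinset]
  constructor
  · intro h
    refine ⟨fun j => ?_, fun j hj => by simpa [hj] using h j⟩
    have := h j
    split_ifs at this
    · have := Finset.mem_range.1 this; lia
    · simp_all
  · intro h j
    split_ifs with hj
    · have := h.1 j
      exact Finset.mem_range.2 (by lia)
    · simpa using h.2 j hj

lemma sum_indexBox_insert {s α : ℕ} {S : Finset (Fin s)} {j : Fin s} (hj : j ∉ S)
    (F : (Fin s → ℕ) → ℝ) : ∑ a ∈ indexBox α (insert j S), F a =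
      ∑ a ∈ indexBox α S, ∑ c ∈ Finset.range (α + 1), F (Function.update a j c) := by
  rw [← Finset.sum_product']
  symm
  refine Finset.sum_bij' (fun p _ => Function.update p.1 j p.2)
    (fun a _ => (Function.update a j 0, a j)) ?_ ?_ ?_ ?_ ?_
  · rintro ⟨a, c⟩ h
    simp only [Finset.mem_product, Finset.mem_range, mem_indexBox] at h ⊢
    refine ⟨fun i => ?_, fun i hi => ?_⟩
    · rcases eq_or_ne i j with rfl | hij
      · simp; lia
      · simpa [hij] using h.1.1 i
    · simp only [Finset.mem_insert, not_or] at hi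
      simpa [hi.1] using h.1.2 i hi.2
  · intro a h
    simp only [Finset.mem_product, Finset.mem_range, mem_indexBox] at h ⊢
    refine ⟨⟨fun i => ?_, fun i hi => ?_⟩, by have := h.1 j; lia⟩
    · rcases eq_or_ne i j with rfl | hij
      · simp
      · simpa [hij] using h.1 i
    · rcases eq_or_ne i j with rfl | hij
      · simp
      · simpa [hij] using h.2 i (by simp [hij, hi])
  · rintro ⟨a, c⟩ h
    simp only [Finset.mem_product, mem_indexBox] at h
    have : a j = 0 := h.1.2 j hj
    simp [← this]
  · intro a _
    simp
  · intro a _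
    rfl

lemma SobolevFunction.pairing_expand_box {s α : ℕ} (f : SobolevFunction s α)
    (S : Finset (Fin s)) {χ : Fin s → ℝ → ℝ} (hχ : ∀ i, ContDiff ℝ (⊤ : ℕ∞) (χ i)) :
    pairing (f.deriv 0) χ = ∑ a ∈ indexBox α S,
      pairing (f.deriv a) fun i => if i ∈ S then dualOp α (a i) (χ i) else χ i := by
  induction S using Finset.induction_on with
  | empty =>
    have : indexBox α (∅ : Finset (Fin s)) = {0} := by
      ext a
      simp only [mem_indexBox, Finset.notMem_empty, not_false_eq_true, forall_const,
        Finset.mem_singleton, funext_iff, Pi.zero_apply]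
      exact ⟨fun h => h.2, fun h => ⟨fun i => by simp [h i], h⟩⟩
    simp [this]
  | insert j S hj ih =>
    rw [ih, sum_indexBox_insert hj]
    refine Finset.sum_congr rfl fun a ha => ?_
    rw [mem_indexBox] at ha
    rw [f.pairing_expand ha.1 (ha.2 j hj) (fun i => by
      split_ifs
      · exact contDiff_dualOp (hχ i) _ _
      · exact hχ i)]
    refine Finset.sum_congr rfl fun c _ => ?_
    congr 1
    funext i
    rcases eq_or_ne i j with rfl | hij
    · simp [hj]
    · simp [hij]

/-- Smooth probability densities on the unit interval that concentrate on the right of `x`. -/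
lemma exists_densities {x : ℝ} (hx : x ∈ Set.Ico (0 : ℝ) 1) : ∃ η : ℕ → ℝ → ℝ,
    (∀ n, ContDiff ℝ (⊤ : ℕ∞) (η n)) ∧ (∀ n y, 0 ≤ η n y) ∧
    (∀ n, ∫ y, η n y ∂unitMeasure = 1) ∧ (∀ n y, y ≤ x → η n y = 0) ∧
    ∀ δ > 0, ∀ᶠ n in atTop, ∀ y, x + δ ≤ y → η n y = 0 := by
  have hd : ∀ n : ℕ, 0 < (1 - x) / (n + 2) := fun n => div_pos (sub_pos.2 hx.2) (by positivity)
  have hd1 : ∀ n : ℕ, (1 - x) / (n + 2) * 2 ≤ 1 - x := fun n => by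
    rw [div_mul_eq_mul_div, div_le_iff₀ (by positivity)]
    have : 0 < 1 - x := sub_pos.2 hx.2
    nlinarith [Nat.cast_nonneg (α := ℝ) n]
  set β : ∀ n : ℕ, ContDiffBump (x + (1 - x) / (n + 2)) := fun n =>
    ⟨(1 - x) / (n + 2) / 2, (1 - x) / (n + 2), half_pos (hd n), half_lt_self (hd n)⟩ with hβ
  have hz : ∀ (n : ℕ) (y : ℝ), y ∉ Set.Ioo x (x + (1 - x) / (n + 2) * 2) →
      (β n).normed volume y = 0 := by
    intro n y hy
    by_contra hne
    have h1 : y ∈ Function.support ((β n).normed volume) := hne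
    rw [ContDiffBump.support_normed_eq, Real.ball_eq_Ioo] at h1
    refine hy ⟨?_, ?_⟩
    · have := h1.1; simp only [hβ] at this; linarith
    · have := h1.2; simp only [hβ] at this; linarith
  refine ⟨fun n => (β n).normed volume, fun n => (β n).contDiff_normed,
    fun n y => (β n).nonneg_normed y, fun n => ?_,
    fun n y hy => hz n y fun h => absurd h.1 (not_lt.2 hy), fun δ hδ => ?_⟩
  · rw [unitMeasure, setIntegral_eq_integral_of_forall_compl_eq_zero]
    · exact (β n).integral_normed
    · intro y hy
      refine hz n y fun h => hy ⟨hx.1.trans h.1.le, ?_⟩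
      have := hd1 n
      linarith [h.2]
  · have hlim : Tendsto (fun n : ℕ => (1 - x) / ((n : ℝ) + 2) * 2) atTop (𝓝 0) := by
      have : Tendsto (fun n : ℕ => (n : ℝ) + 2) atTop atTop :=
        tendsto_natCast_atTop_atTop.atTop_add tendsto_const_nhds
      simpa using (this.const_div_atTop (1 - x)).mul_const 2
    filter_upwards [hlim.eventually (gt_mem_nhds hδ)] with n hn y hy
    exact hz n y fun h => by linarith [h.2]

section Densities

variable {x : ℝ} {η : ℕ → ℝ → ℝ}

lemma integral_abs_density (h0 : ∀ n y, 0 ≤ η n y) (h1 : ∀ n, ∫ y, η n y ∂unitMeasure = 1)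
    (n : ℕ) : ∫ y, |η n y| ∂unitMeasure = 1 := by
  rw [← h1 n]
  exact integral_congr_ae (Eventually.of_forall fun y => abs_of_nonneg (h0 n y))

lemma integral_abs_le_of_abs_le {h : ℝ → ℝ} (hb : ∀ y ∈ Set.Ico (0 : ℝ) 1, |h y| ≤ 1) :
    ∫ y, |h y| ∂unitMeasure ≤ 1 :=
  (le_abs_self _).trans (abs_integral_le_of_bound fun y hy => by rw [abs_abs]; exact hb y hy)

lemma abs_iterate_smoothOp_density_le (hs : ∀ n, ContDiff ℝ (⊤ : ℕ∞) (η n))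
    (h0 : ∀ n y, 0 ≤ η n y) (h1 : ∀ n, ∫ y, η n y ∂unitMeasure = 1) (a n : ℕ) {y : ℝ}
    (hy : y ∈ Set.Ico (0 : ℝ) 1) : |smoothOp^[a + 1] (η n) y| ≤ 1 := by
  induction a generalizing y with
  | zero => exact abs_smoothOp_le (hs n).continuous (integral_abs_density h0 h1 n).le hy
  | succ a ih =>
    rw [Function.iterate_succ_apply']
    exact abs_smoothOp_le (contDiff_iterate_smoothOp (hs n) _).continuous
      (integral_abs_le_of_abs_le fun y hy => ih hy) hy

/-- The iterated operators, applied to densities concentrating at `x`, converge to the iterated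
kernels. -/
lemma tendsto_iterate_smoothOp_density (hs : ∀ n, ContDiff ℝ (⊤ : ℕ∞) (η n))
    (h0 : ∀ n y, 0 ≤ η n y) (h1 : ∀ n, ∫ y, η n y ∂unitMeasure = 1)
    (hl : ∀ n y, y ≤ x → η n y = 0) (hr : ∀ δ > 0, ∀ᶠ n in atTop, ∀ y, x + δ ≤ y → η n y = 0)
    (a : ℕ) {y : ℝ} (hy : y ∈ Set.Ico (0 : ℝ) 1) :
    Tendsto (fun n => smoothOp^[a + 1] (η n) y) atTop (𝓝 (kernel a x y)) := by
  induction a generalizing y with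
  | zero =>
    simp only [zero_add, Function.iterate_one, kernel]
    refine tendsto_const_nhds.congr' ?_
    -- for large `n` the support of the density lies on one side of `y`
    have hev : ∀ᶠ n in atTop, ∀ t, baseKernel t y * η n t = baseKernel x y * η n t := by
      rcases lt_or_ge x y with hxy | hxy
      · filter_upwards [hr (y - x) (sub_pos.2 hxy)] with n hn t
        rcases lt_or_ge t y with ht | ht
        · simp [baseKernel, hxy, ht]
        · rw [hn t (by linarith)]; simp
      · refine Eventually.of_forall fun n t => ?_
        rcases le_or_gt t x with ht | ht
        · rw [hl n t ht]; simp
        · simp [baseKernel, not_lt.2 hxy, not_lt.2 (hxy.trans ht.le)]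
    filter_upwards [hev] with n hn
    rw [smoothOp_eq_integral (hs n).continuous hy]
    simp_rw [hn]
    rw [integral_const_mul, h1, mul_one]
  | succ a ih =>
    have hc : ∀ n, Continuous (smoothOp^[a + 1] (η n)) :=
      fun n => (contDiff_iterate_smoothOp (hs n) _).continuous
    simp only [kernel]
    have : ∀ n, smoothOp^[a + 1 + 1] (η n) y =
        ∫ t, baseKernel t y * smoothOp^[a + 1] (η n) t ∂unitMeasure := fun n => by
      rw [Function.iterate_succ_apply', smoothOp_eq_integral (hc n) hy]
    simp_rw [this]
    refine tendsto_integral_of_dominated_convergence (fun _ => 1) (fun n => ?_)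
      (integrable_const _) (fun n => ?_) ?_
    · exact ((measurable_baseKernel_left y).mul (hc n).measurable).aestronglyMeasurable
    · filter_upwards [ae_unitMeasure] with t ht
      rw [Real.norm_eq_abs, abs_mul]
      exact mul_le_one₀ (abs_baseKernel_le hy) (abs_nonneg _)
        (abs_iterate_smoothOp_density_le hs h0 h1 a n ht)
    · filter_upwards [ae_unitMeasure] with t ht
      exact (ih ht).const_mul _

lemma abs_dualOp_density_le (hs : ∀ n, ContDiff ℝ (⊤ : ℕ∞) (η n))
    (h0 : ∀ n y, 0 ≤ η n y) (h1 : ∀ n, ∫ y, η n y ∂unitMeasure = 1) {α : ℕ} (hα : 0 < α)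
    (a n : ℕ) {y : ℝ} (hy : y ∈ Set.Ico (0 : ℝ) 1) : |dualOp α a (η n) y| ≤ 1 := by
  match a with
  | 0 =>
    rw [dualOp, if_pos hα, Function.iterate_zero, ← integral_unitMeasure]
    simp [h1]
  | a + 1 =>
    unfold dualOp
    split_ifs
    · rw [← integral_unitMeasure]
      exact abs_integral_le_of_bound fun y hy => abs_iterate_smoothOp_density_le hs h0 h1 a n hy
    · exact abs_iterate_smoothOp_density_le hs h0 h1 a n hy

lemma tendsto_dualOp_density (hs : ∀ n, ContDiff ℝ (⊤ : ℕ∞) (η n))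
    (h0 : ∀ n y, 0 ≤ η n y) (h1 : ∀ n, ∫ y, η n y ∂unitMeasure = 1)
    (hl : ∀ n y, y ≤ x → η n y = 0) (hr : ∀ δ > 0, ∀ᶠ n in atTop, ∀ y, x + δ ≤ y → η n y = 0)
    {α : ℕ} (hα : 0 < α) (a : ℕ) {y : ℝ} (hy : y ∈ Set.Ico (0 : ℝ) 1) :
    Tendsto (fun n => dualOp α a (η n) y) atTop (𝓝 (sobolevKernel α a x y)) := by
  match a with
  | 0 =>
    simp only [dualOp, if_pos hα, Function.iterate_zero, ← integral_unitMeasure, id, h1,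
      sobolevKernel]
    exact tendsto_const_nhds
  | a + 1 =>
    simp only [dualOp, sobolevKernel]
    split_ifs
    · simp only [← integral_unitMeasure, kernelMean]
      refine tendsto_integral_of_dominated_convergence (fun _ => 1) (fun n => ?_)
        (integrable_const _) (fun n => ?_) ?_
      · exact (contDiff_iterate_smoothOp (hs n) _).continuous.aestronglyMeasurable
      · filter_upwards [ae_unitMeasure] with t ht
        exact abs_iterate_smoothOp_density_le hs h0 h1 a n ht
      · filter_upwards [ae_unitMeasure] with t ht
        exact tendsto_iterate_smoothOp_density hs h0 h1 hl hr a ht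
    · exact tendsto_iterate_smoothOp_density hs h0 h1 hl hr a hy

end Densities

/-- A function of smoothness `α` is recovered, at every point, from the integrals of its
derivatives against products of kernels. -/
theorem SobolevFunction.eq_sum_integral {s α : ℕ} (hα : 0 < α) (f : SobolevFunction s α)
    {x : Fin s → ℝ} (hx : x ∈ cube s) : f x = ∑ a ∈ indexBox α Finset.univ,
      ∫ y, f.deriv a y * ∏ i, sobolevKernel α (a i) (x i) (y i) ∂cubeMeasure s := by
  choose η hs h0 h1 hl hr using fun i => exists_densities (mem_cube.1 hx i)
  have hf0 : Integrable (f.deriv 0) (cubeMeasure s) := f.integrable fun _ => Nat.zero_le _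
  have bη : ∀ n, ∃ C : Fin s → ℝ, ∀ i, ∀ y ∈ Set.Ico (0 : ℝ) 1, |η i n y| ≤ C i := fun n => by
    choose C _ hC using fun i => exists_bound_on_unit (hs i n).continuous
    exact ⟨C, fun i y hy => hC i y (Set.Ico_subset_Icc_self hy)⟩
  have hprod : ∀ n, ∫ y, ∏ i, η i n (y i) ∂cubeMeasure s = 1 := fun n => by
    rw [cubeMeasure_eq_pi, integral_fintype_prod_eq_prod]
    simp [h1]
  have iprod : ∀ n, Integrable (fun y => ∏ i, η i n (y i)) (cubeMeasure s) := fun n => by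
    obtain ⟨C, hC⟩ := bη n
    simpa using integrable_mul_prod (integrable_const (1 : ℝ))
      (fun i => (hs i n).continuous.measurable) hC
  have lim1 : Tendsto (fun n => pairing (f.deriv 0) fun i => η i n) atTop (𝓝 (f x)) := by
    rw [Metric.tendsto_atTop]
    intro ε hε
    obtain ⟨δ, hδ, hfδ⟩ := Metric.continuousOn_iff.1 f.continuousOn x hx (ε / 2) (half_pos hε)
    have hev : ∀ᶠ n in atTop, ∀ i y, x i + δ ≤ y → η i n y = 0 :=
      eventually_all.2 fun i => hr i δ hδ
    obtain ⟨n0, hn0⟩ := eventually_atTop.1 hev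
    refine ⟨n0, fun n hn => ?_⟩
    obtain ⟨C, hC⟩ := bη n
    have i1 : Integrable (fun y => f.deriv 0 y * ∏ i, η i n (y i)) (cubeMeasure s) :=
      integrable_mul_prod hf0 (fun i => (hs i n).continuous.measurable) hC
    have e : pairing (f.deriv 0) (fun i => η i n) - f x =
        ∫ y, (f.deriv 0 y - f x) * ∏ i, η i n (y i) ∂cubeMeasure s := by
      simp_rw [sub_mul]
      rw [integral_sub i1 ((iprod n).const_mul _), integral_const_mul, hprod, mul_one, pairing]
    rw [Real.dist_eq, e]
    have hle : |∫ y, (f.deriv 0 y - f x) * ∏ i, η i n (y i) ∂cubeMeasure s| ≤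
        ∫ y, ε / 2 * ∏ i, η i n (y i) ∂cubeMeasure s := by
      refine abs_integral_le_integral_abs.trans ?_
      refine integral_mono_of_nonneg (Eventually.of_forall fun _ => abs_nonneg _)
        ((iprod n).const_mul _) ?_
      filter_upwards [ae_cubeMeasure s] with y hy
      rw [abs_mul, abs_of_nonneg (a := ∏ i, η i n (y i)) (Finset.prod_nonneg fun i _ => h0 i n _)]
      by_cases hz : ∃ i, η i n (y i) = 0
      · obtain ⟨i, hi⟩ := hz
        rw [Finset.prod_eq_zero (Finset.mem_univ i) hi]
        simp
      · push Not at hz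
        refine mul_le_mul_of_nonneg_right ?_ (Finset.prod_nonneg fun i _ => h0 i n _)
        refine (hfδ y hy ?_).le
        rw [dist_pi_lt_iff hδ]
        intro i
        have a1 : x i < y i := by
          by_contra hc; exact hz i (hl i n _ (not_lt.1 hc))
        have a2 : y i < x i + δ := by
          by_contra hc; exact hz i (hn0 n hn i _ (not_lt.1 hc))
        rw [Real.dist_eq, abs_of_pos (sub_pos.2 a1)]
        linarith
    rw [integral_const_mul, hprod, mul_one] at hle
    linarith
  have lim2 : Tendsto (fun n => pairing (f.deriv 0) fun i => η i n) atTop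
      (𝓝 (∑ a ∈ indexBox α Finset.univ,
        ∫ y, f.deriv a y * ∏ i, sobolevKernel α (a i) (x i) (y i) ∂cubeMeasure s)) := by
    simp_rw [fun n => f.pairing_expand_box Finset.univ (χ := fun i => η i n) fun i => hs i n]
    refine tendsto_finsetSum _ fun a ha => ?_
    simp only [Finset.mem_univ, if_true]
    have hfa := f.integrable (mem_indexBox.1 ha).1
    refine tendsto_integral_of_dominated_convergence (fun y => |f.deriv a y|) (fun n => ?_)
      hfa.abs (fun n => ?_) ?_
    · refine hfa.aestronglyMeasurable.mul (Continuous.aestronglyMeasurable ?_)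
      exact continuous_finsetProd _ fun i _ =>
        (contDiff_dualOp (hs i n) _ _).continuous.comp (continuous_apply i)
    · filter_upwards [ae_cubeMeasure s] with y hy
      rw [Real.norm_eq_abs, abs_mul, Finset.abs_prod]
      refine mul_le_of_le_one_right (abs_nonneg _) (Finset.prod_le_one (fun _ _ => abs_nonneg _)
        fun i _ => ?_)
      exact abs_dualOp_density_le (hs i) (h0 i) (h1 i) hα _ n (mem_cube.1 hy i)
    · filter_upwards [ae_cubeMeasure s] with y hy
      refine tendsto_const_nhds.mul (tendsto_finsetProd _ fun i _ => ?_)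
      exact tendsto_dualOp_density (hs i) (h0 i) (h1 i) (hl i) (hr i) hα _ (mem_cube.1 hy i)
  exact tendsto_nhds_unique lim1 lim2

/-! ### The worst-case error -/

/-- The Cauchy–Schwarz inequality, with values in `ℝ≥0∞`. -/
lemma ofReal_sq_integral_mul_le {X : Type*} [MeasurableSpace X] {μ : Measure X} {f g : X → ℝ}
    (hf : AEMeasurable f μ) (hg : AEMeasurable g μ) :
    ENNReal.ofReal ((∫ x, f x * g x ∂μ) ^ 2) ≤
      (∫⁻ x, ENNReal.ofReal (f x ^ 2) ∂μ) * ∫⁻ x, ENNReal.ofReal (g x ^ 2) ∂μ := by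
  have e : ∀ t : ℝ, ENNReal.ofReal (t ^ 2) = ‖t‖ₑ ^ (2 : ℝ) := fun t => by
    rw [← sq_abs, ENNReal.ofReal_pow (abs_nonneg _), Real.enorm_eq_ofReal_abs]
    norm_cast
  simp_rw [e]
  have h1 : ‖∫ x, f x * g x ∂μ‖ₑ ≤ ∫⁻ x, ‖f x‖ₑ * ‖g x‖ₑ ∂μ := by
    refine (enorm_integral_le_lintegral_enorm _).trans_eq ?_
    simp_rw [enorm_mul]
  have h2 := ENNReal.lintegral_mul_le_Lp_mul_Lq μ Real.HolderConjugate.two_two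
    hf.enorm hg.enorm
  have h3 := ENNReal.rpow_le_rpow (h1.trans h2) (z := 2) (by norm_num)
  refine h3.trans_eq ?_
  rw [ENNReal.mul_rpow_of_nonneg _ _ (by norm_num), ← ENNReal.rpow_mul, ← ENNReal.rpow_mul]
  norm_num

/-- Weighted form of the Cauchy–Schwarz inequality for finite sums; a vanishing weight forces the
corresponding term to vanish. -/
lemma ofReal_sq_sum_le {ι : Type*} (I : Finset ι) (c : ι → ℝ) (S Q : ι → ℝ≥0∞) (w : ι → ℝ≥0)
    (hc : ∀ i ∈ I, ENNReal.ofReal (c i ^ 2) ≤ S i * Q i)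
    (hS : ∑ i ∈ I, S i / (w i : ℝ≥0∞) ≤ 1) :
    ENNReal.ofReal ((∑ i ∈ I, c i) ^ 2) ≤ ∑ i ∈ I, (w i : ℝ≥0∞) * Q i := by
  have e : ∀ t : ℝ, ENNReal.ofReal (t ^ 2) = ‖t‖ₑ ^ (2 : ℝ) := fun t => by
    rw [← sq_abs, ENNReal.ofReal_pow (abs_nonneg _), Real.enorm_eq_ofReal_abs]
    norm_cast
  have h1 : ∀ i ∈ I, ‖c i‖ₑ ≤ (S i / w i) ^ (1 / 2 : ℝ) * (w i * Q i) ^ (1 / 2 : ℝ) := by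
    intro i hi
    have h2 : ‖c i‖ₑ = (ENNReal.ofReal (c i ^ 2)) ^ (1 / 2 : ℝ) := by
      rw [e, ← ENNReal.rpow_mul]; norm_num
    rw [h2, ← ENNReal.mul_rpow_of_nonneg _ _ (by norm_num)]
    refine ENNReal.rpow_le_rpow ((hc i hi).trans ?_) (by norm_num)
    by_cases hw : w i = 0
    · have h3 : S i / w i ≤ 1 := (Finset.single_le_sum (f := fun i => S i / (w i : ℝ≥0∞))
        (fun _ _ => zero_le) hi).trans hS
      have h4 : S i = 0 := by
        by_contra hne
        rw [hw, ENNReal.coe_zero, ENNReal.div_zero hne] at h3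
        exact absurd h3 (by simp)
      simp [h4]
    · rw [← mul_assoc, ENNReal.div_mul_cancel (by simpa using hw) ENNReal.coe_ne_top]
  rw [e]
  have h5 : ‖∑ i ∈ I, c i‖ₑ ≤ (∑ i ∈ I, w i * Q i) ^ (1 / 2 : ℝ) := by
    refine (enorm_sum_le _ _).trans ((Finset.sum_le_sum h1).trans ?_)
    refine (ENNReal.inner_le_Lp_mul_Lq I _ _ Real.HolderConjugate.two_two).trans ?_
    simp_rw [← ENNReal.rpow_mul]
    norm_num
    refine mul_le_of_le_one_left' ?_
    exact ENNReal.rpow_le_one hS (by norm_num)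
  refine (ENNReal.rpow_le_rpow h5 (z := 2) (by norm_num)).trans_eq ?_
  rw [← ENNReal.rpow_mul]
  norm_num

lemma measurable_piecewise {s : ℕ} (v : Finset (Fin s)) :
    Measurable fun p : (Fin s → ℝ) × (Fin s → ℝ) => v.piecewise p.1 p.2 := by
  refine measurable_pi_iff.2 fun i => ?_
  by_cases hi : i ∈ v
  · simp only [hi, Finset.piecewise_eq_of_mem]
    exact (measurable_pi_apply i).comp measurable_fst
  · simp only [hi, not_false_eq_true, Finset.piecewise_eq_of_notMem]
    exact (measurable_pi_apply i).comp measurable_snd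

/-- Combining the coordinates in `v` of one random point with the remaining coordinates of an
independent one gives a random point again. -/
lemma measurePreserving_piecewise {s : ℕ} (v : Finset (Fin s)) :
    MeasurePreserving (fun p : (Fin s → ℝ) × (Fin s → ℝ) => v.piecewise p.1 p.2)
      ((cubeMeasure s).prod (cubeMeasure s)) (cubeMeasure s) := by
  refine ⟨measurable_piecewise v, ?_⟩
  rw [cubeMeasure_eq_pi]
  symm
  refine Measure.pi_eq fun A hA => ?_
  rw [Measure.map_apply (measurable_piecewise v) (MeasurableSet.univ_pi hA)]
  have : (fun p : (Fin s → ℝ) × (Fin s → ℝ) => v.piecewise p.1 p.2) ⁻¹' Set.univ.pi A =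
      (Set.univ.pi fun i => if i ∈ v then A i else Set.univ) ×ˢ
        (Set.univ.pi fun i => if i ∈ v then Set.univ else A i) := by
    ext p
    simp only [Set.mem_preimage, Set.mem_pi, Set.mem_univ, forall_const, Set.mem_prod]
    rw [← forall_and]
    refine forall_congr' fun i => ?_
    by_cases hi : i ∈ v <;> simp [hi]
  rw [this, Measure.prod_prod, Measure.pi_pi, Measure.pi_pi, ← Finset.prod_mul_distrib]
  refine Finset.prod_congr rfl fun i _ => ?_
  by_cases hi : i ∈ v <;> simp [hi]

/-- A function of the coordinates in `v` is integrated against `g` as against its section mean. -/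
lemma ofReal_sq_integral_le_sectionNormSq {s : ℕ} (v : Finset (Fin s))
    {g W : (Fin s → ℝ) → ℝ} (hg : Integrable g (cubeMeasure s)) (hW : Measurable W)
    (hv : ∀ x y, W (v.piecewise x y) = W x) {C : ℝ} (hC : ∀ x ∈ cube s, |W x| ≤ C) :
    ENNReal.ofReal ((∫ y, g y * W y ∂cubeMeasure s) ^ 2) ≤
      sectionNormSq v g * ∫⁻ y, ENNReal.ofReal (W y ^ 2) ∂cubeMeasure s := by
  have hp := measurePreserving_piecewise v
  have hgW : Integrable (fun y => g y * W y) (cubeMeasure s) :=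
    hg.mul_bdd (c := C) hW.aestronglyMeasurable
      ((ae_cubeMeasure s).mono fun x hx => by simpa using hC x hx)
  have h1 : ∫ y, g y * W y ∂cubeMeasure s =
      ∫ x, (∫ y, g (v.piecewise x y) ∂cubeMeasure s) * W x ∂cubeMeasure s := by
    have h2 : Integrable (fun p : (Fin s → ℝ) × (Fin s → ℝ) =>
        g (v.piecewise p.1 p.2) * W (v.piecewise p.1 p.2))
        ((cubeMeasure s).prod (cubeMeasure s)) := hp.integrable_comp_of_integrable hgW
    calc _ = ∫ y, g y * W y ∂(Measure.map (fun p : (Fin s → ℝ) × (Fin s → ℝ) =>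
            v.piecewise p.1 p.2) ((cubeMeasure s).prod (cubeMeasure s))) := by rw [hp.map_eq]
      _ = _ := integral_map hp.measurable.aemeasurable
            (by rw [hp.map_eq]; exact hgW.aestronglyMeasurable)
      _ = _ := by
        rw [integral_prod _ h2]
        simp_rw [hv, integral_mul_const]
  rw [h1]
  have h3 : Integrable (fun p : (Fin s → ℝ) × (Fin s → ℝ) => g (v.piecewise p.1 p.2))
      ((cubeMeasure s).prod (cubeMeasure s)) := hp.integrable_comp_of_integrable hg
  exact ofReal_sq_integral_mul_le h3.integral_prod_left.aemeasurable hW.aemeasurable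

/-- The coordinates at which the multi-index `a` does not vanish. -/
def indexSupport {s : ℕ} (a : Fin s → ℕ) : Finset (Fin s) := Finset.univ.filter fun i => a i ≠ 0

/-- The coordinates at which the multi-index `a` is maximal. -/
def indexTop {s : ℕ} (α : ℕ) (a : Fin s → ℕ) : Finset (Fin s) :=
  Finset.univ.filter fun i => a i = α

lemma SobolevFunction.normSq_eq {s α : ℕ} (hα : 0 < α) (γ : Finset ℕ → ℝ≥0)
    (f : SobolevFunction s α) : f.normSq γ = ∑ a ∈ indexBox α Finset.univ,
      sectionNormSq (indexTop α a) (f.deriv a) /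
        (γ ((indexSupport a).map Fin.valEmbedding) : ℝ≥0∞) := by
  simp only [SobolevFunction.normSq, div_eq_mul_inv, Finset.sum_mul]
  simp only [Finset.sum_sigma']
  symm
  refine Finset.sum_bij' (fun a _ => ⟨indexSupport a, indexTop α a, a⟩)
    (fun p _ => p.2.2) ?_ ?_ ?_ ?_ ?_
  · intro a ha
    have ha' := (mem_indexBox.1 ha).1
    simp only [Finset.mem_sigma, Finset.mem_univ, Finset.mem_powerset, true_and, multiIndices,
      Fintype.mem_piFinset, indexSupport, indexTop, Finset.mem_filter]
    refine ⟨fun i hi => ?_, fun i => ?_⟩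
    · simp only [Finset.mem_filter, Finset.mem_univ, true_and] at hi ⊢
      lia
    · have := ha' i
      split_ifs with h1 h2
      · simpa using h1
      · simp; lia
      · simpa using h2
  · intro p hp
    simp only [Finset.mem_sigma, Finset.mem_univ, Finset.mem_powerset, true_and, multiIndices,
      Fintype.mem_piFinset] at hp
    rw [mem_indexBox]
    refine ⟨fun i => ?_, fun i hi => absurd (Finset.mem_univ i) hi⟩
    have := hp.2 i
    split_ifs at this <;> simp at this <;> lia
  · intro a _
    rfl
  · rintro ⟨u, v, a⟩ hp
    simp only [Finset.mem_sigma, Finset.mem_univ, Finset.mem_powerset, true_and, multiIndices,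
      Fintype.mem_piFinset] at hp
    have hu : indexSupport a = u := by
      ext i
      have := hp.2 i
      simp only [indexSupport, Finset.mem_filter, Finset.mem_univ, true_and]
      split_ifs at this with h1 h2 <;> simp at this
      · exact ⟨fun _ => hp.1 h1, fun _ => by lia⟩
      · exact ⟨fun _ => h2, fun _ => by lia⟩
      · simp [this, h2]
    have hv : indexTop α a = v := by
      ext i
      have := hp.2 i
      simp only [indexTop, Finset.mem_filter, Finset.mem_univ, true_and]
      split_ifs at this with h1 h2 <;> simp at this
      · simp [this, h1]
      · simp only [h1, iff_false]; lia
      · simp only [h1, iff_false]; lia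
    simp only [hu, hv]
  · intro a _
    rfl

/-- The average over the points `z` of the product of kernels that belongs to the multi-index
`a`. -/
def averageKernel {s N : ℕ} (α : ℕ) (a : Fin s → ℕ) (z : Fin N → Fin s → ℝ) (y : Fin s → ℝ) : ℝ :=
  1 / (N : ℝ) * ∑ n, ∏ i, sobolevKernel α (a i) (z n i) (y i)

/-- The contribution of the multi-index `a` to the squared worst-case error. -/
def indexError {s N : ℕ} (α : ℕ) (a : Fin s → ℕ) (z : Fin N → Fin s → ℝ) : ℝ≥0∞ :=
  ∫⁻ y, ENNReal.ofReal (averageKernel α a z y ^ 2) ∂cubeMeasure s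

lemma measurable_prod_sobolevKernel {s : ℕ} (α : ℕ) (a : Fin s → ℕ) :
    Measurable fun p : (Fin s → ℝ) × (Fin s → ℝ) =>
      ∏ i, sobolevKernel α (a i) (p.1 i) (p.2 i) :=
  Finset.measurable_prod _ fun i _ => by
    have h : Measurable fun p : (Fin s → ℝ) × (Fin s → ℝ) => (p.1 i, p.2 i) := by fun_prop
    exact (measurable_sobolevKernel α (a i)).comp h

lemma abs_prod_sobolevKernel_le {s : ℕ} (α : ℕ) (a : Fin s → ℕ) (x : Fin s → ℝ) {y : Fin s → ℝ}
    (hy : y ∈ cube s) : |∏ i, sobolevKernel α (a i) (x i) (y i)| ≤ 1 := by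
  rw [Finset.abs_prod]
  exact Finset.prod_le_one (fun _ _ => abs_nonneg _)
    fun i _ => abs_sobolevKernel_le α _ _ (mem_cube.1 hy i)

lemma measurable_averageKernel {s N : ℕ} (α : ℕ) (a : Fin s → ℕ) (z : Fin N → Fin s → ℝ) :
    Measurable (averageKernel α a z) :=
  (Finset.measurable_sum _ fun _ _ =>
    (measurable_prod_sobolevKernel α a).comp measurable_prodMk_left).const_mul _

lemma abs_averageKernel_le {s N : ℕ} (α : ℕ) (a : Fin s → ℕ) (z : Fin N → Fin s → ℝ)
    {y : Fin s → ℝ} (hy : y ∈ cube s) : |averageKernel α a z y| ≤ 1 := by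
  rw [averageKernel, abs_mul, abs_of_nonneg (by positivity), one_div, inv_mul_eq_div]
  refine div_le_one_of_le₀ ?_ (by positivity)
  refine (Finset.abs_sum_le_sum_abs _ _).trans ?_
  refine (Finset.sum_le_sum fun _ _ => abs_prod_sobolevKernel_le α a _ hy).trans_eq ?_
  simp

lemma SobolevFunction.error_eq {s α N : ℕ} (hα : 0 < α) (hN : 0 < N) (f : SobolevFunction s α)
    {z : Fin N → Fin s → ℝ} (hz : ∀ n, z n ∈ cube s) :
    1 / (N : ℝ) * ∑ n, f (z n) - ∫ y, f y ∂cubeMeasure s =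
      ∑ a ∈ (indexBox α Finset.univ).erase 0,
        ∫ y, f.deriv a y * averageKernel α a z y ∂cubeMeasure s := by
  have h1 : 1 / (N : ℝ) * ∑ n, f (z n) = ∑ a ∈ indexBox α Finset.univ,
      ∫ y, f.deriv a y * averageKernel α a z y ∂cubeMeasure s := by
    simp_rw [fun n => f.eq_sum_integral hα (hz n)]
    rw [Finset.sum_comm, Finset.mul_sum]
    refine Finset.sum_congr rfl fun a ha => ?_
    rw [← integral_finsetSum, ← integral_const_mul]
    · refine integral_congr_ae (Eventually.of_forall fun y => ?_)
      simp only [averageKernel, ← Finset.mul_sum]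
      ring
    · intro n _
      refine (f.integrable (mem_indexBox.1 ha).1).mul_bdd (c := 1) ?_ ?_
      · exact ((measurable_prod_sobolevKernel α a).comp measurable_prodMk_left).aestronglyMeasurable
      · exact (ae_cubeMeasure s).mono fun y hy => abs_prod_sobolevKernel_le α a (z n) hy
  have h0 : (0 : Fin s → ℕ) ∈ indexBox α Finset.univ := by simp [mem_indexBox]
  rw [h1, ← Finset.add_sum_erase _ _ h0]
  have h2 : ∀ y, averageKernel α (0 : Fin s → ℕ) z y = 1 := fun y => by
    simp [averageKernel, sobolevKernel, hN.ne']
  simp_rw [h2, mul_one]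
  ring

/-- The squared worst-case error of a point set in terms of the kernels. -/
lemma worstCaseError_sq_le {s α N : ℕ} (hα : 0 < α) (hN : 0 < N) (γ : Finset ℕ → ℝ≥0)
    {z : Fin N → Fin s → ℝ} (hz : ∀ n, z n ∈ cube s) :
    worstCaseError α γ z ^ 2 ≤ ∑ a ∈ (indexBox α Finset.univ).erase 0,
      (γ ((indexSupport a).map Fin.valEmbedding) : ℝ≥0∞) * indexError α a z := by
  set R := ∑ a ∈ (indexBox α Finset.univ).erase 0,
      (γ ((indexSupport a).map Fin.valEmbedding) : ℝ≥0∞) * indexError α a z with hR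
  have h : worstCaseError α γ z ≤ R ^ (1 / 2 : ℝ) := by
    refine iSup₂_le fun f hf => ?_
    have h1 : ENNReal.ofReal ((∑ a ∈ (indexBox α Finset.univ).erase 0,
        ∫ y, f.deriv a y * averageKernel α a z y ∂cubeMeasure s) ^ 2) ≤ R := by
      refine ofReal_sq_sum_le _ _ (fun a => sectionNormSq (indexTop α a) (f.deriv a)) _ _
        (fun a ha => ?_) ?_
      · refine ofReal_sq_integral_le_sectionNormSq _
          (f.integrable (mem_indexBox.1 (Finset.mem_of_mem_erase ha)).1)
          (measurable_averageKernel α a z) (fun x y => ?_)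
          (fun x hx => abs_averageKernel_le α a z hx)
        -- a factor with index below `α` does not depend on its second argument
        simp only [averageKernel]
        congr 1
        refine Finset.sum_congr rfl fun n _ => Finset.prod_congr rfl fun i _ => ?_
        by_cases hi : a i = α
        · rw [Finset.piecewise_eq_of_mem _ _ _ (by simp [indexTop, hi])]
        · have hle := (mem_indexBox.1 (Finset.mem_of_mem_erase ha)).1 i
          rcases hai : a i with _ | c
          · rfl
          · simp only [sobolevKernel]
            rw [if_pos (by lia), if_pos (by lia)]
      · refine le_trans ?_ hf
        rw [f.normSq_eq hα]
        exact Finset.sum_le_sum_of_subset (Finset.erase_subset _ _)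
    rw [← f.error_eq hα hN hz] at h1
    have h2 : ENNReal.ofReal |∫ y, f y ∂cubeMeasure s - 1 / (N : ℝ) * ∑ n, f (z n)| =
        (ENNReal.ofReal ((1 / (N : ℝ) * ∑ n, f (z n) - ∫ y, f y ∂cubeMeasure s) ^ 2)) ^
          (1 / 2 : ℝ) := by
      rw [ENNReal.ofReal_rpow_of_nonneg (sq_nonneg _) (by norm_num), ← Real.sqrt_eq_rpow,
        Real.sqrt_sq_eq_abs, abs_sub_comm]
    rw [h2]
    exact ENNReal.rpow_le_rpow h1 (by norm_num)
  have h3 : (R ^ (1 / 2 : ℝ)) ^ 2 = R := by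
    rw [← ENNReal.rpow_natCast, ← ENNReal.rpow_mul]; norm_num
  rw [← h3]
  gcongr

/-! ### Digits and digital shifts -/

/-- The natural number with the `n` leading `b`-adic digits `a 0, …, a (n - 1)`. -/
def digitCode (b : ℕ) (a : ℕ → ℕ) : ℕ → ℕ
  | 0 => 0
  | n + 1 => b * digitCode b a n + a n

lemma digitCode_congr {b : ℕ} {a a' : ℕ → ℕ} {n : ℕ} (h : ∀ i < n, a i = a' i) :
    digitCode b a n = digitCode b a' n := by
  induction n with
  | zero => rfl
  | succ n ih =>
    rw [digitCode, digitCode, ih fun i hi => h i (by lia), h n (by lia)]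

lemma digitCode_lt {b : ℕ} {a : ℕ → ℕ} (ha : ∀ i, a i < b) (n : ℕ) : digitCode b a n < b ^ n := by
  induction n with
  | zero => simp [digitCode]
  | succ n ih =>
    rw [digitCode, pow_succ']
    have := ha n
    calc b * digitCode b a n + a n < b * digitCode b a n + b := by lia
      _ = b * (digitCode b a n + 1) := by ring
      _ ≤ b * b ^ n := Nat.mul_le_mul_left _ ih

lemma digitCode_inj {b : ℕ} {a a' : ℕ → ℕ} (ha : ∀ i, a i < b) (ha' : ∀ i, a' i < b) {n : ℕ}
    (h : digitCode b a n = digitCode b a' n) : ∀ i < n, a i = a' i := by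
  induction n with
  | zero => intro i hi; lia
  | succ n ih =>
    rw [digitCode, digitCode] at h
    have h1 : a n = a' n := by
      have := congrArg (· % b) h
      simpa [Nat.add_mod, Nat.mod_eq_of_lt (ha n), Nat.mod_eq_of_lt (ha' n)] using this
    have hb : 0 < b := (Nat.zero_le _).trans_lt (ha 0)
    have h2 : digitCode b a n = digitCode b a' n := by
      rw [h1] at h
      exact Nat.eq_of_mul_eq_mul_left hb (Nat.add_right_cancel h)
    intro i hi
    rcases Nat.lt_succ_iff_lt_or_eq.1 hi with h3 | rfl
    · exact ih h2 i h3
    · exact h1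

lemma ofDigits_lt_one_of_tail {b : ℕ} {a : ℕ → Fin b}
    (h : ∀ n, Real.ofDigits (fun i => a (i + n)) < 1) :
    Real.ofDigits a ∈ Set.Ico (0 : ℝ) 1 := ⟨Real.ofDigits_nonneg a, by simpa using h 0⟩

section Digits

variable {b : ℕ} [NeZero b]

lemma ofDigits_tail_succ (a : ℕ → Fin b) (n : ℕ) : Real.ofDigits (fun i => a (i + n)) =
    (a n + Real.ofDigits fun i => a (i + (n + 1))) / b := by
  have h := Real.ofDigits_eq_sum_add_ofDigits (fun i => a (i + n)) 1
  have hb : (b : ℝ) ≠ 0 := Nat.cast_ne_zero.2 (NeZero.ne b)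
  rw [h]
  simp only [Finset.sum_range_one, Real.ofDigitsTerm, zero_add, pow_one, add_assoc, add_comm 1 n]
  field_simp

lemma pow_mul_ofDigits (a : ℕ → Fin b) (n : ℕ) : (b : ℝ) ^ n * Real.ofDigits a =
    digitCode b (fun i => a i) n + Real.ofDigits fun i => a (i + n) := by
  have hb : (b : ℝ) ≠ 0 := Nat.cast_ne_zero.2 (NeZero.ne b)
  induction n with
  | zero => simp [digitCode]
  | succ n ih =>
    rw [pow_succ', mul_assoc, ih, ofDigits_tail_succ, digitCode]
    push_cast
    field_simp
    ring

/-- A digit sequence no tail of which represents `1` is the digit sequence of its value. -/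
lemma digits_ofDigits {a : ℕ → Fin b} (h : ∀ n, Real.ofDigits (fun i => a (i + n)) < 1) :
    Real.digits (Real.ofDigits a) b = a := by
  funext i
  have h1 : ⌊Real.ofDigits a * (b : ℝ) ^ (i + 1)⌋₊ = digitCode b (fun i => a i) (i + 1) := by
    rw [mul_comm, pow_mul_ofDigits, Nat.floor_eq_iff (by
      have := Real.ofDigits_nonneg fun j => a (j + (i + 1)); positivity)]
    have h2 := h (i + 1)
    have h3 := Real.ofDigits_nonneg fun j => a (j + (i + 1))
    constructor <;> linarith
  rw [Real.digits, h1, digitCode]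
  ext
  simp [Fin.ofNat, Nat.add_mod, Nat.mod_eq_of_lt (a i).isLt]

lemma ofDigits_tail_lt {a : ℕ → Fin b} {M : ℕ}
    (h : ∀ n, M ≤ n → Real.ofDigits (fun i => a (i + n)) < 1) (n : ℕ) :
    Real.ofDigits (fun i => a (i + n)) < 1 := by
  have hb : (0 : ℝ) < b := Nat.cast_pos.2 (NeZero.pos b)
  have key : ∀ k n, M ≤ n + k → Real.ofDigits (fun i => a (i + n)) < 1 := by
    intro k
    induction k with
    | zero => intro n hn; exact h n hn
    | succ k ih =>
      intro n hn
      have h1 := ih (n + 1) (by lia)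
      have h2 : ((a n : ℕ) : ℝ) + 1 ≤ b := by exact_mod_cast (a n).isLt
      rw [ofDigits_tail_succ, div_lt_one hb]
      linarith
  exact key M n (by lia)

lemma ofDigits_tail_of_finite {a : ℕ → Fin b} {M : ℕ} (h : ∀ i, M ≤ i → a i = 0) (n : ℕ) :
    Real.ofDigits (fun i => a (i + n)) < 1 := by
  refine ofDigits_tail_lt (M := M) (fun n hn => ?_) n
  have : (fun i => a (i + n)) = fun _ => 0 := funext fun i => h _ (by lia)
  rw [this]
  simp [Real.ofDigits, Real.ofDigitsTerm]

lemma ofDigits_tail_digits {x : ℝ} (hx : x ∈ Set.Ico (0 : ℝ) 1) (hb : 1 < b) (n : ℕ) :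
    (digitCode b (fun i => Real.digits x b i) n : ℝ) = ⌊(b : ℝ) ^ n * x⌋₊ ∧
    Real.ofDigits (fun i => Real.digits x b (i + n)) = (b : ℝ) ^ n * x - ⌊(b : ℝ) ^ n * x⌋₊ ∧
    Real.ofDigits (fun i => Real.digits x b (i + n)) < 1 := by
  have hb0 : (b : ℝ) ^ n ≠ 0 := pow_ne_zero _ (Nat.cast_ne_zero.2 (NeZero.ne b))
  have h1 := Real.ofDigits_eq_sum_add_ofDigits (Real.digits x b) n
  have h2 := Real.ofDigits_digits_sum_eq (b := b) hx n
  have h3 := pow_mul_ofDigits (Real.digits x b) n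
  rw [Real.ofDigits_digits hb hx] at h1 h3
  have h4 : (b : ℝ) ^ n * x = ⌊(b : ℝ) ^ n * x⌋₊ +
      Real.ofDigits fun i => Real.digits x b (i + n) := by
    conv_lhs => rw [h1]
    rw [mul_add, h2, ← mul_assoc, mul_inv_cancel₀ hb0, one_mul]
  have h5 := Nat.lt_floor_add_one ((b : ℝ) ^ n * x)
  exact ⟨by linarith, by linarith, by linarith⟩

lemma digitCode_digits {x : ℝ} (hx : x ∈ Set.Ico (0 : ℝ) 1) (hb : 1 < b) (n : ℕ) :
    digitCode b (fun i => Real.digits x b i) n = ⌊(b : ℝ) ^ n * x⌋₊ := by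
  exact_mod_cast (ofDigits_tail_digits hx hb n).1

/-- The number `x` has at most `M` nonzero `b`-adic digits. -/
def HasFiniteDigits (b : ℕ) [NeZero b] (M : ℕ) (x : ℝ) : Prop := ∀ i, M ≤ i → Real.digits x b i = 0

variable {M : ℕ} {x σ : ℝ}

lemma digitAdd_tail (hx : HasFiniteDigits b M x) {n : ℕ} (hn : M ≤ n) :
    Real.ofDigits (fun i => Real.digits x b (i + n) + Real.digits σ b (i + n)) =
      Real.ofDigits fun i => Real.digits σ b (i + n) := by
  congr 1
  funext i
  rw [hx _ (by lia), zero_add]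

lemma digitAdd_tail_lt (hb : 1 < b) (hx : HasFiniteDigits b M x) (hσ : σ ∈ Set.Ico (0 : ℝ) 1)
    (n : ℕ) : Real.ofDigits (fun i => Real.digits x b (i + n) + Real.digits σ b (i + n)) < 1 := by
  refine ofDigits_tail_lt (a := fun i => Real.digits x b i + Real.digits σ b i) (M := M)
    (fun n hn => ?_) n
  rw [digitAdd_tail hx hn]
  exact (ofDigits_tail_digits hσ hb n).2.2

lemma digitAdd_mem (hb : 1 < b) (hx : HasFiniteDigits b M x) (hσ : σ ∈ Set.Ico (0 : ℝ) 1) :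
    digitAdd b x σ ∈ Set.Ico (0 : ℝ) 1 :=
  ofDigits_lt_one_of_tail (digitAdd_tail_lt hb hx hσ)

lemma digits_digitAdd (hb : 1 < b) (hx : HasFiniteDigits b M x) (hσ : σ ∈ Set.Ico (0 : ℝ) 1)
    (i : ℕ) : Real.digits (digitAdd b x σ) b i = Real.digits x b i + Real.digits σ b i :=
  congrFun (digits_ofDigits (digitAdd_tail_lt hb hx hσ)) i

lemma measurable_digitAdd (x : ℝ) : Measurable (digitAdd b x) := by
  have h1 : Measurable fun σ : ℝ => fun i => Real.digits x b i + Real.digits σ b i := by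
    refine measurable_pi_iff.2 fun i => ?_
    have h2 : Measurable fun σ : ℝ => ⌊σ * (b : ℝ) ^ (i + 1)⌋₊ :=
      Nat.measurable_floor.comp (measurable_id.mul_const _)
    exact (measurable_from_top (f := fun n : ℕ => Real.digits x b i + Fin.ofNat b n)).comp h2
  exact Real.continuous_ofDigits.measurable.comp h1

/-- The interval of all numbers in `[0,1)` whose `n` leading digits are those of `v`. -/
def digitCell (b n v : ℕ) : Set ℝ := Set.Ico ((v : ℝ) / b ^ n) ((v + 1) / b ^ n)

lemma mem_digitCell {n v : ℕ} {t : ℝ} (ht : 0 ≤ t) :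
    t ∈ digitCell b n v ↔ ⌊(b : ℝ) ^ n * t⌋₊ = v := by
  have hb : (0 : ℝ) < (b : ℝ) ^ n := pow_pos (Nat.cast_pos.2 (NeZero.pos b)) n
  rw [Nat.floor_eq_iff (by positivity), digitCell, Set.mem_Ico, div_le_iff₀ hb, lt_div_iff₀ hb,
    mul_comm t]

lemma digitCell_subset {n v : ℕ} (hv : v < b ^ n) : digitCell b n v ⊆ Set.Ico 0 1 := by
  have hb : (0 : ℝ) < (b : ℝ) ^ n := pow_pos (Nat.cast_pos.2 (NeZero.pos b)) n
  intro t ht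
  have h1 : ((v : ℝ) + 1) ≤ (b : ℝ) ^ n := by exact_mod_cast hv
  refine ⟨le_trans (by positivity) ht.1, lt_of_lt_of_le ht.2 ?_⟩
  rwa [div_le_one hb]

lemma floor_pow_mul_lt {n : ℕ} {t : ℝ} (ht : t ∈ Set.Ico (0 : ℝ) 1) :
    ⌊(b : ℝ) ^ n * t⌋₊ < b ^ n := by
  have hb : (0 : ℝ) < (b : ℝ) ^ n := pow_pos (Nat.cast_pos.2 (NeZero.pos b)) n
  rw [Nat.floor_lt (mul_nonneg hb.le ht.1)]
  push_cast
  nlinarith [ht.2]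

lemma iUnion_digitCell (n : ℕ) : ⋃ v ∈ Finset.range (b ^ n), digitCell b n v = Set.Ico 0 1 := by
  ext t
  simp only [Set.mem_iUnion, Finset.mem_range, exists_prop]
  constructor
  · rintro ⟨v, hv, ht⟩
    exact digitCell_subset hv ht
  · intro ht
    exact ⟨_, floor_pow_mul_lt ht, (mem_digitCell ht.1).2 rfl⟩

lemma disjoint_digitCell (n : ℕ) : Pairwise (Function.onFun Disjoint (digitCell b n)) := by
  intro v w hvw
  rw [Function.onFun, Set.disjoint_left]
  intro t hv hw
  have ht : 0 ≤ t := le_trans (by positivity) hv.1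
  exact hvw (((mem_digitCell ht).1 hv).symm.trans ((mem_digitCell ht).1 hw))

/-- A digital shift permutes the cells of level `M`, and acts on each of them by translation. -/
lemma measurePreserving_digitAdd (hb : 1 < b) (hx : HasFiniteDigits b M x) :
    MeasurePreserving (digitAdd b x) unitMeasure unitMeasure := by
  refine ⟨measurable_digitAdd x, ?_⟩
  have hbM : (0 : ℝ) < (b : ℝ) ^ M := pow_pos (Nat.cast_pos.2 (NeZero.pos b)) M
  have hcast : ∀ v : ℕ, v < b ^ M → (v : ℝ) / b ^ M ∈ digitCell b M v := fun v _ =>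
    ⟨le_rfl, by gcongr; linarith⟩
  set τ : ℕ → ℕ := fun v => digitCode b
    (fun i => (Real.digits x b i + Real.digits ((v : ℝ) / b ^ M) b i : Fin b)) M with hτ
  have hcode : ∀ v < b ^ M, ∀ t ∈ digitCell b M v,
      ∀ i < M, Real.digits t b i = Real.digits ((v : ℝ) / b ^ M) b i := by
    intro v hv t ht i hi
    have h1 := digitCell_subset hv ht
    have h2 := digitCell_subset hv (hcast v hv)
    have h3 := digitCode_inj (fun i => (Real.digits t b i).isLt)
      (fun i => (Real.digits ((v : ℝ) / b ^ M) b i).isLt) (n := M) (by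
        rw [digitCode_digits h1 hb, digitCode_digits h2 hb, (mem_digitCell h1.1).1 ht,
          (mem_digitCell h2.1).1 (hcast v hv)]) i hi
    exact Fin.ext h3
  have htrans : ∀ v < b ^ M, ∀ t ∈ digitCell b M v,
      digitAdd b x t = t + ((τ v : ℝ) - v) / b ^ M := by
    intro v hv t ht
    have h1 := digitCell_subset hv ht
    have h2 := pow_mul_ofDigits (fun i => Real.digits x b i + Real.digits t b i) M
    rw [digitAdd_tail hx le_rfl, (ofDigits_tail_digits h1 hb M).2.1,
      (mem_digitCell h1.1).1 ht, digitCode_congr (a' := fun i =>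
        (Real.digits x b i + Real.digits ((v : ℝ) / b ^ M) b i : Fin b))
        fun i hi => by rw [hcode v hv t ht i hi]] at h2
    change (b : ℝ) ^ M * digitAdd b x t = _ at h2
    field_simp
    linarith
  have hτlt : ∀ v, τ v < b ^ M := fun v => digitCode_lt (fun i => Fin.isLt _) M
  have hτinj : Set.InjOn τ (Finset.range (b ^ M)) := by
    intro v hv w hw hvw
    have hv' := Finset.mem_range.1 (Finset.mem_coe.1 hv)
    have hw' := Finset.mem_range.1 (Finset.mem_coe.1 hw)
    have h1 := digitCode_inj (fun i => Fin.isLt _) (fun i => Fin.isLt _) hvw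
    have h2 := digitCell_subset hv' (hcast v hv')
    have h3 := digitCell_subset hw' (hcast w hw')
    rw [← (mem_digitCell h2.1).1 (hcast v hv'), ← (mem_digitCell h3.1).1 (hcast w hw'),
      ← digitCode_digits h2 hb, ← digitCode_digits h3 hb]
    refine digitCode_congr fun i hi => ?_
    rw [add_left_cancel (Fin.ext (h1 i hi))]
  have himage : (Finset.range (b ^ M)).image τ = Finset.range (b ^ M) := by
    refine Finset.eq_of_subset_of_card_le (fun w hw => ?_) ?_
    · obtain ⟨v, -, rfl⟩ := Finset.mem_image.1 hw
      exact Finset.mem_range.2 (hτlt v)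
    · rw [Finset.card_image_of_injOn hτinj]
  have hmeas : ∀ v, MeasurableSet (digitCell b M v) := fun v => measurableSet_Ico
  have hsplit : ∀ A : Set ℝ, MeasurableSet A →
      unitMeasure A = ∑ v ∈ Finset.range (b ^ M), volume (A ∩ digitCell b M v) := by
    intro A hA
    rw [unitMeasure, Measure.restrict_apply hA, ← iUnion_digitCell (b := b) M, Set.inter_iUnion₂,
      measure_biUnion_finset]
    · intro v _ w _ hvw
      exact (disjoint_digitCell M hvw).mono Set.inter_subset_right Set.inter_subset_right
    · exact fun v _ => hA.inter (hmeas v)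
  ext A hA
  rw [Measure.map_apply (measurable_digitAdd x) hA, hsplit _ (measurable_digitAdd x hA),
    hsplit A hA]
  conv_rhs => rw [← himage, Finset.sum_image hτinj]
  refine Finset.sum_congr rfl fun v hv => ?_
  have hv' := Finset.mem_range.1 hv
  have : digitAdd b x ⁻¹' A ∩ digitCell b M v =
      (fun t => t + ((τ v : ℝ) - v) / b ^ M) ⁻¹' (A ∩ digitCell b M (τ v)) := by
    ext t
    simp only [Set.mem_inter_iff, Set.mem_preimage]
    have hcell : t ∈ digitCell b M v ↔
        t + ((τ v : ℝ) - v) / b ^ M ∈ digitCell b M (τ v) := by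
      simp only [digitCell, Set.mem_Ico, sub_div, add_div]
      constructor <;> rintro ⟨h1, h2⟩ <;> constructor <;> linarith
    constructor
    · rintro ⟨h1, h2⟩
      rw [htrans v hv' t h2] at h1
      exact ⟨h1, hcell.1 h2⟩
    · rintro ⟨h1, h2⟩
      have h3 := hcell.2 h2
      exact ⟨by rw [htrans v hv' t h3]; exact h1, h3⟩
  rw [this, measure_preimage_add_right]

end Digits

/-! ### Averages of functions with vanishing sums in some variables -/

section Characters

variable {b : ℕ} [Fact b.Prime] {Ω : Type*} [Fintype Ω] [DecidableEq Ω]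

/-- Sums over all vectors vanish if the sums in the direction of one coordinate do. -/
lemma sum_eq_zero_of_sum_update {β R : Type*} [Fintype β] [AddCommMonoid R] [Inhabited β] (ω : Ω)
    {F : (Ω → β) → R} (h : ∀ v, ∑ c, F (Function.update v ω c) = 0) : ∑ v, F v = 0 := by
  rw [← Equiv.sum_comp (Equiv.funSplitAt ω β).symm, Fintype.sum_prod_type_right]
  refine Finset.sum_eq_zero fun r _ => ?_
  rw [← h ((Equiv.funSplitAt ω β).symm (default, r))]
  refine Finset.sum_congr rfl fun c _ => ?_
  congr 1
  funext i
  by_cases hi : i = ω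
  · subst hi; simp [Equiv.funSplitAt, Equiv.piSplitAt]
  · simp [Equiv.funSplitAt, Equiv.piSplitAt, hi]

lemma addChar_sum {A R κ : Type*} [AddCommMonoid A] [CommMonoid R] (ψ : AddChar A R)
    (I : Finset κ) (f : κ → A) : ψ (∑ i ∈ I, f i) = ∏ i ∈ I, ψ (f i) := by
  classical
  induction I using Finset.induction_on with
  | empty => simp
  | insert i I hi ih => rw [Finset.sum_insert hi, Finset.prod_insert hi, AddChar.map_add_eq_mul, ih]

/-- Orthogonality of the characters of `(ℤ/b)^Ω`. -/
lemma sum_stdAddChar_dot (w : Ω → ZMod b) :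
    ∑ c : Ω → ZMod b, ZMod.stdAddChar (∑ ω, c ω * w ω) =
      if w = 0 then (b : ℂ) ^ Fintype.card Ω else 0 := by
  have h1 : ∀ c : Ω → ZMod b, ZMod.stdAddChar (∑ ω, c ω * w ω) =
      ∏ ω, ZMod.stdAddChar (c ω * w ω) := fun c => addChar_sum _ _ _
  simp_rw [h1]
  rw [← Fintype.piFinset_univ, ← Finset.prod_univ_sum (fun _ => Finset.univ)
    (fun ω t => ZMod.stdAddChar (t * w ω))]
  simp_rw [AddChar.sum_mulShift _ (ZMod.isPrimitive_stdAddChar b)]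
  split_ifs with hw
  · simp [hw]
  · obtain ⟨ω, hω⟩ := Function.ne_iff.1 hw
    refine Finset.prod_eq_zero (Finset.mem_univ ω) ?_
    rw [if_neg (show w ω ≠ 0 from hω)]
    simp

/-- If `H` sums to zero in the direction of each coordinate in `J`, then its average over a family
of vectors vanishes as soon as the averages of those characters vanish all whose coefficients in
`J` are nonzero. -/
lemma sum_comp_eq_zero {ι : Type*} [Fintype ι] (J : Finset Ω) {H : (Ω → ZMod b) → ℝ}
    (hH : ∀ ω ∈ J, ∀ v, ∑ c, H (Function.update v ω c) = 0) (A : ι → Ω → ZMod b)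
    (hA : ∀ c : Ω → ZMod b, (∀ ω ∈ J, c ω ≠ 0) →
      ∑ n, ZMod.stdAddChar (∑ ω, c ω * A n ω) = (0 : ℂ)) (v : Ω → ZMod b) :
    ∑ n, H (A n + v) = 0 := by
  have hb : (b : ℂ) ^ Fintype.card Ω ≠ 0 :=
    pow_ne_zero _ (Nat.cast_ne_zero.2 (Fact.out : b.Prime).ne_zero)
  have hinv : ∀ w, (b : ℂ) ^ Fintype.card Ω * H w =
      ∑ c : Ω → ZMod b, (∑ w', (H w' : ℂ) * ZMod.stdAddChar (-∑ ω, c ω * w' ω)) *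
        ZMod.stdAddChar (∑ ω, c ω * w ω) := by
    intro w
    have h1 : ∀ c w' : Ω → ZMod b, (H w' : ℂ) * ZMod.stdAddChar (-∑ ω, c ω * w' ω) *
        ZMod.stdAddChar (∑ ω, c ω * w ω) =
          H w' * ZMod.stdAddChar (∑ ω, c ω * (w - w') ω) := by
      intro c w'
      rw [mul_assoc, ← AddChar.map_add_eq_mul]
      congr 2
      simp only [Pi.sub_apply, mul_sub, Finset.sum_sub_distrib]
      ring
    simp_rw [Finset.sum_mul, h1]
    rw [Finset.sum_comm]
    simp_rw [← Finset.mul_sum, sum_stdAddChar_dot]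
    rw [Finset.sum_eq_single w]
    · simp [mul_comm]
    · intro w' _ hw
      rw [if_neg (sub_ne_zero.2 hw.symm), mul_zero]
    · simp
  have hzero : ∀ c : Ω → ZMod b, ∀ ω ∈ J, c ω = 0 →
      ∑ w', (H w' : ℂ) * ZMod.stdAddChar (-∑ ω, c ω * w' ω) = 0 := by
    intro c ω hω hc
    refine sum_eq_zero_of_sum_update ω fun w => ?_
    have h1 : ∀ t, ∑ ω', c ω' * Function.update w ω t ω' = ∑ ω', c ω' * w ω' := fun t =>
      Finset.sum_congr rfl fun ω' _ => by
        rcases eq_or_ne ω' ω with rfl | h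
        · simp [hc]
        · simp [h]
    simp_rw [h1]
    rw [← Finset.sum_mul, ← Complex.ofReal_sum, hH ω hω w]
    simp
  have key : (b : ℂ) ^ Fintype.card Ω * ((∑ n, H (A n + v) : ℝ) : ℂ) = 0 := by
    rw [Complex.ofReal_sum, Finset.mul_sum]
    simp_rw [hinv]
    rw [Finset.sum_comm]
    refine Finset.sum_eq_zero fun c _ => ?_
    rw [← Finset.mul_sum]
    by_cases hc : ∀ ω ∈ J, c ω ≠ 0
    · have h1 : ∀ n, (ZMod.stdAddChar (∑ ω, c ω * (A n + v) ω) : ℂ) =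
          ZMod.stdAddChar (∑ ω, c ω * A n ω) * ZMod.stdAddChar (∑ ω, c ω * v ω) := by
        intro n
        rw [← AddChar.map_add_eq_mul]
        congr 1
        simp only [Pi.add_apply, mul_add, Finset.sum_add_distrib]
      simp_rw [h1]
      rw [← Finset.sum_mul, hA c hc, zero_mul, mul_zero]
    · push Not at hc
      obtain ⟨ω, hω, hc⟩ := hc
      rw [hzero c ω hω hc, zero_mul]
  have := (mul_eq_zero.1 key).resolve_left hb
  exact_mod_cast this

end Characters

/-! ### Averages over digital cells -/

section Cells

/-- The mean value of `g` over a digital cell of level `n`. -/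
def cellMean (b : ℕ) (g : ℝ → ℝ) (n v : ℕ) : ℝ := (b : ℝ) ^ n * ∫ t in digitCell b n v, g t

/-- The martingale differences of the cell means; by convention, that of level `0` is `1`. -/
def cellDiff (b : ℕ) (g : ℝ → ℝ) : ℕ → ℕ → ℝ
  | 0, _ => 1
  | n + 1, v => cellMean b g (n + 1) v - cellMean b g n (v / b)

lemma cellMean_zero (b : ℕ) (g : ℝ → ℝ) : cellMean b g 0 0 = ∫ t, g t ∂unitMeasure := by
  simp [cellMean, digitCell, unitMeasure]

variable {b : ℕ} [NeZero b]

lemma integrableOn_digitCell {g : ℝ → ℝ} (hg : Integrable g unitMeasure) {n v : ℕ}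
    (hv : v < b ^ n) : IntegrableOn g (digitCell b n v) :=
  IntegrableOn.mono_set hg (digitCell_subset hv)

lemma digitCell_succ (n v : ℕ) :
    ⋃ c ∈ Finset.range b, digitCell b (n + 1) (b * v + c) = digitCell b n v := by
  ext t
  simp only [Set.mem_iUnion, Finset.mem_range, exists_prop]
  have hb := NeZero.pos b
  rcases lt_or_ge t 0 with ht | ht
  · have h : ∀ n v, t ∉ digitCell b n v := fun n v h =>
      absurd (le_trans (by positivity) h.1) (not_le.2 ht)
    simp [h]
  have h1 : ⌊(b : ℝ) ^ (n + 1) * t⌋₊ / b = ⌊(b : ℝ) ^ n * t⌋₊ := by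
    rw [← Nat.floor_div_natCast]
    congr 1
    have : (b : ℝ) ≠ 0 := Nat.cast_ne_zero.2 hb.ne'
    field_simp
    ring
  simp_rw [mem_digitCell ht, ← h1]
  constructor
  · rintro ⟨c, hc, h⟩
    rw [h, Nat.mul_add_div hb, Nat.div_eq_of_lt hc, add_zero]
  · intro h
    exact ⟨_, Nat.mod_lt _ hb, by rw [← h, Nat.div_add_mod]⟩

lemma sum_cellMean_succ {g : ℝ → ℝ} (hg : Integrable g unitMeasure) {n v : ℕ} (hv : v < b ^ n) :
    ∑ c ∈ Finset.range b, cellMean b g (n + 1) (b * v + c) = b * cellMean b g n v := by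
  simp only [cellMean]
  rw [← Finset.mul_sum, ← digitCell_succ (b := b) n v, integral_biUnion_finset]
  · ring
  · exact fun _ _ => measurableSet_Ico
  · intro c _ c' _ hc
    exact disjoint_digitCell (n + 1) (by simpa using hc)
  · intro c hc
    refine (integrableOn_digitCell hg hv).mono_set ?_
    rw [← digitCell_succ (b := b) n v]
    exact Set.subset_biUnion_of_mem (u := fun c => digitCell b (n + 1) (b * v + c))
      (Finset.mem_coe.2 hc)

lemma abs_cellMean_sub_le {g : ℝ → ℝ} (hg : Integrable g unitMeasure)
    (hl : ∀ x ∈ Set.Ico (0 : ℝ) 1, ∀ x' ∈ Set.Ico (0 : ℝ) 1, |g x - g x'| ≤ |x - x'|) {n v : ℕ}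
    (hv : v < b ^ n) {z : ℝ} (hz : z ∈ digitCell b n v) :
    |cellMean b g n v - g z| ≤ ((b : ℝ) ^ n)⁻¹ := by
  have hb : (0 : ℝ) < (b : ℝ) ^ n := pow_pos (Nat.cast_pos.2 (NeZero.pos b)) n
  have hvol : volume.real (digitCell b n v) = ((b : ℝ) ^ n)⁻¹ := by
    rw [digitCell, Real.volume_real_Ico_of_le (by gcongr; linarith)]
    field_simp
    ring
  have hfin : volume (digitCell b n v) < ⊤ := measure_Ico_lt_top
  have h1 : cellMean b g n v - g z = (b : ℝ) ^ n * ∫ t in digitCell b n v, (g t - g z) := by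
    rw [integral_sub (integrableOn_digitCell hg hv) (integrableOn_const hfin.ne),
      setIntegral_const, hvol, cellMean, smul_eq_mul]
    field_simp
  have h2 : ‖∫ t in digitCell b n v, (g t - g z)‖ ≤ ((b : ℝ) ^ n)⁻¹ * ((b : ℝ) ^ n)⁻¹ := by
    rw [← hvol]
    conv_rhs => rw [mul_comm]
    refine le_trans (norm_setIntegral_le_of_norm_le_const hfin (C := ((b : ℝ) ^ n)⁻¹)
      fun t ht => ?_) (by rw [hvol])
    refine (hl t (digitCell_subset hv ht) z (digitCell_subset hv hz)).trans ?_
    have e : ((v : ℝ) + 1) / b ^ n = v / b ^ n + ((b : ℝ) ^ n)⁻¹ := by field_simp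
    have a1 := ht.1
    have a2 := hz.1
    have a3 := e ▸ ht.2
    have a4 := e ▸ hz.2
    rw [abs_le]
    constructor <;> linarith
  rw [h1, abs_mul, abs_of_pos hb]
  calc _ ≤ (b : ℝ) ^ n * (((b : ℝ) ^ n)⁻¹ * ((b : ℝ) ^ n)⁻¹) := by gcongr; exact h2
    _ = _ := by field_simp

lemma abs_cellDiff_le {g : ℝ → ℝ} (hg : Integrable g unitMeasure)
    (hl : ∀ x ∈ Set.Ico (0 : ℝ) 1, ∀ x' ∈ Set.Ico (0 : ℝ) 1, |g x - g x'| ≤ |x - x'|) {n : ℕ}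
    (hn : n ≠ 0) {z : ℝ} (hz : z ∈ Set.Ico (0 : ℝ) 1) :
    |cellDiff b g n ⌊(b : ℝ) ^ n * z⌋₊| ≤ 2 * b * ((b : ℝ) ^ n)⁻¹ := by
  obtain ⟨n, rfl⟩ := Nat.exists_eq_succ_of_ne_zero hn
  have hb1 : (1 : ℝ) ≤ b := Nat.one_le_cast.2 (NeZero.pos b)
  have hb : (b : ℝ) ≠ 0 := by positivity
  have hfl : ⌊(b : ℝ) ^ (n + 1) * z⌋₊ / b = ⌊(b : ℝ) ^ n * z⌋₊ := by
    rw [← Nat.floor_div_natCast]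
    congr 1
    field_simp
    ring
  simp only [Nat.succ_eq_add_one, cellDiff, hfl]
  have h1 := abs_cellMean_sub_le hg hl (floor_pow_mul_lt hz) ((mem_digitCell (b := b)
    (n := n + 1) hz.1).2 rfl)
  have h2 := abs_cellMean_sub_le hg hl (floor_pow_mul_lt hz) ((mem_digitCell (b := b)
    (n := n) hz.1).2 rfl)
  have h3 : ((b : ℝ) ^ (n + 1))⁻¹ ≤ ((b : ℝ) ^ n)⁻¹ :=
    inv_anti₀ (by positivity) (pow_le_pow_right₀ hb1 (by lia))
  have h4 : 2 * b * ((b : ℝ) ^ (n + 1))⁻¹ = 2 * ((b : ℝ) ^ n)⁻¹ := by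
    field_simp
    ring
  rw [h4]
  rw [abs_le] at h1 h2 ⊢
  constructor <;> linarith [h1.1, h1.2, h2.1, h2.2]

lemma sum_cellDiff {g : ℝ → ℝ} (h0 : ∫ t, g t ∂unitMeasure = 0) {z : ℝ}
    (hz : z ∈ Set.Ico (0 : ℝ) 1) (L : ℕ) :
    ∑ n ∈ Finset.Icc 1 L, cellDiff b g n ⌊(b : ℝ) ^ n * z⌋₊ =
      cellMean b g L ⌊(b : ℝ) ^ L * z⌋₊ := by
  have hb : (b : ℝ) ≠ 0 := Nat.cast_ne_zero.2 (NeZero.ne b)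
  induction L with
  | zero =>
    have : ⌊z⌋₊ = 0 := Nat.floor_eq_zero.2 hz.2
    simp [this, cellMean_zero, h0]
  | succ L ih =>
    rw [Finset.sum_Icc_succ_top (by lia), ih, cellDiff]
    have hfl : ⌊(b : ℝ) ^ (L + 1) * z⌋₊ / b = ⌊(b : ℝ) ^ L * z⌋₊ := by
      rw [← Nat.floor_div_natCast]
      congr 1
      field_simp
      ring
    rw [hfl]
    ring

end Cells

/-! ### A uniform bound for averages over a digitally shifted point set -/

section Averages

variable {b : ℕ} [Fact b.Prime]

/-- The digits of a real number, as residues modulo `b`. -/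
def residueDigit (b : ℕ) [Fact b.Prime] (x : ℝ) (i : ℕ) : ZMod b :=
  ((Real.digits x b i : ℕ) : ZMod b)

lemma val_residueDigit (x : ℝ) (i : ℕ) : (residueDigit b x i).val = Real.digits x b i := by
  rw [residueDigit, ZMod.val_natCast, Nat.mod_eq_of_lt (Real.digits x b i).isLt]

lemma residueDigit_digitAdd {M : ℕ} {x σ : ℝ} (hx : HasFiniteDigits b M x)
    (hσ : σ ∈ Set.Ico (0 : ℝ) 1) (i : ℕ) :
    residueDigit b (digitAdd b x σ) i = residueDigit b x i + residueDigit b σ i := by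
  have hb : 1 < b := (Fact.out : b.Prime).one_lt
  rw [residueDigit, digits_digitAdd hb hx hσ, residueDigit, residueDigit, Fin.val_add,
    ZMod.natCast_mod, Nat.cast_add]

variable {s N : ℕ}

/-- The linear combination with coefficients `c` of the digits of the coordinates of `x`, the
leading `M j` digits of the `j`-th coordinate being used. -/
def digitForm (M : Fin s → ℕ) (c : (Σ j, Fin (M j)) → ZMod b) (x : Fin s → ℝ) : ZMod b :=
  ∑ ω, c ω * residueDigit b (x ω.1) ω.2

/-- The average of a product of martingale differences of levels `M j` vanishes unless there is a
linear combination of the digits, with leading digits `M j`, whose character does not cancel. -/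
lemma sum_prod_cellDiff_eq_zero {x : Fin N → Fin s → ℝ} {K : ℕ}
    (hx : ∀ n j, HasFiniteDigits b K (x n j)) {σ : Fin s → ℝ} (hσ : σ ∈ cube s)
    {g : Fin s → ℝ → ℝ} {M : Fin s → ℕ} (hg : ∀ j, M j ≠ 0 → Integrable (g j) unitMeasure)
    (hM : ∀ c : (Σ j, Fin (M j)) → ZMod b, (∀ j (i : Fin (M j)), (i : ℕ) + 1 = M j → c ⟨j, i⟩ ≠ 0) →
      ∑ n, ZMod.stdAddChar (digitForm M c (x n)) = (0 : ℂ)) :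
    ∑ n, ∏ j, cellDiff b (g j) (M j) ⌊(b : ℝ) ^ M j * digitAdd b (x n j) (σ j)⌋₊ = 0 := by
  have hb : 1 < b := (Fact.out : b.Prime).one_lt
  set code : ∀ j, ((Σ j, Fin (M j)) → ZMod b) → ℕ := fun j w =>
    digitCode b (fun i => if h : i < M j then (w ⟨j, i, h⟩).val else 0) (M j) with hcode
  set A : Fin N → (Σ j, Fin (M j)) → ZMod b := fun n ω => residueDigit b (x n ω.1) ω.2 with hA
  set v : (Σ j, Fin (M j)) → ZMod b := fun ω => residueDigit b (σ ω.1) ω.2 with hv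
  have hfl : ∀ n j, ⌊(b : ℝ) ^ M j * digitAdd b (x n j) (σ j)⌋₊ = code j (A n + v) := by
    intro n j
    have hσj := mem_cube.1 hσ j
    rw [← digitCode_digits (digitAdd_mem hb (hx n j) hσj) hb, hcode]
    refine digitCode_congr fun i hi => ?_
    rw [dif_pos hi, hA, hv, Pi.add_apply]
    simp only
    rw [← residueDigit_digitAdd (hx n j) hσj, val_residueDigit]
  simp_rw [hfl]
  refine sum_comp_eq_zero (H := fun w => ∏ j, cellDiff b (g j) (M j) (code j w))
    (Finset.univ.filter fun ω : Σ j, Fin (M j) => (ω.2 : ℕ) + 1 = M ω.1) ?_ A ?_ v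
  · rintro ⟨j, i⟩ hω w
    have hi : (i : ℕ) + 1 = M j := by simpa using hω
    have hne : ∀ c, ∀ j' ∈ Finset.univ.erase j,
        cellDiff b (g j') (M j') (code j' (Function.update w ⟨j, i⟩ c)) =
          cellDiff b (g j') (M j') (code j' w) := by
      intro c j' hj'
      congr 1
      refine digitCode_congr fun i' hi' => ?_
      rw [dif_pos hi', dif_pos hi', Function.update_of_ne]
      intro h
      exact Finset.ne_of_mem_erase hj' (congrArg Sigma.fst h)
    have hsplit : ∀ c, ∏ j', cellDiff b (g j') (M j') (code j' (Function.update w ⟨j, i⟩ c)) =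
        cellDiff b (g j) (M j) (code j (Function.update w ⟨j, i⟩ c)) *
          ∏ j' ∈ Finset.univ.erase j, cellDiff b (g j') (M j') (code j' w) := by
      intro c
      rw [← Finset.mul_prod_erase _ _ (Finset.mem_univ j), Finset.prod_congr rfl (hne c)]
    simp_rw [hsplit]
    rw [← Finset.sum_mul]
    refine mul_eq_zero_of_left ?_ _
    -- the code without its last digit
    set V := digitCode b (fun i' => if h : i' < M j then (w ⟨j, i', h⟩).val else 0) i with hV
    have hVlt : V < b ^ (i : ℕ) := digitCode_lt (fun i' => by
      split_ifs
      · exact ZMod.val_lt _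
      · exact NeZero.pos b) _
    have hc : ∀ c : ZMod b, cellDiff b (g j) (M j) (code j (Function.update w ⟨j, i⟩ c)) =
        cellMean b (g j) (i + 1) (b * V + c.val) - cellMean b (g j) i V := by
      intro c
      have h1 : code j (Function.update w ⟨j, i⟩ c) = b * V + c.val := by
        have h2 : code j (Function.update w ⟨j, i⟩ c) = digitCode b (fun i' =>
          if h : i' < M j then (Function.update w ⟨j, i⟩ c ⟨j, i', h⟩).val else 0) (i + 1) := by
          rw [hi]
        rw [h2, digitCode, dif_pos i.isLt, hV]
        congr 2
        · refine digitCode_congr fun i' hi' => ?_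
          rw [dif_pos (by lia), dif_pos (by lia), Function.update_of_ne]
          intro h
          simp only [Sigma.mk.injEq, heq_eq_eq, true_and] at h
          have := congrArg Fin.val h
          simp only at this
          lia
        · simp
      rw [h1]
      have h3 : ∀ m, m = (i : ℕ) + 1 → cellDiff b (g j) m (b * V + c.val) =
          cellMean b (g j) (i + 1) (b * V + c.val) - cellMean b (g j) i V := by
        rintro m rfl
        rw [cellDiff, Nat.mul_add_div (NeZero.pos b), Nat.div_eq_of_lt (ZMod.val_lt c), add_zero]
      exact h3 _ hi.symm
    simp_rw [hc]
    rw [Finset.sum_sub_distrib, Finset.sum_const, Finset.card_univ, ZMod.card, nsmul_eq_mul,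
      ← sum_cellMean_succ (hg j (by lia)) hVlt, sub_eq_zero]
    refine Finset.sum_bij (fun c _ => c.val) (fun c _ => Finset.mem_range.2 (ZMod.val_lt c))
      (fun c _ c' _ h => ZMod.val_injective b h)
      (fun k hk => ⟨k, Finset.mem_univ _, ZMod.val_cast_of_lt (Finset.mem_range.1 hk)⟩)
      fun _ _ => rfl
  · intro c hc
    exact hM c fun j i hi => hc ⟨j, i⟩ (by simpa using hi)

/-- The geometric series with ratio `b ^ (-1/2)`. -/
lemma sum_sqrt_inv_pow_le {q : ℝ} (hq0 : 0 ≤ q) (hq : q ^ 2 ≤ 1 / 2) (L : ℕ) :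
    ∑ n ∈ Finset.Icc 1 L, q ^ n ≤ 3 := by
  have hq1 : q ≤ 3 / 4 := by nlinarith
  have h : ∑ n ∈ Finset.Icc 1 L, q ^ n ≤ 3 * (1 - q ^ L) := by
    induction L with
    | zero => simp
    | succ L ih =>
      rw [Finset.sum_Icc_succ_top (by lia), pow_succ]
      have : 0 ≤ q ^ L := by positivity
      nlinarith
  have : 0 ≤ q ^ L := by positivity
  linarith

/-- The average of a product of Lipschitz functions of mean zero over a digitally shifted point
set is small if the character sums of the point set vanish for all linear combinations of leading
digits. The figure of merit `ρ` bounds the exceptions. -/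
theorem abs_average_prod_le {x : Fin N → Fin s → ℝ} {K : ℕ}
    (hx : ∀ n j, HasFiniteDigits b K (x n j)) {σ : Fin s → ℝ} (hσ : σ ∈ cube s)
    {u : Finset (Fin s)} {g : Fin s → ℝ → ℝ} (hg : ∀ j ∈ u, Integrable (g j) unitMeasure)
    (hl : ∀ j ∈ u, ∀ x ∈ Set.Ico (0 : ℝ) 1, ∀ x' ∈ Set.Ico (0 : ℝ) 1,
      |g j x - g j x'| ≤ |x - x'|)
    (h0 : ∀ j ∈ u, ∫ t, g j t ∂unitMeasure = 0) {q ρ : ℝ} (hq0 : 0 ≤ q) (hq : q ^ 2 = (b : ℝ)⁻¹)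
    (hρ0 : 0 ≤ ρ)
    (hρ : ∀ M : Fin s → ℕ, (∀ j, M j ≠ 0 ↔ j ∈ u) → ∀ c : (Σ j, Fin (M j)) → ZMod b,
      (∀ j (i : Fin (M j)), (i : ℕ) + 1 = M j → c ⟨j, i⟩ ≠ 0) →
      ∑ n, ZMod.stdAddChar (digitForm M c (x n)) ≠ (0 : ℂ) → q ^ (∑ j, M j) ≤ ρ) :
    |1 / (N : ℝ) * ∑ n, ∏ j ∈ u, g j (digitAdd b (x n j) (σ j))| ≤ (6 * b) ^ u.card * ρ := by
  have hb : 1 < b := (Fact.out : b.Prime).one_lt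
  have hb2 : (2 : ℝ) ≤ b := by exact_mod_cast hb
  have hz : ∀ n j, digitAdd b (x n j) (σ j) ∈ Set.Ico (0 : ℝ) 1 := fun n j =>
    digitAdd_mem hb (hx n j) (mem_cube.1 hσ j)
  set z : Fin N → Fin s → ℝ := fun n j => digitAdd b (x n j) (σ j) with hzdef
  -- with each factor replaced by its mean over the cell of level `L` that contains the argument
  have approx : ∀ L : ℕ, |1 / (N : ℝ) * ∑ n, ∏ j ∈ u,
      cellMean b (g j) L ⌊(b : ℝ) ^ L * z n j⌋₊| ≤ (6 * b) ^ u.card * ρ := by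
    intro L
    set box : Finset (Fin s → ℕ) :=
      Fintype.piFinset fun j => if j ∈ u then Finset.Icc 1 L else {0} with hbox
    have hsupp : ∀ M ∈ box, ∀ j, M j ≠ 0 ↔ j ∈ u := by
      intro M hM j
      have := Fintype.mem_piFinset.1 hM j
      split_ifs at this with hj
      · have := Finset.mem_Icc.1 this
        simp only [hj, iff_true]; lia
      · simp only [hj, iff_false, not_not]
        simpa using this
    have hexp : ∀ n, ∏ j ∈ u, cellMean b (g j) L ⌊(b : ℝ) ^ L * z n j⌋₊ =
        ∑ M ∈ box, ∏ j, cellDiff b (g j) (M j) ⌊(b : ℝ) ^ M j * z n j⌋₊ := by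
      intro n
      rw [hbox, ← Finset.prod_univ_sum (fun j => if j ∈ u then Finset.Icc 1 L else {0})
        (fun j m => cellDiff b (g j) m ⌊(b : ℝ) ^ m * z n j⌋₊),
        ← Finset.prod_subset (Finset.subset_univ u)]
      · refine Finset.prod_congr rfl fun j hj => ?_
        rw [if_pos hj, sum_cellDiff (h0 j hj) (hz n j)]
      · intro j _ hj
        rw [if_neg hj, Finset.sum_singleton, cellDiff]
    have hterm : ∀ M ∈ box, |1 / (N : ℝ) *
        ∑ n, ∏ j, cellDiff b (g j) (M j) ⌊(b : ℝ) ^ M j * z n j⌋₊| ≤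
          ρ * ((2 * b) ^ u.card * ∏ j ∈ u, q ^ M j) := by
      intro M hM
      have hpos : 0 ≤ ρ * ((2 * b) ^ u.card * ∏ j ∈ u, q ^ M j) := by positivity
      by_cases hbad : ∀ c : (Σ j, Fin (M j)) → ZMod b,
          (∀ j (i : Fin (M j)), (i : ℕ) + 1 = M j → c ⟨j, i⟩ ≠ 0) →
          ∑ n, ZMod.stdAddChar (digitForm M c (x n)) = (0 : ℂ)
      · rw [sum_prod_cellDiff_eq_zero hx hσ (fun j hj => hg j ((hsupp M hM j).1 hj)) hbad]
        simpa using hpos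
      · push Not at hbad
        obtain ⟨c, hc, hne⟩ := hbad
        have h1 := hρ M (hsupp M hM) c hc hne
        have hMu : ∑ j, M j = ∑ j ∈ u, M j := by
          rw [← Finset.sum_subset (Finset.subset_univ u)]
          intro j _ hj
          by_contra h
          exact hj ((hsupp M hM j).1 h)
        rw [hMu, ← Finset.prod_pow_eq_pow_sum] at h1
        -- of the decay `b ^ (-∑ M j)`, one half is bounded by `ρ`, the other half is summable
        have h2 : ∀ n, |∏ j, cellDiff b (g j) (M j) ⌊(b : ℝ) ^ M j * z n j⌋₊| ≤
            (2 * b) ^ u.card * ((∏ j ∈ u, q ^ M j) * ∏ j ∈ u, q ^ M j) := by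
          intro n
          rw [← Finset.prod_subset (Finset.subset_univ u), Finset.abs_prod, ← Finset.prod_const,
            ← Finset.prod_mul_distrib, ← Finset.prod_mul_distrib]
          · refine Finset.prod_le_prod (fun _ _ => abs_nonneg _) fun j hj => ?_
            refine (abs_cellDiff_le (hg j hj) (hl j hj) ((hsupp M hM j).2 hj) (hz n j)).trans_eq ?_
            rw [← pow_add, ← two_mul, pow_mul, hq, inv_pow]
          · intro j _ hj
            have : M j = 0 := by
              by_contra h
              exact hj ((hsupp M hM j).1 h)
            rw [this, cellDiff]
        have h3 : 0 ≤ ∏ j ∈ u, q ^ M j := by positivity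
        rw [abs_mul, abs_of_nonneg (by positivity), one_div]
        rcases Nat.eq_zero_or_pos N with rfl | hN
        · simpa using hpos
        · rw [inv_mul_le_iff₀ (by positivity)]
          refine (Finset.abs_sum_le_sum_abs _ _).trans ?_
          refine (Finset.sum_le_sum fun n _ => h2 n).trans ?_
          rw [Finset.sum_const, Finset.card_univ, Fintype.card_fin, nsmul_eq_mul]
          refine mul_le_mul_of_nonneg_left ?_ (by positivity)
          calc _ ≤ (2 * (b : ℝ)) ^ u.card * (ρ * ∏ j ∈ u, q ^ M j) := by gcongr
            _ = _ := by ring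
    calc _ = |∑ M ∈ box, 1 / (N : ℝ) *
            ∑ n, ∏ j, cellDiff b (g j) (M j) ⌊(b : ℝ) ^ M j * z n j⌋₊| := by
          simp_rw [hexp]
          rw [Finset.sum_comm, Finset.mul_sum]
      _ ≤ ∑ M ∈ box, ρ * ((2 * b) ^ u.card * ∏ j ∈ u, q ^ M j) :=
          (Finset.abs_sum_le_sum_abs _ _).trans (Finset.sum_le_sum hterm)
      _ = ρ * ((2 * b) ^ u.card * ∏ j ∈ u, ∑ n ∈ Finset.Icc 1 L, q ^ n) := by
          rw [← Finset.mul_sum, ← Finset.mul_sum]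
          congr 2
          have : ∀ M ∈ box, ∏ j ∈ u, q ^ M j = ∏ j, q ^ M j := by
            intro M hM
            refine Finset.prod_subset (Finset.subset_univ u) fun j _ hj => ?_
            have : M j = 0 := by
              by_contra h
              exact hj ((hsupp M hM j).1 h)
            rw [this, pow_zero]
          rw [Finset.sum_congr rfl this, hbox,
            ← Finset.prod_univ_sum (fun j => if j ∈ u then Finset.Icc 1 L else {0})
              (fun j m => q ^ m), ← Finset.prod_subset (Finset.subset_univ u)]
          · exact Finset.prod_congr rfl fun j hj => by rw [if_pos hj]
          · intro j _ hj
            simp [hj]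
      _ ≤ ρ * ((2 * b) ^ u.card * ∏ j ∈ u, 3) := by
          gcongr
          refine sum_sqrt_inv_pow_le hq0 ?_ L
          rw [hq, one_div]
          exact inv_anti₀ (by norm_num) hb2
      _ = (6 * b) ^ u.card * ρ := by
          rw [Finset.prod_const, ← mul_pow]
          ring
  have hlim : Tendsto (fun L : ℕ => |1 / (N : ℝ) * ∑ n, ∏ j ∈ u,
      cellMean b (g j) L ⌊(b : ℝ) ^ L * z n j⌋₊|) atTop
      (𝓝 |1 / (N : ℝ) * ∑ n, ∏ j ∈ u, g j (z n j)|) := by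
    refine (Tendsto.const_mul _ (tendsto_finsetSum _ fun n _ =>
      tendsto_finsetProd _ fun j hj => ?_)).abs
    have h1 : Tendsto (fun L : ℕ => ((b : ℝ) ^ L)⁻¹) atTop (𝓝 0) :=
      (tendsto_pow_atTop_atTop_of_one_lt (by linarith)).inv_tendsto_atTop
    rw [tendsto_iff_dist_tendsto_zero]
    refine squeeze_zero (fun _ => dist_nonneg) (fun L => ?_) h1
    exact abs_cellMean_sub_le (hg j hj) (hl j hj) (floor_pow_mul_lt (hz n j))
      ((mem_digitCell (hz n j).1).2 rfl)
  exact le_of_tendsto' hlim approx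

end Averages

/-! ### The digits of an interlaced polynomial lattice point set -/

section Net

variable {b : ℕ} [Fact b.Prime]

lemma hasFiniteDigits_ofDigits {a : ℕ → Fin b} {M : ℕ} (h : ∀ i, M ≤ i → a i = 0) :
    Real.digits (Real.ofDigits a) b = a := digits_ofDigits (ofDigits_tail_of_finite h)

lemma vMap_eq_ofDigits (m : ℕ) (L : LaurentSeries (ZMod b)) : vMap b m L = Real.ofDigits
    fun l => if l < m then (⟨(L.coeff ((l : ℤ) + 1)).val, ZMod.val_lt _⟩ : Fin b) else 0 := by
  rw [Real.ofDigits, tsum_eq_sum (s := Finset.range m) fun l hl => by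
    rw [Finset.mem_range] at hl; simp [Real.ofDigitsTerm, hl]]
  rw [vMap, ← Finset.Ico_add_one_right_eq_Icc, Finset.sum_Ico_eq_sum_range]
  refine Finset.sum_congr (by simp) fun l hl => ?_
  have hl' : l < m := Finset.mem_range.1 (by simpa using hl)
  simp [Real.ofDigitsTerm, hl', div_eq_mul_inv, add_comm]

lemma digits_vMap (m : ℕ) (L : LaurentSeries (ZMod b)) (l : ℕ) :
    (Real.digits (vMap b m L) b l : ℕ) = if l < m then (L.coeff ((l : ℤ) + 1)).val else 0 := by
  rw [vMap_eq_ofDigits, hasFiniteDigits_ofDigits (M := m) fun i hi => if_neg (by lia)]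
  dsimp only
  split_ifs <;> rfl

lemma interlace_digits {m d : ℕ} (hd : 0 < d) {y : ℕ → ℝ} (hy : ∀ r, HasFiniteDigits b m (y r)) :
    HasFiniteDigits b (m * d) (interlace b d y) ∧
      ∀ i, Real.digits (interlace b d y) b i = Real.digits (y (i % d)) b (i / d) := by
  have h : ∀ i, m * d ≤ i → Real.digits (y (i % d)) b (i / d) = 0 := fun i hi =>
    hy _ _ ((Nat.le_div_iff_mul_le hd).2 hi)
  have h1 := hasFiniteDigits_ofDigits h
  refine ⟨fun i hi => ?_, fun i => congrFun h1 i⟩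
  exact (congrFun h1 i).trans (h i hi)

lemma hasFiniteDigits_vMap (m : ℕ) (L : LaurentSeries (ZMod b)) :
    HasFiniteDigits b m (vMap b m L) := by
  intro l hl
  ext
  rw [digits_vMap, if_neg (by lia)]
  rfl

lemma hasFiniteDigits_interlacedNet {m s d : ℕ} (hd : 0 < d) (p : (ZMod b)[X])
    (q : ℕ → (ZMod b)[X]) (n : Fin (b ^ m)) (j : Fin s) :
    HasFiniteDigits b (m * d) (interlacedNet b m s d p q n j) :=
  (interlace_digits hd fun _ => hasFiniteDigits_vMap m _).1

lemma residueDigit_interlacedNet {m s d : ℕ} (hd : 0 < d) (p : (ZMod b)[X])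
    (q : ℕ → (ZMod b)[X]) (n : Fin (b ^ m)) (j : Fin s) (i : ℕ) :
    residueDigit b (interlacedNet b m s d p q n j) i = if i / d < m then
      (embedLaurent b (natPoly b n * q (d * j + i % d)) / embedLaurent b p).coeff
        (((i / d : ℕ) : ℤ) + 1) else 0 := by
  have h := (interlace_digits (y := fun r => latticePoint b m p q n (d * (j : ℕ) + r)) hd
    fun _ => hasFiniteDigits_vMap m _).2 i
  rw [residueDigit, interlacedNet, h, latticePoint, digits_vMap]
  split_ifs
  · exact ZMod.natCast_zmod_val _
  · exact Nat.cast_zero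

lemma coeff_ofDigits_X (L : List ℕ) (a : ℕ) :
    (Nat.ofDigits (X : (ZMod b)[X]) L).coeff a = ((L.getD a 0 : ℕ) : ZMod b) := by
  induction L generalizing a with
  | nil => simp [Nat.ofDigits]
  | cons c L ih =>
    rw [Nat.ofDigits]
    cases a with
    | zero => simp
    | succ a =>
      rw [coeff_add, coeff_X_mul, ih, ← C_eq_natCast, coeff_C_succ]
      simp

/-- The coefficients of `tr_m(k)` are the lowest digits of `k`. -/
lemma coeff_truncPoly (m k a : ℕ) :
    (truncPoly b m k).coeff a = if a < m then ((k / b ^ a % b : ℕ) : ZMod b) else 0 := by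
  have hb : 2 ≤ b := (Fact.out : b.Prime).two_le
  rw [truncPoly, coeff_ofDigits_X]
  split_ifs with h
  · rw [← Nat.getD_digits k a hb]
    simp [List.getD_eq_getElem?_getD, h]
  · simp [List.getD_eq_getElem?_getD, h]

lemma natPoly_add_mul {c n : ℕ} (hc : c < b) :
    natPoly b (c + b * n) = (c : (ZMod b)[X]) + X * natPoly b n := by
  have hb : 1 < b := (Fact.out : b.Prime).one_lt
  rcases Nat.eq_zero_or_pos c with rfl | h
  · rcases Nat.eq_zero_or_pos n with rfl | h'
    · simp [natPoly, Nat.ofDigits]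
    · rw [natPoly, Nat.digits_add b hb 0 n hc (Or.inr h'.ne'), Nat.ofDigits]
      rfl
  · rw [natPoly, Nat.digits_add b hb c n hc (Or.inl h.ne'), Nat.ofDigits]
    rfl

/-- A character sum over all polynomials of degree less than `m` is nonzero only if the character
is trivial on them. -/
lemma eq_zero_of_sum_stdAddChar_ne_zero {m : ℕ} (ℓ : (ZMod b)[X] →+ ZMod b)
    (h : ∑ n : Fin (b ^ m), ZMod.stdAddChar (ℓ (natPoly b n)) ≠ (0 : ℂ)) :
    ∀ k < m, ℓ (X ^ k) = 0 := by
  induction m generalizing ℓ with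
  | zero => intro k hk; lia
  | succ m ih =>
    have h1 : ∑ n : Fin (b ^ (m + 1)), (ZMod.stdAddChar (ℓ (natPoly b n)) : ℂ) =
        (∑ n : Fin (b ^ m), ZMod.stdAddChar (ℓ (X * natPoly b n))) *
          ∑ c : ZMod b, ZMod.stdAddChar (c * ℓ 1) := by
      rw [← (finProdFinEquiv.trans (finCongr (pow_succ b m).symm)).sum_comp,
        Fintype.sum_prod_type, Finset.sum_mul]
      refine Finset.sum_congr rfl fun n _ => ?_
      rw [Finset.mul_sum]
      refine Finset.sum_bij (fun c _ => ((c : ℕ) : ZMod b)) (fun _ _ => Finset.mem_univ _)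
        (fun c _ c' _ hcc => ?_) (fun c _ => ⟨⟨c.val, ZMod.val_lt c⟩, Finset.mem_univ _, by simp⟩)
        fun c _ => ?_
      · have := congrArg ZMod.val hcc
        rwa [ZMod.val_cast_of_lt c.isLt, ZMod.val_cast_of_lt c'.isLt, ← Fin.ext_iff] at this
      · simp only [Equiv.trans_apply, finCongr_apply, Fin.val_cast, finProdFinEquiv_apply_val]
        rw [natPoly_add_mul c.isLt, ← AddChar.map_add_eq_mul, map_add, add_comm,
          ← nsmul_one (A := (ZMod b)[X]) (c : ℕ), map_nsmul, nsmul_eq_mul]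
    rw [h1] at h
    have h2 := left_ne_zero_of_mul h
    have h3 := right_ne_zero_of_mul h
    rw [AddChar.sum_mulShift _ (ZMod.isPrimitive_stdAddChar b)] at h3
    have h4 : ℓ 1 = 0 := by
      by_contra hne
      simp [hne] at h3
    intro k hk
    cases k with
    | zero => simpa using h4
    | succ k =>
      have := ih (ℓ.comp (AddMonoidHom.mulLeft X)) h2 k (by lia)
      simpa [pow_succ'] using this

/-! ### Polynomials as Laurent series -/

lemma embedLaurent_monomial (a : ℕ) (c : ZMod b) :
    embedLaurent b (monomial a c) = HahnSeries.single (-(a : ℤ)) c := by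
  have h : algebraMap (ZMod b) (LaurentSeries (ZMod b)) c = HahnSeries.C c := by
    rw [HahnSeries.algebraMap_apply']
    simp
  rw [embedLaurent, aeval_monomial, HahnSeries.single_pow, h, HahnSeries.C_apply,
    HahnSeries.single_mul_single]
  simp

lemma embedLaurent_mul (f g : (ZMod b)[X]) :
    embedLaurent b (f * g) = embedLaurent b f * embedLaurent b g := map_mul _ _ _

lemma embedLaurent_add (f g : (ZMod b)[X]) :
    embedLaurent b (f + g) = embedLaurent b f + embedLaurent b g := map_add _ _ _

lemma embedLaurent_sum {κ : Type*} (I : Finset κ) (f : κ → (ZMod b)[X]) :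
    embedLaurent b (∑ i ∈ I, f i) = ∑ i ∈ I, embedLaurent b (f i) := map_sum _ _ _

lemma coeff_embedLaurent (f : (ZMod b)[X]) (k : ℤ) :
    (embedLaurent b f).coeff k = if k ≤ 0 then f.coeff k.natAbs else 0 := by
  induction f using Polynomial.induction_on' with
  | add f g hf hg =>
    rw [embedLaurent_add, HahnSeries.coeff_add, hf, hg, coeff_add]
    split_ifs <;> simp
  | monomial a c =>
    rw [embedLaurent_monomial, HahnSeries.coeff_single, coeff_monomial]
    split_ifs <;> first | rfl | lia

lemma embedLaurent_ne_zero {f : (ZMod b)[X]} (hf : f ≠ 0) : embedLaurent b f ≠ 0 := by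
  intro h
  have h1 := coeff_embedLaurent f (-(f.natDegree : ℤ))
  rw [h, if_pos (by lia)] at h1
  simp only [HahnSeries.coeff_zero, Int.natAbs_neg, Int.natAbs_natCast, coeff_natDegree] at h1
  exact hf (leadingCoeff_eq_zero.1 h1.symm)

lemma order_embedLaurent {f : (ZMod b)[X]} (hf : f ≠ 0) :
    (embedLaurent b f).order = -(f.natDegree : ℤ) := by
  refine le_antisymm (HahnSeries.order_le_of_coeff_ne_zero ?_) ?_
  · rw [coeff_embedLaurent, if_pos (by lia)]
    simpa using hf
  · by_contra hlt
    have h1 := mt HahnSeries.coeff_order_eq_zero.1 (embedLaurent_ne_zero hf)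
    rw [coeff_embedLaurent] at h1
    split_ifs at h1 with h2
    · exact h1 (coeff_eq_zero_of_natDegree_lt (by lia))
    · exact h1 rfl

/-- The coefficient of `x⁻¹` in `g / p` is nonzero if `deg g = deg p - 1`. -/
lemma coeff_one_div_ne_zero {g p : (ZMod b)[X]} (hg : g ≠ 0) (hp : p ≠ 0)
    (h : g.natDegree + 1 = p.natDegree) :
    (embedLaurent b g / embedLaurent b p).coeff 1 ≠ 0 := by
  have hp' := embedLaurent_ne_zero hp
  have hL : embedLaurent b g / embedLaurent b p ≠ 0 := div_ne_zero (embedLaurent_ne_zero hg) hp'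
  have h1 : embedLaurent b g = embedLaurent b g / embedLaurent b p * embedLaurent b p :=
    (div_mul_cancel₀ _ hp').symm
  have h2 := congrArg HahnSeries.order h1
  rw [HahnSeries.order_mul hL hp', order_embedLaurent hg, order_embedLaurent hp] at h2
  have h3 : (embedLaurent b g / embedLaurent b p).order = 1 := by lia
  have h4 := mt HahnSeries.coeff_order_eq_zero.1 hL
  rwa [h3] at h4

/-- If the coefficients of `x⁻¹` in `x^k h / p` vanish for all `k < deg p`, then `p` divides `h`. -/
lemma dvd_of_coeff_eq_zero {h p : (ZMod b)[X]} (hp : p ≠ 0)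
    (hc : ∀ k < p.natDegree, (embedLaurent b (X ^ k * h) / embedLaurent b p).coeff 1 = 0) :
    p ∣ h := by
  rw [← EuclideanDomain.mod_eq_zero]
  by_contra hne
  have hp' := embedLaurent_ne_zero hp
  have hdeg : (h % p).natDegree < p.natDegree :=
    natDegree_lt_natDegree hne (degree_mod_lt h hp)
  set k := p.natDegree - 1 - (h % p).natDegree with hk
  have h1 := hc k (by lia)
  have h2 : X ^ k * h = X ^ k * (h % p) + X ^ k * (h / p) * p := by
    conv_lhs => rw [← EuclideanDomain.mod_add_div h p]
    ring
  rw [h2, embedLaurent_add, embedLaurent_mul _ p, add_div, mul_div_cancel_right₀ _ hp',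
    HahnSeries.coeff_add, coeff_embedLaurent (X ^ k * (h / p)), if_neg (by lia), add_zero] at h1
  refine coeff_one_div_ne_zero (mul_ne_zero (pow_ne_zero _ X_ne_zero) hne) hp ?_ h1
  rw [natDegree_mul (pow_ne_zero _ X_ne_zero) hne, natDegree_X_pow]
  lia

/-- Digit sums of `f / p` are coefficients of `x⁻¹` in polynomial multiples of `f / p`. -/
lemma sum_coeff_eq_coeff_one (m : ℕ) (T f p : (ZMod b)[X]) (hT : ∀ a, m ≤ a → T.coeff a = 0) :
    ∑ a ∈ Finset.range m, T.coeff a * (embedLaurent b f / embedLaurent b p).coeff ((a : ℤ) + 1) =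
      (embedLaurent b (T * f) / embedLaurent b p).coeff 1 := by
  have h1 : T = ∑ a ∈ Finset.range m, monomial a (T.coeff a) := by
    ext k
    simp only [finsetSum_coeff, coeff_monomial]
    rw [Finset.sum_ite_eq' (Finset.range m) k]
    split_ifs with hk
    · rfl
    · exact hT k (by simpa using hk)
  conv_rhs => rw [h1, embedLaurent_mul, embedLaurent_sum, mul_div_assoc, Finset.sum_mul,
    HahnSeries.coeff_sum]
  refine Finset.sum_congr rfl fun a _ => ?_
  rw [embedLaurent_monomial]
  have := HahnSeries.coeff_single_mul_add (r := T.coeff a)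
    (x := embedLaurent b f / embedLaurent b p) (a := (a : ℤ) + 1) (b := -(a : ℤ))
  rw [← this]
  congr 1
  lia

/-- There are natural numbers with prescribed digits. -/
lemma exists_nat_digits (K : ℕ) (e : ℕ → ℕ) (he : ∀ a, e a < b) :
    ∃ l < b ^ K, ∀ a, l / b ^ a % b = if a < K then e a else 0 := by
  have hb : 0 < b := (Fact.out : b.Prime).pos
  induction K generalizing e with
  | zero => exact ⟨0, by simp, fun a => by simp⟩
  | succ K ih =>
    obtain ⟨l, hl, hd⟩ := ih (fun a => e (a + 1)) fun a => he _
    refine ⟨e 0 + b * l, ?_, fun a => ?_⟩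
    · have := he 0
      calc e 0 + b * l < b * (l + 1) := by lia
        _ ≤ b * b ^ K := Nat.mul_le_mul_left _ hl
        _ = b ^ (K + 1) := (pow_succ' b K).symm
    · cases a with
      | zero => simp [Nat.mod_eq_of_lt (he 0)]
      | succ a =>
        rw [pow_succ', ← Nat.div_div_eq_div_mul, Nat.add_mul_div_left _ _ hb,
          Nat.div_eq_of_lt (he 0), zero_add, hd]
        simp

end Net

/-! ### The dual net and the figure of merit -/

section Merit

variable {b : ℕ} [Fact b.Prime]

/-- The part of the quality criterion that belongs to the coordinates in `u`, without its
weight. -/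
def projectionMerit (b : ℕ) [Fact b.Prime] (m α d t : ℕ) (p : (ZMod b)[X]) (q : ℕ → (ZMod b)[X])
    (u : Finset ℕ) : ℝ≥0∞ :=
  ∑ w ∈ ((Finset.univ : Finset (Fin t)).powerset.erase ∅).filter fun w => phi d w = u,
    ∑' l : {l : w → ℕ+ // zeroExtend w l ∈ dualNet b m t p q},
      ENNReal.ofReal (∏ i, rFun b α d (l.1 i))

lemma phi_mem {d s : ℕ} {w : Finset (Fin (d * s))} (hw : w ≠ ∅) :
    phi d w ∈ (Finset.range s).powerset.erase ∅ := by
  rw [Finset.mem_erase, Finset.mem_powerset]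
  refine ⟨?_, fun k hk => ?_⟩
  · rw [phi, ne_eq, Finset.image_eq_empty]
    exact hw
  · obtain ⟨i, -, rfl⟩ := Finset.mem_image.1 hk
    exact Finset.mem_range.2 (Nat.div_lt_of_lt_mul i.isLt)

lemma criterion_eq (m s α d : ℕ) (γ : Finset ℕ → ℝ≥0) (p : (ZMod b)[X]) (q : ℕ → (ZMod b)[X]) :
    criterion b m α d γ (d * s) p q = ∑ u ∈ (Finset.range s).powerset.erase ∅,
      ENNReal.ofReal (γ u * constDTilde b α d ^ u.card) *
        projectionMerit b m α d (d * s) p q u := by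
  rw [criterion, ← Finset.sum_fiberwise_of_maps_to (g := fun w => phi d w)
    (t := (Finset.range s).powerset.erase ∅) fun w hw => phi_mem (Finset.ne_of_mem_erase hw)]
  refine Finset.sum_congr rfl fun u _ => ?_
  rw [projectionMerit, Finset.mul_sum]
  refine Finset.sum_congr rfl fun w hw => ?_
  rw [(Finset.mem_filter.1 hw).2]

/-- The coordinate to which a component belongs. -/
def coordinate {d s : ℕ} (i : Fin (d * s)) : Fin s := ⟨i / d, Nat.div_lt_of_lt_mul i.isLt⟩

lemma sum_coordinate {d s : ℕ} (F : Fin s → ℕ) :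
    ∑ i : Fin (d * s), F (coordinate i) = d * ∑ j, F j := by
  rcases Nat.eq_zero_or_pos d with rfl | hd
  · have : IsEmpty (Fin (0 * s)) := by rw [zero_mul]; infer_instance
    simp
  rw [← (finProdFinEquiv.trans (finCongr (mul_comm s d))).sum_comp, Fintype.sum_prod_type,
    Finset.mul_sum]
  refine Finset.sum_congr rfl fun j _ => ?_
  have h : ∀ r : Fin d,
      coordinate ((finProdFinEquiv.trans (finCongr (mul_comm s d))) (j, r)) = j := by
    intro r
    ext
    simp [coordinate, Nat.add_mul_div_left _ _ hd, Nat.div_eq_of_lt r.isLt]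
  rw [Finset.sum_congr rfl fun r _ => congrArg F (h r)]
  simp

/-- A linear form in the digits of the net is the coefficient of `x⁻¹` in `n h / p`, where `h`
combines the generating polynomials with the polynomials that are built from the coefficients. -/
lemma digitForm_interlacedNet {m s d : ℕ} (hd : 0 < d) {M : Fin s → ℕ} (p : (ZMod b)[X])
    (q : ℕ → (ZMod b)[X]) (c : (Σ j, Fin (M j)) → ZMod b) (T : Fin (d * s) → (ZMod b)[X])
    (hT : ∀ i a, (T i).coeff a = if a < m then
      (if h : a * d + i % d < M (coordinate i) then c ⟨coordinate i, _, h⟩ else 0) else 0)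
    (n : Fin (b ^ m)) : digitForm M c (interlacedNet b m s d p q n) =
      (embedLaurent b (natPoly b n * ∑ i, T i * q i) / embedLaurent b p).coeff 1 := by
  have h1 : ∀ i : Fin (d * s), (embedLaurent b (T i * (natPoly b n * q i)) /
      embedLaurent b p).coeff 1 = ∑ a ∈ Finset.range m, (T i).coeff a *
        (embedLaurent b (natPoly b n * q i) / embedLaurent b p).coeff ((a : ℤ) + 1) := fun i =>
    (sum_coeff_eq_coeff_one m _ _ _ fun a ha => by rw [hT, if_neg (by lia)]).symm
  have h2 : (embedLaurent b (natPoly b n * ∑ i, T i * q i) / embedLaurent b p).coeff 1 =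
      ∑ i : Fin (d * s), (embedLaurent b (T i * (natPoly b n * q i)) /
        embedLaurent b p).coeff 1 := by
    rw [Finset.mul_sum, embedLaurent_sum, Finset.sum_div, HahnSeries.coeff_sum]
    refine Finset.sum_congr rfl fun i _ => ?_
    rw [mul_left_comm]
  rw [h2]
  simp_rw [h1]
  rw [← Finset.sum_product', digitForm]
  simp_rw [residueDigit_interlacedNet hd, mul_ite, mul_zero]
  rw [← Finset.sum_filter]
  have hlt : ∀ ω : Σ j, Fin (M j), d * (ω.1 : ℕ) + (ω.2 : ℕ) % d < d * s := fun ω => by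
    have h3 := ω.1.isLt
    have h4 := Nat.mod_lt (ω.2 : ℕ) hd
    calc _ < d * (ω.1 + 1) := by rw [mul_add]; lia
      _ ≤ d * s := Nat.mul_le_mul_left _ h3
  have hco : ∀ ω : Σ j, Fin (M j), coordinate ⟨_, hlt ω⟩ = ω.1 := fun ω => by
    ext
    simp only [coordinate]
    rw [Nat.mul_add_div hd, Nat.div_eq_of_lt (Nat.mod_lt _ hd), add_zero]
  have hmod : ∀ ω : Σ j, Fin (M j), (d * (ω.1 : ℕ) + (ω.2 : ℕ) % d) % d = (ω.2 : ℕ) % d :=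
    fun ω => by rw [Nat.mul_add_mod, Nat.mod_mod]
  have hpos : ∀ ω : Σ j, Fin (M j), (ω.2 : ℕ) / d * d + (ω.2 : ℕ) % d = ω.2 :=
    fun ω => Nat.div_add_mod' _ _
  refine Finset.sum_of_injOn
    (fun ω => ((⟨d * (ω.1 : ℕ) + (ω.2 : ℕ) % d, hlt ω⟩ : Fin (d * s)), (ω.2 : ℕ) / d)) ?_ ?_ ?_ ?_
  · intro ω _ ω' _ h
    simp only [Prod.mk.injEq, Fin.mk.injEq] at h
    have e1 : ω.1 = ω'.1 := by
      rw [← hco ω, ← hco ω']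
      congr 1
      exact Fin.ext h.1
    have e2 : (ω.2 : ℕ) = ω'.2 := by
      have := congrArg (· % d) h.1
      simp only [hmod] at this
      rw [← hpos ω, ← hpos ω', h.2, this]
    obtain ⟨j, i⟩ := ω
    obtain ⟨j', i'⟩ := ω'
    simp only at e1 e2
    subst e1
    rw [Fin.ext e2]
  · intro ω hω
    simp only [Finset.coe_filter, Finset.mem_univ, true_and, Set.mem_ofPred_eq] at hω
    simpa using hω
  · rintro ⟨i, a⟩ hia hni
    have ha : a < m := by simpa using hia
    simp only
    rw [hT, if_pos ha]
    split_ifs with h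
    · refine absurd ⟨⟨coordinate i, ⟨_, h⟩⟩, ?_, ?_⟩ hni
      · simp only [Finset.coe_filter, Finset.mem_univ, true_and, Set.mem_ofPred_eq]
        rw [Nat.mul_comm, Nat.mul_add_div hd, Nat.div_eq_of_lt (Nat.mod_lt _ hd), add_zero]
        exact ha
      · simp only [Prod.mk.injEq, Fin.ext_iff, coordinate]
        rw [Nat.mul_comm a d, Nat.mul_add_div hd, Nat.div_eq_of_lt (Nat.mod_lt _ hd), add_zero,
          Nat.mul_add_mod, Nat.mod_mod, Nat.div_add_mod]
        exact ⟨rfl, rfl⟩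
    · rw [zero_mul]
  · intro ω hω
    have hω' : (ω.2 : ℕ) / d < m := by simpa using hω
    simp only
    rw [hT, if_pos hω']
    congr 1
    have key : ∀ (j : Fin s) (k : ℕ), j = ω.1 → k = ω.2 →
        c ω = if h : k < M j then c ⟨j, ⟨k, h⟩⟩ else 0 := by
      rintro _ _ rfl rfl
      rw [dif_pos ω.2.isLt]
    exact key _ _ (hco ω) (by rw [hmod, hpos])

/-- A linear combination of digits whose character does not cancel over the net yields an element
of the dual net, and hence a lower bound for the merit. -/
lemma le_projectionMerit {m s α d : ℕ} (hd : 0 < d) {p : (ZMod b)[X]} (hp : p ≠ 0)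
    (hpm : p.natDegree = m) (q : ℕ → (ZMod b)[X]) {u : Finset (Fin s)} (hu : u.Nonempty)
    {M : Fin s → ℕ} (hM : ∀ j, M j ≠ 0 ↔ j ∈ u) (c : (Σ j, Fin (M j)) → ZMod b)
    (hc : ∀ j (i : Fin (M j)), (i : ℕ) + 1 = M j → c ⟨j, i⟩ ≠ 0)
    (hsum : ∑ n, ZMod.stdAddChar (digitForm M c (interlacedNet b m s d p q n)) ≠ (0 : ℂ)) :
    ENNReal.ofReal (((b : ℝ) ^ ((2 * min α d + α) * (d * ∑ j, M j)))⁻¹) ≤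
      projectionMerit b m α d (d * s) p q (u.map Fin.valEmbedding) := by
  have hb : 1 < b := (Fact.out : b.Prime).one_lt
  -- undoing the interlacing turns the coefficients of the form into the digits of an index vector
  set κ : Fin (d * s) → ℕ → ZMod b := fun i a =>
    if h : a * d + i % d < M (coordinate i) then c ⟨coordinate i, _, h⟩ else 0 with hκ
  choose l hl hdig using fun i : Fin (d * s) => exists_nat_digits (b := b) (M (coordinate i))
    (fun a => (κ i a).val) fun a => ZMod.val_lt _
  have hdig' : ∀ i a, l i / b ^ a % b = (κ i a).val := by
    intro i a
    rw [hdig]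
    split_ifs with h
    · rfl
    · rw [hκ]
      simp only
      rw [dif_neg (by have := Nat.le_mul_of_pos_right a hd; lia), ZMod.val_zero]
  set h : (ZMod b)[X] := ∑ i : Fin (d * s), truncPoly b m (l i) * q i with hh
  -- the form depends additively on the polynomial `n(x)`, so the character sum decides whether it
  -- vanishes identically
  set ℓ : (ZMod b)[X] →+ ZMod b := AddMonoidHom.mk' (fun f =>
    (embedLaurent b (f * h) / embedLaurent b p).coeff 1) (fun f g => by
      rw [add_mul, embedLaurent_add, add_div, HahnSeries.coeff_add]) with hℓ
  have hform : ∀ n, digitForm M c (interlacedNet b m s d p q n) = ℓ (natPoly b n) := fun n =>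
    digitForm_interlacedNet hd p q c (fun i => truncPoly b m (l i)) (fun i a => by
      rw [coeff_truncPoly, hdig', ZMod.natCast_zmod_val]) n
  simp_rw [hform] at hsum
  have hdvd : p ∣ h := dvd_of_coeff_eq_zero hp (by
    rw [hpm]
    exact eq_zero_of_sum_stdAddChar_ne_zero ℓ hsum)
  set w : Finset (Fin (d * s)) := Finset.univ.filter fun i => l i ≠ 0 with hw
  set l' : w → ℕ+ := fun i => ⟨l i, Nat.pos_of_ne_zero (Finset.mem_filter.1 i.2).2⟩ with hl'
  have hext : zeroExtend w l' = l := by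
    funext i
    rw [zeroExtend]
    split_ifs with hi
    · rfl
    · have : l i = 0 := by simpa [hw] using hi
      exact this.symm
  have hcoord : ∀ i ∈ w, coordinate i ∈ u := by
    intro i hi
    rw [← hM]
    intro h0
    have := hl i
    rw [h0, pow_zero, Nat.lt_one_iff] at this
    exact (Finset.mem_filter.1 hi).2 this
  have hphi : phi d w = u.map Fin.valEmbedding := by
    ext k
    simp only [phi, Finset.mem_image, Finset.mem_map, Fin.valEmbedding_apply]
    constructor
    · rintro ⟨i, hi, rfl⟩
      exact ⟨coordinate i, hcoord i hi, rfl⟩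
    · rintro ⟨j, hj, rfl⟩
      -- the component that contains the leading digit in use
      have hMj := Nat.pos_of_ne_zero ((hM j).2 hj)
      have hmod := Nat.mod_lt (M j - 1) hd
      have hlt : d * (j : ℕ) + (M j - 1) % d < d * s := by
        calc _ < d * (j + 1) := by rw [mul_add]; lia
          _ ≤ d * s := Nat.mul_le_mul_left _ j.isLt
      have hdiv : (d * (j : ℕ) + (M j - 1) % d) / d = j := by
        rw [Nat.mul_add_div hd, Nat.div_eq_of_lt hmod, add_zero]
      have hco : coordinate ⟨_, hlt⟩ = j := Fin.ext hdiv
      refine ⟨⟨_, hlt⟩, Finset.mem_filter.2 ⟨Finset.mem_univ _, fun h0 => ?_⟩, hdiv⟩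
      have h1 := hdig' ⟨_, hlt⟩ ((M j - 1) / d)
      rw [h0, Nat.zero_div, Nat.zero_mod, eq_comm, ZMod.val_eq_zero] at h1
      have hpos : (M j - 1) / d * d + (d * (j : ℕ) + (M j - 1) % d) % d = M j - 1 := by
        rw [Nat.mul_add_mod, Nat.mod_mod, Nat.div_add_mod']
      have key : ∀ (j' : Fin s) (k : ℕ) (hk : k < M j'), (h : j' = j) → k + 1 = M j →
          c ⟨j', ⟨k, hk⟩⟩ ≠ 0 := by
        rintro _ k hk rfl h
        exact hc _ _ h
      simp only [hκ] at h1
      rw [dif_pos (by rw [hpos, hco]; lia)] at h1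
      exact key _ _ _ hco (by rw [hpos]; lia) h1
  have hwne : w ≠ ∅ := by
    rintro h0
    rw [h0] at hphi
    simp only [phi, Finset.image_empty] at hphi
    exact hu.ne_empty (Finset.map_eq_empty.1 hphi.symm)
  have hbpos : (0 : ℝ) < b := by exact_mod_cast hb.trans' zero_lt_one
  have hprod : ((b : ℝ) ^ ((2 * min α d + α) * (d * ∑ j, M j)))⁻¹ ≤ ∏ i, rFun b α d (l' i) := by
    have e1 : ∏ i, rFun b α d (l' i) =
        ((b : ℝ) ^ ∑ i ∈ w, (2 * min α d * (Nat.digits b (l i)).length + α))⁻¹ := by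
      rw [← Finset.prod_pow_eq_pow_sum, ← Finset.prod_inv_distrib, ← Finset.prod_coe_sort w]
      refine Finset.prod_congr rfl fun i _ => ?_
      rw [rFun, if_neg (PNat.ne_zero _)]
      rfl
    rw [e1]
    refine inv_anti₀ (by positivity) (pow_le_pow_right₀ (by exact_mod_cast hb.le) ?_)
    rw [← sum_coordinate, Finset.mul_sum]
    refine le_trans (Finset.sum_le_sum fun i hi => ?_)
      (Finset.sum_le_sum_of_subset (Finset.subset_univ w))
    have a1 : (Nat.digits b (l i)).length ≤ M (coordinate i) :=
      (Nat.digits_length_le_iff hb _).2 (hl i)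
    have a2 : 1 ≤ M (coordinate i) := Nat.one_le_iff_ne_zero.2 ((hM _).2 (hcoord i hi))
    calc _ ≤ 2 * min α d * M (coordinate i) + α * M (coordinate i) :=
          add_le_add (Nat.mul_le_mul_left _ a1) (Nat.le_mul_of_pos_right _ a2)
      _ = _ := by ring
  refine (ENNReal.ofReal_le_ofReal hprod).trans ?_
  have hmem : zeroExtend w l' ∈ dualNet b m (d * s) p q := by
    rw [hext]; exact hdvd
  refine (ENNReal.le_tsum (f := fun l : {l : w → ℕ+ // zeroExtend w l ∈ dualNet b m (d * s) p q} =>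
    ENNReal.ofReal (∏ i, rFun b α d (l.1 i))) ⟨l', hmem⟩).trans ?_
  exact Finset.single_le_sum (f := fun w : Finset (Fin (d * s)) =>
    ∑' l : {l : w → ℕ+ // zeroExtend w l ∈ dualNet b m (d * s) p q},
      ENNReal.ofReal (∏ i, rFun b α d (l.1 i))) (fun _ _ => zero_le)
    (Finset.mem_filter.2 ⟨by simpa using hwne, hphi⟩)

end Merit

/-! ### The mean square error of the interlaced net -/

section MeanSquare

variable {b : ℕ} [Fact b.Prime]

lemma lintegral_cubeMeasure_prod {s : ℕ} {f : Fin s → ℝ → ℝ≥0∞} (hf : ∀ i, Measurable (f i)) :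
    ∫⁻ y, ∏ i, f i (y i) ∂(cubeMeasure s) = ∏ i, ∫⁻ t, f i t ∂unitMeasure := by
  rw [cubeMeasure_eq_pi, ProbabilityTheory.lintegral_prod_eq_prod_lintegral_of_indepFun Finset.univ
    (fun i (y : Fin s → ℝ) => f i (y i))
    (ProbabilityTheory.iIndepFun_pi fun i => (hf i).aemeasurable)
    fun i => (hf i).comp (measurable_pi_apply i)]
  refine Finset.prod_congr rfl fun i _ => ?_
  exact (measurePreserving_eval (fun _ : Fin s => unitMeasure) i).lintegral_comp (hf i)

/-- The mean of `indexError` over all digital shifts. -/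
def shiftedIndexError (b : ℕ) [NeZero b] {s N : ℕ} (α : ℕ) (a : Fin s → ℕ)
    (x : Fin N → Fin s → ℝ) : ℝ≥0∞ :=
  ∫⁻ σ, indexError α a (fun n j => digitAdd b (x n j) (σ j)) ∂(cubeMeasure s)

lemma measurable_shift {s : ℕ} (x : Fin s → ℝ) :
    Measurable fun σ : Fin s → ℝ => fun j => digitAdd b (x j) (σ j) :=
  measurable_pi_lambda _ fun j => (measurable_digitAdd (x j)).comp (measurable_pi_apply j)

lemma measurable_averageKernel_shift {s N : ℕ} (α : ℕ) (a : Fin s → ℕ) (x : Fin N → Fin s → ℝ) :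
    Measurable fun p : (Fin s → ℝ) × (Fin s → ℝ) =>
      averageKernel α a (fun n j => digitAdd b (x n j) (p.1 j)) p.2 :=
  (Finset.measurable_sum _ fun n _ => (measurable_prod_sobolevKernel α a).comp
    (((measurable_shift (x n)).comp measurable_fst).prodMk measurable_snd)).const_mul _

lemma measurable_indexError_shift {s N : ℕ} (α : ℕ) (a : Fin s → ℕ) (x : Fin N → Fin s → ℝ) :
    Measurable fun σ : Fin s → ℝ => indexError α a (fun n j => digitAdd b (x n j) (σ j)) :=
  ((measurable_averageKernel_shift α a x).pow_const 2).ennreal_ofReal.lintegral_prod_right'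

lemma meanSquareError_le {α s N M : ℕ} (hα : 0 < α) (hN : 0 < N) (γ : Finset ℕ → ℝ≥0)
    {x : Fin N → Fin s → ℝ} (hx : ∀ n j, HasFiniteDigits b M (x n j)) :
    meanSquareError b α γ x ≤ ∑ a ∈ (indexBox α Finset.univ).erase 0,
      (γ ((indexSupport a).map Fin.valEmbedding) : ℝ≥0∞) * shiftedIndexError b α a x := by
  have hb : 1 < b := (Fact.out : b.Prime).one_lt
  calc meanSquareError b α γ x
      ≤ ∫⁻ σ, ∑ a ∈ (indexBox α Finset.univ).erase 0,
          (γ ((indexSupport a).map Fin.valEmbedding) : ℝ≥0∞) *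
            indexError α a (fun n j => digitAdd b (x n j) (σ j)) ∂(cubeMeasure s) := by
        refine lintegral_mono_ae ((ae_cubeMeasure s).mono fun σ hσ => ?_)
        exact worstCaseError_sq_le hα hN γ fun n => mem_cube.2 fun j =>
          digitAdd_mem hb (hx n j) (mem_cube.1 hσ j)
    _ = _ := by
        rw [lintegral_finsetSum _ fun a _ => (measurable_indexError_shift α a x).const_mul _]
        exact Finset.sum_congr rfl fun a _ =>
          lintegral_const_mul _ (measurable_indexError_shift α a x)

lemma lintegral_lintegral_mul_sum {X Y : Type*} [MeasurableSpace X] [MeasurableSpace Y]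
    {μ : Measure X} {ν : Measure Y} [SFinite ν] {ι : Type*} [Fintype ι] {F : ι → X → Y → ℝ≥0∞}
    (hF : ∀ n, Measurable fun p : X × Y => F n p.1 p.2) (c : ℝ≥0∞) :
    ∫⁻ x, ∫⁻ y, c * ∑ n, F n x y ∂ν ∂μ = c * ∑ n, ∫⁻ x, ∫⁻ y, F n x y ∂ν ∂μ := by
  have h1 : ∀ x, ∫⁻ y, c * ∑ n, F n x y ∂ν = c * ∑ n, ∫⁻ y, F n x y ∂ν := fun x => by
    have h2 : ∀ n, Measurable (F n x) := fun n => (hF n).comp measurable_prodMk_left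
    rw [lintegral_const_mul _ (Finset.measurable_sum _ fun n _ => h2 n),
      lintegral_finsetSum _ fun n _ => h2 n]
  have h3 : ∀ n, Measurable fun x => ∫⁻ y, F n x y ∂ν := fun n => (hF n).lintegral_prod_right'
  simp_rw [h1]
  rw [lintegral_const_mul _ (Finset.measurable_sum _ fun n _ => h3 n),
    lintegral_finsetSum _ fun n _ => h3 n]

/-- By Jensen's inequality, and since every shifted point is uniformly distributed, the mean error
is at most the squared norm of the kernel. -/
lemma shiftedIndexError_le_prod {α s N M : ℕ} (hN : 0 < N) (a : Fin s → ℕ)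
    {x : Fin N → Fin s → ℝ} (hx : ∀ n j, HasFiniteDigits b M (x n j)) :
    shiftedIndexError b α a x ≤ ∏ i, sobolevKernelSq α (a i) := by
  have hb : 1 < b := (Fact.out : b.Prime).one_lt
  have hN' : (0 : ℝ) < N := by exact_mod_cast hN
  set F : Fin N → (Fin s → ℝ) → (Fin s → ℝ) → ℝ≥0∞ := fun n σ y =>
    ∏ i, ENNReal.ofReal (sobolevKernel α (a i) (digitAdd b (x n i) (σ i)) (y i) ^ 2) with hF
  have hker : ∀ i, Measurable fun p : ℝ × ℝ =>
      ENNReal.ofReal (sobolevKernel α (a i) p.1 p.2 ^ 2) := fun i =>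
    ((measurable_sobolevKernel α (a i)).pow_const 2).ennreal_ofReal
  have hint : ∀ n, ∫⁻ σ, ∫⁻ y, F n σ y ∂(cubeMeasure s) ∂(cubeMeasure s) =
      ∏ i, sobolevKernelSq α (a i) := by
    intro n
    have h1 : ∀ σ, ∫⁻ y, F n σ y ∂(cubeMeasure s) = ∏ i, ∫⁻ t,
        ENNReal.ofReal (sobolevKernel α (a i) (digitAdd b (x n i) (σ i)) t ^ 2) ∂unitMeasure :=
      fun σ => lintegral_cubeMeasure_prod (f := fun i t =>
        ENNReal.ofReal (sobolevKernel α (a i) (digitAdd b (x n i) (σ i)) t ^ 2))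
        fun i => (hker i).comp measurable_prodMk_left
    simp_rw [h1]
    rw [lintegral_cubeMeasure_prod (f := fun i t' => ∫⁻ t,
      ENNReal.ofReal (sobolevKernel α (a i) (digitAdd b (x n i) t') t ^ 2) ∂unitMeasure)
      fun i => (hker i).lintegral_prod_right'.comp (measurable_digitAdd _)]
    refine Finset.prod_congr rfl fun i _ => ?_
    exact (measurePreserving_digitAdd hb (hx n i)).lintegral_comp (hker i).lintegral_prod_right'
  have hFm : ∀ n, Measurable fun p : (Fin s → ℝ) × (Fin s → ℝ) => F n p.1 p.2 := fun n =>
    Finset.measurable_prod _ fun i _ => (hker i).comp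
      (((measurable_digitAdd (x n i)).comp ((measurable_pi_apply i).comp measurable_fst)).prodMk
        ((measurable_pi_apply i).comp measurable_snd))
  have hpt : ∀ σ y, ENNReal.ofReal
      (averageKernel α a (fun n j => digitAdd b (x n j) (σ j)) y ^ 2) ≤
        (N : ℝ≥0∞)⁻¹ * ∑ n, F n σ y := by
    intro σ y
    have h1 : averageKernel α a (fun n j => digitAdd b (x n j) (σ j)) y ^ 2 ≤ (N : ℝ)⁻¹ *
        ∑ n, ∏ i, sobolevKernel α (a i) (digitAdd b (x n i) (σ i)) (y i) ^ 2 := by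
      rw [averageKernel]
      have h2 := sq_sum_le_card_mul_sum_sq (s := (Finset.univ : Finset (Fin N)))
        (f := fun n => ∏ i, sobolevKernel α (a i) (digitAdd b (x n i) (σ i)) (y i))
      rw [Finset.card_univ, Fintype.card_fin] at h2
      simp_rw [Finset.prod_pow]
      rw [mul_pow]
      calc _ ≤ (1 / (N : ℝ)) ^ 2 * (N * ∑ n,
          (∏ i, sobolevKernel α (a i) (digitAdd b (x n i) (σ i)) (y i)) ^ 2) := by gcongr
        _ = _ := by field_simp
    refine (ENNReal.ofReal_le_ofReal h1).trans_eq ?_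
    rw [ENNReal.ofReal_mul (by positivity), ENNReal.ofReal_inv_of_pos hN', ENNReal.ofReal_natCast,
      ENNReal.ofReal_sum_of_nonneg fun n _ => Finset.prod_nonneg fun i _ => sq_nonneg _]
    congr 1
    exact Finset.sum_congr rfl fun n _ =>
      ENNReal.ofReal_prod_of_nonneg fun i _ => sq_nonneg _
  calc shiftedIndexError b α a x
      ≤ ∫⁻ σ, ∫⁻ y, (N : ℝ≥0∞)⁻¹ * ∑ n, F n σ y ∂(cubeMeasure s) ∂(cubeMeasure s) :=
        lintegral_mono fun σ => lintegral_mono fun y => hpt σ y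
    _ = (N : ℝ≥0∞)⁻¹ * ∑ n, ∫⁻ σ, ∫⁻ y, F n σ y ∂(cubeMeasure s) ∂(cubeMeasure s) :=
        lintegral_lintegral_mul_sum hFm _
    _ = _ := by
        simp_rw [hint]
        rw [Finset.sum_const, Finset.card_univ, Fintype.card_fin, nsmul_eq_mul, ← mul_assoc,
          ENNReal.inv_mul_cancel (by exact_mod_cast hN.ne') (ENNReal.natCast_ne_top N), one_mul]

lemma shiftedIndexError_le_sup {s N : ℕ} (α : ℕ) (a : Fin s → ℕ) (x : Fin N → Fin s → ℝ) {R : ℝ}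
    (h : ∀ σ ∈ cube s, ∀ y ∈ cube s,
      |averageKernel α a (fun n j => digitAdd b (x n j) (σ j)) y| ≤ R) :
    shiftedIndexError b α a x ≤ ENNReal.ofReal (R ^ 2) := by
  calc shiftedIndexError b α a x
      ≤ ∫⁻ _, ∫⁻ _, ENNReal.ofReal (R ^ 2) ∂(cubeMeasure s) ∂(cubeMeasure s) := by
        refine lintegral_mono_ae ((ae_cubeMeasure s).mono fun σ hσ => ?_)
        refine lintegral_mono_ae ((ae_cubeMeasure s).mono fun y hy => ?_)
        exact ENNReal.ofReal_le_ofReal (sq_le_sq' (neg_le_of_abs_le (h σ hσ y hy))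
          (le_of_abs_le (h σ hσ y hy)))
    _ = _ := by simp

/-- The interlaced net integrates the kernels with an error that is controlled by the merit of the
projection to the support of the index. -/
lemma abs_averageKernel_interlacedNet_le {m s α d : ℕ} (hα : 2 ≤ α) (hd : 0 < d) {p : (ZMod b)[X]}
    (hp : p ≠ 0) (hpm : p.natDegree = m) (q : ℕ → (ZMod b)[X]) {a : Fin s → ℕ}
    (ha : (indexSupport a).Nonempty) {X : ℝ} (hX : projectionMerit b m α d (d * s) p q
      ((indexSupport a).map Fin.valEmbedding) = ENNReal.ofReal X) (hX0 : 0 ≤ X)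
    {σ y : Fin s → ℝ} (hσ : σ ∈ cube s) (hy : y ∈ cube s) :
    |averageKernel α a (fun n j => digitAdd b (interlacedNet b m s d p q n j) (σ j)) y| ≤
      (6 * b) ^ (indexSupport a).card * X ^ (1 / (2 * ((2 * min α d + α) * d : ℕ) : ℝ)) := by
  have hb : 1 < b := (Fact.out : b.Prime).one_lt
  have hb0 : (0 : ℝ) < b := by exact_mod_cast hb.trans' zero_lt_one
  have hA : (0 : ℝ) < ((2 * min α d + α) * d : ℕ) := by
    have : 0 < (2 * min α d + α) * d := Nat.mul_pos (by lia) hd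
    exact_mod_cast this
  set A : ℕ := (2 * min α d + α) * d with hAdef
  have hprod : ∀ n : Fin (b ^ m), ∏ i, sobolevKernel α (a i)
      (digitAdd b (interlacedNet b m s d p q n i) (σ i)) (y i) =
      ∏ j ∈ indexSupport a, (fun j t => sobolevKernel α (a j) t (y j)) j
        (digitAdd b (interlacedNet b m s d p q n j) (σ j)) := by
    intro n
    refine (Finset.prod_subset (Finset.subset_univ _) fun j _ hj => ?_).symm
    have : a j = 0 := by simpa [indexSupport] using hj
    simp [this, sobolevKernel]
  rw [averageKernel]
  simp_rw [hprod]
  have hyj : ∀ j, y j ∈ Set.Ico (0 : ℝ) 1 := mem_cube.1 hy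
  refine abs_average_prod_le (hasFiniteDigits_interlacedNet hd p q) hσ
    (q := (b : ℝ) ^ (-(1 / 2) : ℝ)) (fun j _ => integrable_of_bound
      ((measurable_sobolevKernel α (a j)).comp measurable_prodMk_right).aestronglyMeasurable
      (C := 1) fun t _ => abs_sobolevKernel_le α (a j) t (hyj j))
    (fun j _ t ht t' ht' => abs_sobolevKernel_sub_le hα (a j) ht ht' (hyj j))
    (fun j hj => integral_sobolevKernel_left α (by simpa [indexSupport] using hj) (hyj j))
    (by positivity) ?_ (by positivity) fun M hM c hc hsum => ?_
  · rw [← Real.rpow_natCast, ← Real.rpow_mul hb0.le, ← Real.rpow_neg_one]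
    norm_num
  · have h1 := le_projectionMerit (α := α) hd hp hpm q ha hM c hc hsum
    rw [hX, ENNReal.ofReal_le_ofReal_iff hX0] at h1
    calc ((b : ℝ) ^ (-(1 / 2) : ℝ)) ^ (∑ j, M j)
        = (((b : ℝ) ^ ((2 * min α d + α) * (d * ∑ j, M j)))⁻¹) ^ (1 / (2 * (A : ℝ))) := by
          rw [← Real.rpow_natCast, ← Real.rpow_mul hb0.le, ← Real.rpow_natCast,
            ← Real.rpow_neg hb0.le, ← Real.rpow_mul hb0.le]
          congr 1
          rw [← mul_assoc, ← hAdef, Nat.cast_mul]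
          field_simp
      _ ≤ _ := Real.rpow_le_rpow (by positivity) h1 (by positivity)

/-- The indices with a given support. -/
lemma filter_indexSupport {s : ℕ} (α : ℕ) {u : Finset (Fin s)} :
    ((indexBox α Finset.univ).filter fun a : Fin s → ℕ => indexSupport a = u) =
      Fintype.piFinset fun j => if j ∈ u then Finset.Icc 1 α else {0} := by
  ext a
  simp only [Finset.mem_filter, mem_indexBox, Fintype.mem_piFinset, Finset.ext_iff, indexSupport,
    Finset.mem_univ, true_and, not_true_eq_false, IsEmpty.forall_iff, implies_true, and_true]
  rw [← forall_and]
  refine forall_congr' fun j => ?_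
  by_cases hj : j ∈ u
  · simp only [hj, iff_true, if_true, Finset.mem_Icc]
    lia
  · simp only [hj, iff_false, if_false, Finset.mem_singleton]
    lia

lemma sum_shiftedIndexError_le_pow {α s N M : ℕ} (hα : 2 ≤ α) (hN : 0 < N)
    {x : Fin N → Fin s → ℝ} (hx : ∀ n j, HasFiniteDigits b M (x n j)) (u : Finset (Fin s)) :
    ∑ a ∈ (indexBox α Finset.univ).filter (fun a : Fin s → ℕ => indexSupport a = u),
      shiftedIndexError b α a x ≤ ENNReal.ofReal (1 / 9) ^ u.card := by
  refine (Finset.sum_le_sum fun a _ => shiftedIndexError_le_prod (α := α) hN a hx).trans ?_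
  rw [filter_indexSupport, ← Finset.prod_univ_sum]
  calc ∏ j, ∑ i ∈ (if j ∈ u then Finset.Icc 1 α else {0}), sobolevKernelSq α i
      ≤ ∏ j, if j ∈ u then ENNReal.ofReal (1 / 9) else 1 := by
        refine Finset.prod_le_prod' fun j _ => ?_
        split_ifs
        · exact sum_sobolevKernelSq_le hα
        · simp [sobolevKernelSq_zero]
    _ = _ := by simp

/-- The uniform bound for the kernels is squared, and there are `α ^ |u|` indices with support
`u`. -/
lemma sum_shiftedIndexError_le_merit {m s α d : ℕ} (hα : 2 ≤ α) (hd : 0 < d) {p : (ZMod b)[X]}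
    (hp : p ≠ 0) (hpm : p.natDegree = m) (q : ℕ → (ZMod b)[X]) {u : Finset (Fin s)}
    (hu : u.Nonempty) :
    ∑ a ∈ (indexBox α Finset.univ).filter (fun a : Fin s → ℕ => indexSupport a = u),
      shiftedIndexError b α a (interlacedNet b m s d p q) ≤
        ENNReal.ofReal (α * (6 * b) ^ 2) ^ u.card *
          projectionMerit b m α d (d * s) p q (u.map Fin.valEmbedding) ^
            (1 / ((2 * min α d + α) * d : ℕ) : ℝ) := by
  have hb : 1 < b := (Fact.out : b.Prime).one_lt
  have hb0 : (0 : ℝ) < b := by exact_mod_cast hb.trans' zero_lt_one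
  have hA : (0 : ℝ) < ((2 * min α d + α) * d : ℕ) := by
    have : 0 < (2 * min α d + α) * d := Nat.mul_pos (by lia) hd
    exact_mod_cast this
  set A : ℕ := (2 * min α d + α) * d with hAdef
  set Y := projectionMerit b m α d (d * s) p q (u.map Fin.valEmbedding) with hY
  -- the merit is finite, but this is not needed
  by_cases hYtop : Y = ⊤
  · rw [hYtop, ENNReal.top_rpow_of_pos (by positivity), ENNReal.mul_top]
    · exact le_top
    · refine pow_ne_zero _ ?_
      rw [ne_eq, ENNReal.ofReal_eq_zero, not_le]
      have : 0 < α := by lia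
      positivity
  have hYX : Y = ENNReal.ofReal Y.toReal := (ENNReal.ofReal_toReal hYtop).symm
  set X := Y.toReal with hX
  have hX0 : 0 ≤ X := ENNReal.toReal_nonneg
  have hterm : ∀ a ∈ (indexBox α Finset.univ).filter (fun a : Fin s → ℕ => indexSupport a = u),
      shiftedIndexError b α a (interlacedNet b m s d p q) ≤
        ENNReal.ofReal ((6 * b) ^ (2 * u.card) * X ^ (1 / (A : ℝ))) := by
    intro a ha
    have hau : indexSupport a = u := (Finset.mem_filter.1 ha).2
    refine (shiftedIndexError_le_sup α a _ fun σ hσ y hy =>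
      abs_averageKernel_interlacedNet_le hα hd hp hpm q
        (hau ▸ hu) (by rw [hau]; exact hYX) hX0 hσ hy).trans_eq ?_
    rw [hau, mul_pow, ← pow_mul, mul_comm u.card 2, ← Real.rpow_natCast (X ^ _),
      ← Real.rpow_mul hX0]
    congr 3
    rw [Nat.cast_ofNat, ← hAdef]
    field_simp
  refine (Finset.sum_le_card_nsmul _ _ _ hterm).trans_eq ?_
  rw [hYX, ENNReal.ofReal_rpow_of_nonneg hX0 (by positivity), filter_indexSupport,
    Fintype.card_piFinset]
  have hcard : ∏ j, (if j ∈ u then Finset.Icc 1 α else {0}).card = α ^ u.card := by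
    rw [← Finset.prod_const, ← Finset.prod_subset (Finset.subset_univ u)]
    · exact Finset.prod_congr rfl fun j hj => by simp [hj]
    · intro j _ hj
      simp [hj]
  rw [hcard, ← ENNReal.ofReal_pow (by positivity), ← ENNReal.ofReal_mul (by positivity),
    nsmul_eq_mul, ← ENNReal.ofReal_natCast, ← ENNReal.ofReal_mul (by positivity)]
  congr 1
  rw [Nat.cast_pow, pow_mul, ← mul_assoc, ← mul_pow]

lemma le_rpow_mul_rpow {t T U : ℝ≥0∞} (hT : t ≤ T) (hU : t ≤ U) {θ : ℝ} (h0 : 0 ≤ θ)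
    (h1 : θ ≤ 1) : t ≤ T ^ (1 - θ) * U ^ θ :=
  calc t = t ^ (1 - θ) * t ^ θ := by
        rw [← ENNReal.rpow_add_of_nonneg _ _ (by linarith) h0, sub_add_cancel, ENNReal.rpow_one]
    _ ≤ _ := mul_le_mul' (ENNReal.rpow_le_rpow hT (by linarith)) (ENNReal.rpow_le_rpow hU h0)

lemma exists_map_valEmbedding {s : ℕ} {u : Finset ℕ} (hu : u ⊆ Finset.range s) :
    ∃ u' : Finset (Fin s), u'.map Fin.valEmbedding = u := by
  refine ⟨Finset.univ.filter fun i => (i : ℕ) ∈ u, ?_⟩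
  ext k
  simp only [Finset.mem_map, Finset.mem_filter, Finset.mem_univ, true_and, Fin.valEmbedding_apply]
  constructor
  · rintro ⟨i, hi, rfl⟩
    exact hi
  · intro hk
    exact ⟨⟨k, Finset.mem_range.1 (hu hk)⟩, hk, rfl⟩

/-- The interpolation between the trivial bound and the bound by the merit. -/
lemma meanSquareError_interlacedNet_le {m s α d : ℕ} (hα : 2 ≤ α) (hd : 0 < d)
    (γ : Finset ℕ → ℝ≥0) {p : (ZMod b)[X]} (hp : p ≠ 0) (hpm : p.natDegree = m)
    (q : ℕ → (ZMod b)[X]) {θ : ℝ} (h0 : 0 ≤ θ) (h1 : θ ≤ 1) :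
    meanSquareError b α γ (interlacedNet b m s d p q) ≤
      ∑ u ∈ (Finset.range s).powerset.erase ∅, (γ u : ℝ≥0∞) *
        ((ENNReal.ofReal (1 / 9) ^ u.card) ^ (1 - θ) *
          (ENNReal.ofReal (α * (6 * b) ^ 2) ^ u.card *
            projectionMerit b m α d (d * s) p q u ^
              (1 / ((2 * min α d + α) * d : ℕ) : ℝ)) ^ θ) := by
  have hb : 1 < b := (Fact.out : b.Prime).one_lt
  have hN : 0 < b ^ m := pow_pos (by lia) m
  refine (meanSquareError_le (by lia) hN γ (hasFiniteDigits_interlacedNet hd p q)).trans ?_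
  rw [← Finset.sum_fiberwise_of_maps_to
    (g := fun a : Fin s → ℕ => (indexSupport a).map Fin.valEmbedding)
    (t := (Finset.range s).powerset.erase ∅)]
  swap
  · intro a ha
    rw [Finset.mem_erase, Finset.mem_powerset]
    refine ⟨?_, fun k hk => ?_⟩
    · rw [ne_eq, Finset.map_eq_empty, indexSupport, Finset.filter_eq_empty_iff]
      intro h
      exact Finset.ne_of_mem_erase ha (funext fun i => not_not.1 (h (Finset.mem_univ i)))
    · obtain ⟨i, -, rfl⟩ := Finset.mem_map.1 hk
      exact Finset.mem_range.2 i.isLt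
  refine Finset.sum_le_sum fun u hu => ?_
  obtain ⟨hune, hus⟩ := Finset.mem_erase.1 hu
  obtain ⟨u', rfl⟩ := exists_map_valEmbedding (Finset.mem_powerset.1 hus)
  have hu' : u'.Nonempty := by
    rw [Finset.nonempty_iff_ne_empty]
    rintro rfl
    exact hune rfl
  rw [Finset.card_map]
  calc _ = (γ (u'.map Fin.valEmbedding) : ℝ≥0∞) *
        ∑ a ∈ ((indexBox α Finset.univ).erase 0).filter
          (fun a : Fin s → ℕ => (indexSupport a).map Fin.valEmbedding = u'.map Fin.valEmbedding),
            shiftedIndexError b α a (interlacedNet b m s d p q) := by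
        rw [Finset.mul_sum]
        refine Finset.sum_congr rfl fun a ha => ?_
        rw [(Finset.mem_filter.1 ha).2]
    _ ≤ (γ (u'.map Fin.valEmbedding) : ℝ≥0∞) *
        ∑ a ∈ (indexBox α Finset.univ).filter (fun a : Fin s → ℕ => indexSupport a = u'),
            shiftedIndexError b α a (interlacedNet b m s d p q) := by
        refine mul_le_mul_right (Finset.sum_le_sum_of_subset fun a ha => ?_) _
        obtain ⟨h2, h3⟩ := Finset.mem_filter.1 ha
        exact Finset.mem_filter.2 ⟨Finset.mem_of_mem_erase h2,
          Finset.map_injective Fin.valEmbedding h3⟩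
    _ ≤ _ := mul_le_mul_right (le_rpow_mul_rpow
        (sum_shiftedIndexError_le_pow hα hN (hasFiniteDigits_interlacedNet hd p q) u')
        (sum_shiftedIndexError_le_merit hα hd hp hpm q hu') h0 h1) _

end MeanSquare

/-! ### The quality criterion as a sum over index vectors -/

section Criterion

variable {b : ℕ} [Fact b.Prime]

lemma constCLam_one (b α d : ℕ) : constCLam b α d 1 =
    ((b : ℝ) ^ α)⁻¹ * (((b : ℝ) - 1) / ((b : ℝ) ^ (2 * min α d) - b)) := by
  have h : (b : ℝ) ^ (2 * 1 * ((min α d : ℕ) : ℝ)) = (b : ℝ) ^ (2 * min α d) := by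
    rw [← Real.rpow_natCast]
    push_cast
    rw [mul_one]
  rw [constCLam, h, Real.rpow_one, max_self, mul_one, Real.rpow_natCast, one_div]

lemma lt_pow_two_mul_min {α d : ℕ} (hα : 2 ≤ α) (hd : 1 ≤ d) :
    (b : ℝ) < (b : ℝ) ^ (2 * min α d) := by
  have hb : (1 : ℝ) < b := by exact_mod_cast (Fact.out : b.Prime).one_lt
  calc (b : ℝ) = (b : ℝ) ^ 1 := (pow_one _).symm
    _ < _ := pow_lt_pow_right₀ hb (by lia)

lemma constCLam_one_pos {α d : ℕ} (hα : 2 ≤ α) (hd : 1 ≤ d) : 0 < constCLam b α d 1 := by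
  have hb : (1 : ℝ) < b := by exact_mod_cast (Fact.out : b.Prime).one_lt
  have := lt_pow_two_mul_min (b := b) hα hd
  rw [constCLam_one]
  exact mul_pos (inv_pos.2 (by positivity)) (div_pos (by linarith) (by linarith))

lemma rFun_nonneg (b α d l : ℕ) : 0 ≤ rFun b α d l := by
  rw [rFun]
  split_ifs <;> positivity

lemma rFun_pow_mul (α d m : ℕ) {l : ℕ} (hl : l ≠ 0) :
    rFun b α d (b ^ m * l) = ((b : ℝ) ^ (2 * min α d * m))⁻¹ * rFun b α d l := by
  have hb : 1 < b := (Fact.out : b.Prime).one_lt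
  have hb0 : b ^ m * l ≠ 0 := mul_ne_zero (pow_ne_zero _ (by lia)) hl
  rw [rFun, rFun, if_neg hl, if_neg hb0, Nat.digits_base_pow_mul hb (Nat.pos_of_ne_zero hl),
    List.length_append, List.length_replicate, ← mul_inv, ← pow_add]
  congr 2
  ring

/-- The indices with exactly `k + 1` digits contribute a term of a geometric series. -/
lemma sum_rFun_Ico {α d : ℕ} (hα : 2 ≤ α) (hd : 1 ≤ d) (k : ℕ) :
    ∑ l ∈ Finset.Ico 1 (b ^ k), rFun b α d l =
      constCLam b α d 1 * (1 - ((b : ℝ) ^ ((2 * min α d - 1) * k))⁻¹) := by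
  have hb : 1 < b := (Fact.out : b.Prime).one_lt
  have hb0 : (0 : ℝ) < b := by exact_mod_cast hb.trans' zero_lt_one
  have hlt := lt_pow_two_mul_min (b := b) hα hd
  induction k with
  | zero => simp
  | succ k ih =>
    rw [← Finset.sum_Ico_consecutive _ (Nat.one_le_pow k b (by lia))
      (Nat.pow_le_pow_right (by lia) (by lia : k ≤ k + 1)), ih]
    have h1 : ∀ l ∈ Finset.Ico (b ^ k) (b ^ (k + 1)),
        rFun b α d l = ((b : ℝ) ^ (2 * min α d * (k + 1) + α))⁻¹ := by
      intro l hl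
      rw [Finset.mem_Ico] at hl
      have hl0 : l ≠ 0 := Nat.one_le_iff_ne_zero.1 ((Nat.one_le_pow k b (by lia)).trans hl.1)
      have hlen : (Nat.digits b l).length = k + 1 :=
        le_antisymm ((Nat.digits_length_le_iff hb _).2 hl.2)
          ((Nat.lt_digits_length_iff hb _).2 hl.1)
      rw [rFun, if_neg hl0, hlen]
    rw [Finset.sum_congr rfl h1, Finset.sum_const, Nat.card_Ico, nsmul_eq_mul, constCLam_one,
      Nat.cast_sub (Nat.pow_le_pow_right (by lia) (by lia : k ≤ k + 1))]
    obtain ⟨n, hn⟩ : ∃ n, 2 * min α d = n + 1 := ⟨2 * min α d - 1, by lia⟩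
    rw [hn] at hlt ⊢
    have h2 : (b : ℝ) ^ n - 1 ≠ 0 := by
      rw [pow_succ] at hlt
      have : 1 < (b : ℝ) ^ n := by
        by_contra! h
        nlinarith
      linarith
    have h3 : (b : ℝ) ^ (n + 1) - b = b * ((b : ℝ) ^ n - 1) := by ring
    rw [h3, Nat.add_sub_cancel]
    push_cast
    rw [show (n + 1) * (k + 1) + α = n * k + n + k + 1 + α by ring, Nat.mul_succ]
    simp only [pow_add, pow_one]
    field_simp
    ring

lemma tsum_rFun_le {α d : ℕ} (hα : 2 ≤ α) (hd : 1 ≤ d) :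
    ∑' l : ℕ+, ENNReal.ofReal (rFun b α d l) ≤ ENNReal.ofReal (constCLam b α d 1) := by
  have hb : 1 < b := (Fact.out : b.Prime).one_lt
  have hc := constCLam_one_pos (b := b) hα hd
  rw [tsum_pnat_eq_tsum_succ (f := fun l => ENNReal.ofReal (rFun b α d l))]
  refine ENNReal.tsum_le_of_sum_range_le fun n => ?_
  rw [← ENNReal.ofReal_sum_of_nonneg fun i _ => rFun_nonneg _ _ _ _]
  refine ENNReal.ofReal_le_ofReal ?_
  rw [Finset.range_eq_Ico, Finset.sum_Ico_add' (rFun b α d) 0 n 1]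
  calc _ ≤ ∑ l ∈ Finset.Ico 1 (b ^ (n + 1)), rFun b α d l := by
        refine Finset.sum_le_sum_of_subset_of_nonneg (Finset.Ico_subset_Ico le_rfl ?_)
          fun i _ _ => rFun_nonneg _ _ _ _
        exact (Nat.lt_pow_self hb).le
    _ ≤ constCLam b α d 1 * 1 := by
        rw [sum_rFun_Ico hα hd]
        refine mul_le_mul_of_nonneg_left ?_ hc.le
        have : (0 : ℝ) ≤ ((b : ℝ) ^ ((2 * min α d - 1) * (n + 1)))⁻¹ := by positivity
        linarith
    _ = _ := mul_one _

lemma tsum_pi_fin_prod {β : Type*} (f : β → ℝ≥0∞) (n : ℕ) :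
    ∑' l : Fin n → β, ∏ i, f (l i) = (∑' x, f x) ^ n := by
  induction n with
  | zero => simp
  | succ n ih =>
    rw [← (Fin.consEquiv fun _ : Fin (n + 1) => β).tsum_eq, ENNReal.tsum_prod', pow_succ', ← ih,
      ← ENNReal.tsum_mul_right]
    refine tsum_congr fun x => ?_
    rw [← ENNReal.tsum_mul_left]
    refine tsum_congr fun l => ?_
    rw [Fin.prod_univ_succ]
    simp [Fin.consEquiv]

/-- A sum over all vectors of a product of functions of the entries. -/
lemma tsum_pi_prod {ι β : Type*} [Fintype ι] (f : β → ℝ≥0∞) :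
    ∑' l : ι → β, ∏ i, f (l i) = (∑' x, f x) ^ Fintype.card ι := by
  rw [← tsum_pi_fin_prod, ← (Equiv.arrowCongr (Fintype.equivFin ι) (Equiv.refl β)).symm.tsum_eq]
  refine tsum_congr fun l => ?_
  exact (Fintype.equivFin ι).prod_comp fun i => f (l i)

lemma filter_zeroExtend_ne_zero {t : ℕ} (w : Finset (Fin t)) (l : w → ℕ+) :
    (Finset.univ.filter fun i => zeroExtend w l i ≠ 0) = w := by
  ext i
  rw [Finset.mem_filter, zeroExtend]
  split_ifs with hi <;> simp [hi]

/-- A sum over all index vectors, arranged by their supports. -/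
lemma sum_tsum_zeroExtend {t : ℕ} (H : (Fin t → ℕ) → ℝ≥0∞) :
    ∑ w : Finset (Fin t), ∑' l : w → ℕ+, H (zeroExtend w l) = ∑' l, H l := by
  set e : (Σ w : Finset (Fin t), w → ℕ+) → (Fin t → ℕ) := fun x => zeroExtend x.1 x.2 with he
  have hbij : Function.Bijective e := by
    constructor
    · rintro ⟨w, l⟩ ⟨w', l'⟩ h
      obtain rfl : w = w' := by
        rw [← filter_zeroExtend_ne_zero w l, ← filter_zeroExtend_ne_zero w' l']
        exact Finset.filter_congr fun i _ => by
          rw [show zeroExtend w l i = zeroExtend w' l' i from congrFun h i]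
      congr 1
      funext i
      have := congrFun h i
      simp only [he, zeroExtend, i.2, dite_true] at this
      exact PNat.coe_injective this
    · intro l
      refine ⟨⟨Finset.univ.filter fun i => l i ≠ 0, fun i =>
        ⟨l i, Nat.pos_of_ne_zero (Finset.mem_filter.1 i.2).2⟩⟩, ?_⟩
      funext i
      simp only [he, zeroExtend]
      split_ifs with hi
      · rfl
      · simpa [eq_comm] using hi
  rw [← (Equiv.ofBijective e hbij).tsum_eq, ENNReal.tsum_sigma', tsum_fintype]
  rfl

/-- The coordinates that are met by the support of an index vector. -/
def metCoordinates (d : ℕ) {t : ℕ} (l : Fin t → ℕ) : Finset ℕ :=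
  phi d (Finset.univ.filter fun i => l i ≠ 0)

/-- The term of an index vector in the quality criterion. -/
def indexMerit (b α d : ℕ) (γ : Finset ℕ → ℝ≥0) {t : ℕ} (l : Fin t → ℕ) : ℝ≥0∞ :=
  ENNReal.ofReal (γ (metCoordinates d l) * constDTilde b α d ^ (metCoordinates d l).card) *
    ∏ i, ENNReal.ofReal (rFun b α d (l i))

lemma prod_rFun_zeroExtend (b α d : ℕ) {t : ℕ} (w : Finset (Fin t)) (l : w → ℕ+) :
    ∏ i, ENNReal.ofReal (rFun b α d (zeroExtend w l i)) =
      ∏ i, ENNReal.ofReal (rFun b α d (l i)) := by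
  rw [← Finset.prod_subset (Finset.subset_univ w), ← Finset.prod_coe_sort w]
  · refine Finset.prod_congr rfl fun i _ => ?_
    simp [zeroExtend]
  · intro i _ hi
    simp [zeroExtend, hi, rFun]

lemma zeroExtend_eq_zero {t : ℕ} {w : Finset (Fin t)} {l : w → ℕ+} :
    zeroExtend w l = 0 ↔ w = ∅ := by
  constructor
  · intro h
    rw [← filter_zeroExtend_ne_zero w l, h]
    simp
  · rintro rfl
    funext i
    simp [zeroExtend]

open Classical in
lemma criterion_eq_tsum (m α d : ℕ) (γ : Finset ℕ → ℝ≥0) (t : ℕ) (p : (ZMod b)[X])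
    (q : ℕ → (ZMod b)[X]) : criterion b m α d γ t p q =
      ∑' l : Fin t → ℕ, if l ≠ 0 ∧ l ∈ dualNet b m t p q then indexMerit b α d γ l else 0 := by
  rw [← sum_tsum_zeroExtend, criterion, Finset.powerset_univ]
  refine (Finset.sum_congr rfl fun w hw => ?_).trans
    (Finset.sum_subset (Finset.erase_subset ∅ Finset.univ) fun w _ hw => ?_)
  · have hw' := Finset.ne_of_mem_erase hw
    rw [← ENNReal.tsum_mul_left]
    refine (tsum_subtype {l : w → ℕ+ | zeroExtend w l ∈ dualNet b m t p q} fun l =>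
      ENNReal.ofReal (γ (phi d w) * constDTilde b α d ^ (phi d w).card) *
        ENNReal.ofReal (∏ i, rFun b α d (l i))).trans ?_
    refine tsum_congr fun l => ?_
    simp only [Set.indicator_apply, Set.mem_ofPred_eq, ne_eq, zeroExtend_eq_zero, hw',
      not_false_eq_true, true_and]
    refine if_congr Iff.rfl ?_ rfl
    rw [indexMerit, metCoordinates, filter_zeroExtend_ne_zero, prod_rFun_zeroExtend,
      ENNReal.ofReal_prod_of_nonneg fun i _ => rFun_nonneg _ _ _ _]
  · have hw' : w = ∅ := by simpa using hw
    refine ENNReal.tsum_eq_zero.2 fun l => if_neg ?_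
    rw [ne_eq, zeroExtend_eq_zero]
    exact fun h => h.1 hw'

lemma sum_powerset_pow {ι : Type*} [DecidableEq ι] (A : Finset ι) (c : ℝ) :
    ∑ v ∈ A.powerset.erase ∅, c ^ v.card = (1 + c) ^ A.card - 1 := by
  have h := Finset.sum_pow_mul_eq_add_pow c 1 A
  simp only [one_pow, mul_one] at h
  rw [add_comm 1 c, ← h, ← Finset.add_sum_erase _ _ (Finset.empty_mem_powerset A)]
  simp

lemma card_filter_coordinate {d s : ℕ} (j : Fin s) :
    (Finset.univ.filter fun i : Fin (d * s) => coordinate i = j).card = d := by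
  rw [Finset.card_filter, sum_coordinate fun k => if k = j then 1 else 0]
  simp

lemma sum_comp_le_of_injective {A B : Type*} {e : A → B} (he : Function.Injective e)
    {S : Finset A} {T : Finset B} (hmaps : ∀ a ∈ S, e a ∈ T) {f : B → ℝ} (hf : ∀ x, 0 ≤ f x) :
    ∑ a ∈ S, f (e a) ≤ ∑ x ∈ T, f x := by
  refine (Finset.sum_map S ⟨e, he⟩ f).symm.trans_le ?_
  refine Finset.sum_le_sum_of_subset_of_nonneg (fun x hx => ?_) fun x _ _ => hf x
  obtain ⟨a, ha, rfl⟩ := Finset.mem_map.1 hx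
  exact hmaps a ha

/-- The sum over the sets with a given image factorizes over the fibres. -/
lemma sum_pow_card_image_le {ι J : Type*} [Fintype ι] [DecidableEq ι] [Fintype J] [DecidableEq J]
    (κ : ι → J) {d : ℕ} (hκ : ∀ j, (Finset.univ.filter fun i => κ i = j).card = d) {c : ℝ}
    (hc : 0 ≤ c) (u : Finset J) :
    ∑ w ∈ (Finset.univ : Finset (Finset ι)).filter (fun w => w.image κ = u), c ^ w.card ≤
      ((1 + c) ^ d - 1) ^ u.card := by
  let T : J → Finset (Finset ι) := fun j =>
    if j ∈ u then (Finset.univ.filter fun i => κ i = j).powerset.erase ∅ else {∅}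
  let e : Finset ι → J → Finset ι := fun w j => w.filter fun i => κ i = j
  have hcard : ∀ w : Finset ι, w.card = ∑ j, (e w j).card := fun w =>
    Finset.card_eq_sum_card_fiberwise (t := Finset.univ)
      fun i _ => Finset.mem_coe.2 (Finset.mem_univ _)
  have hpow : ∀ w : Finset ι, c ^ w.card = ∏ j, c ^ (e w j).card := fun w => by
    rw [hcard w]
    exact (Finset.prod_pow_eq_pow_sum _ _ _).symm
  have hinj : Function.Injective e := by
    intro w w' h
    ext i
    have := Finset.ext_iff.1 (congrFun h (κ i)) i
    simpa [e] using this
  have hmaps : ∀ w ∈ (Finset.univ : Finset (Finset ι)).filter (fun w => w.image κ = u),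
      e w ∈ Fintype.piFinset T := by
    intro w hw
    have hw' : w.image κ = u := (Finset.mem_filter.1 hw).2
    rw [Fintype.mem_piFinset]
    intro j
    have hiff : j ∈ u ↔ ∃ i ∈ w, κ i = j := by
      rw [← hw', Finset.mem_image]
    by_cases hj : j ∈ u
    · obtain ⟨i, hi, hij⟩ := hiff.1 hj
      simp only [T, if_pos hj]
      refine Finset.mem_erase.2
        ⟨Finset.ne_empty_of_mem (a := i) (Finset.mem_filter.2 ⟨hi, hij⟩), ?_⟩
      exact Finset.mem_powerset.2 (Finset.filter_subset_filter _ (Finset.subset_univ w))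
    · simp only [T, if_neg hj]
      rw [Finset.mem_singleton, Finset.filter_eq_empty_iff]
      exact fun i hi hij => hj (hiff.2 ⟨i, hi, hij⟩)
  have hT : ∀ j, ∑ v ∈ T j, c ^ v.card = if j ∈ u then (1 + c) ^ d - 1 else 1 := by
    intro j
    by_cases hj : j ∈ u
    · simp only [T, if_pos hj]
      rw [sum_powerset_pow, hκ]
    · simp only [T, if_neg hj]
      simp
  calc ∑ w ∈ (Finset.univ : Finset (Finset ι)).filter (fun w => w.image κ = u), c ^ w.card
      = ∑ w ∈ (Finset.univ : Finset (Finset ι)).filter (fun w => w.image κ = u),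
        ∏ j, c ^ (e w j).card :=
        Finset.sum_congr rfl fun w _ => hpow w
    _ ≤ ∑ x ∈ Fintype.piFinset T, ∏ j, c ^ (x j).card :=
        sum_comp_le_of_injective (f := fun x : J → Finset ι => ∏ j, c ^ (x j).card) hinj hmaps
          fun x => Finset.prod_nonneg fun j _ => pow_nonneg hc _
    _ = ∏ j, ∑ v ∈ T j, c ^ v.card := (Finset.prod_univ_sum T fun _ v => c ^ v.card).symm
    _ = ((1 + c) ^ d - 1) ^ u.card := by
        simp_rw [hT]
        rw [Finset.prod_ite_mem, Finset.univ_inter, Finset.prod_const]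

lemma sum_pow_card_le {d s : ℕ} {c : ℝ} (hc : 0 ≤ c) (u : Finset ℕ) (hu : u ⊆ Finset.range s) :
    ∑ w ∈ (Finset.univ : Finset (Finset (Fin (d * s)))).filter (fun w => phi d w = u),
      c ^ w.card ≤ ((1 + c) ^ d - 1) ^ u.card := by
  obtain ⟨u', rfl⟩ := exists_map_valEmbedding hu
  rw [Finset.card_map]
  refine le_of_eq_of_le (Finset.sum_congr (Finset.filter_congr fun w _ => ?_) fun _ _ => rfl)
    (sum_pow_card_image_le coordinate card_filter_coordinate hc u')
  have : phi d w = (w.image coordinate).map Fin.valEmbedding := by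
    rw [phi, Finset.map_eq_image, Finset.image_image]
    rfl
  rw [this, Finset.map_inj]

/-- The sum over all nonzero index vectors, without the condition defining the dual net. -/
lemma tsum_indexMerit_le {α d : ℕ} (hα : 2 ≤ α) (hd : 1 ≤ d) (γ : Finset ℕ → ℝ≥0) (s : ℕ) :
    ∑' l : Fin (d * s) → ℕ, (if l ≠ 0 then indexMerit b α d γ l else 0) ≤
      ∑ u ∈ (Finset.range s).powerset.erase ∅, ENNReal.ofReal (γ u * constDTilde b α d ^ u.card) *
        ENNReal.ofReal (((1 + constCLam b α d 1) ^ d - 1) ^ u.card) := by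
  have hc := constCLam_one_pos (b := b) hα hd
  rw [← sum_tsum_zeroExtend, ← Finset.sum_subset (Finset.erase_subset ∅ Finset.univ)]
  · rw [← Finset.sum_fiberwise_of_maps_to (g := fun w => phi d w)
      (t := (Finset.range s).powerset.erase ∅) fun w hw => phi_mem (Finset.ne_of_mem_erase hw)]
    refine Finset.sum_le_sum fun u hu => ?_
    have hu' := Finset.mem_powerset.1 (Finset.mem_of_mem_erase hu)
    calc _ ≤ ∑ w ∈ ((Finset.univ : Finset (Finset (Fin (d * s)))).erase ∅).filter
            (fun w => phi d w = u), ENNReal.ofReal (γ u * constDTilde b α d ^ u.card) *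
              ENNReal.ofReal (constCLam b α d 1 ^ w.card) := by
          refine Finset.sum_le_sum fun w hw => ?_
          obtain ⟨hw1, hw2⟩ := Finset.mem_filter.1 hw
          have hw' := Finset.ne_of_mem_erase hw1
          have h1 : ∀ l : w → ℕ+, (if zeroExtend w l ≠ 0 then indexMerit b α d γ (zeroExtend w l)
              else 0) = ENNReal.ofReal (γ u * constDTilde b α d ^ u.card) *
                ∏ i, ENNReal.ofReal (rFun b α d (l i)) := by
            intro l
            rw [if_pos (by rw [ne_eq, zeroExtend_eq_zero]; exact hw'), indexMerit, metCoordinates,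
              filter_zeroExtend_ne_zero, prod_rFun_zeroExtend, hw2]
          simp_rw [h1]
          rw [ENNReal.tsum_mul_left, tsum_pi_prod fun l : ℕ+ => ENNReal.ofReal (rFun b α d l),
            Fintype.card_coe, ENNReal.ofReal_pow hc.le]
          exact mul_le_mul_right (pow_le_pow_left' (tsum_rFun_le hα hd) _) _
      _ ≤ _ := by
          rw [← Finset.mul_sum, ← ENNReal.ofReal_sum_of_nonneg fun w _ => pow_nonneg hc.le _]
          refine mul_le_mul_right (ENNReal.ofReal_le_ofReal ?_) _
          refine le_trans ?_ (sum_pow_card_le hc.le u hu')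
          exact Finset.sum_le_sum_of_subset_of_nonneg
            (Finset.filter_subset_filter _ (Finset.erase_subset _ _))
            fun w _ _ => pow_nonneg hc.le _
  · intro w _ hw
    have hw' : w = ∅ := by simpa using hw
    exact ENNReal.tsum_eq_zero.2 fun l => if_neg (by rw [ne_eq, not_not, zeroExtend_eq_zero, hw'])

end Criterion

/-! ### The component-by-component construction -/

section Construction

variable {b : ℕ} [Fact b.Prime]

lemma dvd_of_truncPoly_eq_zero {m l : ℕ} (h : truncPoly b m l = 0) : b ^ m ∣ l := by
  have hdig : ∀ a < m, l / b ^ a % b = 0 := by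
    intro a ha
    have h1 := coeff_truncPoly (b := b) m l a
    rw [h, coeff_zero, if_pos ha, eq_comm, ZMod.natCast_eq_zero_iff] at h1
    exact Nat.eq_zero_of_dvd_of_lt h1 (Nat.mod_lt _ (Fact.out : b.Prime).pos)
  clear h
  induction m with
  | zero => simp
  | succ m ih =>
    obtain ⟨k, rfl⟩ := ih fun a ha => hdig a (by lia)
    have h1 := hdig m (by lia)
    rw [Nat.mul_div_cancel_left _ (pow_pos (Fact.out : b.Prime).pos m)] at h1
    rw [pow_succ]
    exact mul_dvd_mul_left _ (Nat.dvd_of_mod_eq_zero h1)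

lemma degree_truncPoly_lt (m l : ℕ) : (truncPoly b m l).degree < m := by
  rw [degree_lt_iff_coeff_zero]
  intro a ha
  rw [coeff_truncPoly, if_neg (by exact not_lt.2 ha)]

lemma exists_finset_genSet (b m : ℕ) [Fact b.Prime] :
    ∃ F : Finset (ZMod b)[X], (∀ f, f ∈ F ↔ f ∈ genSet b m) ∧ F.card = b ^ m - 1 := by
  classical
  have hfin : Fintype (degreeLT (ZMod b) m) :=
    Fintype.ofEquiv _ (degreeLTEquiv (ZMod b) m).toEquiv.symm
  have hcard : Fintype.card (degreeLT (ZMod b) m) = b ^ m := by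
    rw [Fintype.card_congr (degreeLTEquiv (ZMod b) m).toEquiv]
    simp [ZMod.card]
  refine ⟨((Finset.univ : Finset (degreeLT (ZMod b) m)).map
    (Function.Embedding.subtype _)).erase 0, fun f => ?_, ?_⟩
  · simp [genSet, mem_degreeLT, and_comm]
  · rw [Finset.card_erase_of_mem, Finset.card_map, Finset.card_univ, hcard]
    simp

/-- At most one component of degree less than `m` solves a congruence whose coefficient is not
divisible by the irreducible modulus. -/
lemma card_filter_dvd_le {m : ℕ} {p : (ZMod b)[X]} (hp : Irreducible p) (hpm : p.natDegree = m)
    {F : Finset (ZMod b)[X]} (hF : ∀ f ∈ F, f ∈ genSet b m) (S : (ZMod b)[X]) {k : ℕ}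
    (hk : truncPoly b m k ≠ 0) [DecidablePred fun f => p ∣ S + truncPoly b m k * f] :
    (F.filter fun f => p ∣ S + truncPoly b m k * f).card ≤ 1 := by
  have hpdeg : p.degree = m := by rw [degree_eq_natDegree hp.ne_zero, hpm]
  refine Finset.card_le_one.2 fun f hf g hg => ?_
  obtain ⟨hf1, hf2⟩ := Finset.mem_filter.1 hf
  obtain ⟨hg1, hg2⟩ := Finset.mem_filter.1 hg
  have h1 : p ∣ truncPoly b m k * (f - g) := by
    have := dvd_sub hf2 hg2
    rwa [add_sub_add_left_eq_sub, ← mul_sub] at this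
  rcases hp.prime.dvd_or_dvd h1 with h2 | h2
  · exact absurd (eq_zero_of_dvd_of_degree_lt h2 (hpdeg ▸ degree_truncPoly_lt m k)) hk
  · refine sub_eq_zero.1 (eq_zero_of_dvd_of_degree_lt h2 (hpdeg ▸ ?_))
    exact (degree_sub_le f g).trans_lt (max_lt (hF f hf1).1 (hF g hg1).1)

/-- Either at most one candidate solves the congruence, or the last entry is a multiple of `b ^ m`
and all of them may. -/
lemma sum_ite_dvd_le {m : ℕ} {p : (ZMod b)[X]} (hp : Irreducible p) (hpm : p.natDegree = m)
    {F : Finset (ZMod b)[X]} (hF : ∀ f ∈ F, f ∈ genSet b m) (S : (ZMod b)[X]) (k : ℕ) (x : ℝ≥0∞)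
    [DecidablePred fun f => p ∣ S + truncPoly b m k * f] :
    ∑ f ∈ F, (if p ∣ S + truncPoly b m k * f then x else 0) ≤
      x + F.card * if b ^ m ∣ k then x else 0 := by
  rw [← Finset.sum_filter, Finset.sum_const, nsmul_eq_mul]
  by_cases hk : truncPoly b m k = 0
  · rw [if_pos (dvd_of_truncPoly_eq_zero hk)]
    refine le_add_left (mul_le_mul_left ?_ x)
    exact_mod_cast Finset.card_filter_le _ _
  · refine le_add_right ?_
    have h1 : ((F.filter fun f => p ∣ S + truncPoly b m k * f).card : ℝ≥0∞) ≤ 1 := by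
      exact_mod_cast card_filter_dvd_le hp hpm hF S hk
    exact (mul_le_mul_left h1 x).trans_eq (one_mul x)

lemma metCoordinates_congr (d : ℕ) {t : ℕ} {l l' : Fin t → ℕ} (h : ∀ i, l i = 0 ↔ l' i = 0) :
    metCoordinates d l = metCoordinates d l' := by
  rw [metCoordinates, metCoordinates]
  congr 1
  exact Finset.filter_congr fun i _ => not_congr (h i)

/-- The index vector with the last entry `k` appended to `l`. -/
def appendIndex {t : ℕ} (l : Fin t → ℕ) (k : ℕ) : Fin (t + 1) → ℕ := Fin.snoc l k

@[simp] lemma appendIndex_castSucc {t : ℕ} (l : Fin t → ℕ) (k : ℕ) (i : Fin t) :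
    appendIndex l k i.castSucc = l i := by
  simp [appendIndex]

@[simp] lemma appendIndex_last {t : ℕ} (l : Fin t → ℕ) (k : ℕ) :
    appendIndex l k (Fin.last t) = k := by
  simp [appendIndex]

lemma appendIndex_eq_zero {t : ℕ} {l : Fin t → ℕ} {k : ℕ} :
    appendIndex l k = 0 ↔ l = 0 ∧ k = 0 := by
  simp [funext_iff, Fin.forall_fin_succ']

lemma indexMerit_appendIndex_zero (b α d : ℕ) (γ : Finset ℕ → ℝ≥0) {t : ℕ} (l : Fin t → ℕ) :
    indexMerit b α d γ (appendIndex l 0) = indexMerit b α d γ l := by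
  have h1 : metCoordinates d (appendIndex l 0) = metCoordinates d l := by
    ext k
    simp [metCoordinates, phi, Fin.exists_fin_succ']
  rw [indexMerit, indexMerit, h1, Fin.prod_univ_castSucc]
  simp [rFun]

/-- Multiplying an entry by `b ^ m` adds `m` digits to it. -/
lemma indexMerit_appendIndex_pow_mul (α d : ℕ) (γ : Finset ℕ → ℝ≥0) {t : ℕ} (l : Fin t → ℕ)
    (m : ℕ) {k : ℕ} (hk : k ≠ 0) : indexMerit b α d γ (appendIndex l (b ^ m * k)) =
      ENNReal.ofReal ((b : ℝ) ^ (2 * min α d * m))⁻¹ * indexMerit b α d γ (appendIndex l k) := by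
  have hb0 : b ^ m ≠ 0 := pow_ne_zero _ (Fact.out : b.Prime).ne_zero
  have h1 : metCoordinates d (appendIndex l (b ^ m * k)) = metCoordinates d (appendIndex l k) := by
    refine metCoordinates_congr d fun i => ?_
    refine Fin.lastCases ?_ (fun i => ?_) i
    · simp [hk, (Fact.out : b.Prime).ne_zero]
    · simp
  rw [indexMerit, indexMerit, h1, Fin.prod_univ_castSucc, Fin.prod_univ_castSucc]
  simp only [appendIndex_castSucc, appendIndex_last]
  rw [rFun_pow_mul α d m hk,
    ENNReal.ofReal_mul (p := ((b : ℝ) ^ (2 * min α d * m))⁻¹) (by positivity)]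
  ring

lemma tsum_fin_succ {t : ℕ} (H : (Fin (t + 1) → ℕ) → ℝ≥0∞) :
    ∑' l, H l = ∑' l : Fin t → ℕ, H (appendIndex l 0) +
      ∑' k : ℕ, if k = 0 then 0 else ∑' l : Fin t → ℕ, H (appendIndex l k) := by
  rw [← (Fin.snocEquiv fun _ : Fin (t + 1) => ℕ).tsum_eq, ENNReal.tsum_prod',
    ENNReal.summable.tsum_eq_add_tsum_ite' 0]
  rfl

/-- The sum of the terms of all nonzero index vectors. -/
def totalMerit (b α d : ℕ) (γ : Finset ℕ → ℝ≥0) (t : ℕ) : ℝ≥0∞ :=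
  ∑' l : Fin t → ℕ, if l ≠ 0 then indexMerit b α d γ l else 0

/-- The sum of the terms of the index vectors whose last entry satisfies a condition and does not
vanish. -/
def lastMerit (b α d : ℕ) (γ : Finset ℕ → ℝ≥0) (t : ℕ) (P : (Fin t → ℕ) → ℕ → Prop) : ℝ≥0∞ :=
  open scoped Classical in ∑' k : ℕ, if k = 0 then 0 else
    ∑' l : Fin t → ℕ, if P l k then indexMerit b α d γ (appendIndex l k) else 0

lemma totalMerit_succ (b α d : ℕ) (γ : Finset ℕ → ℝ≥0) (t : ℕ) : totalMerit b α d γ (t + 1) =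
    totalMerit b α d γ t + lastMerit b α d γ t fun _ _ => True := by
  rw [totalMerit, tsum_fin_succ]
  congr 1
  · refine tsum_congr fun l => ?_
    simp [appendIndex_eq_zero, indexMerit_appendIndex_zero]
  · refine tsum_congr fun k => ?_
    by_cases hk : k = 0
    · simp [hk]
    · simp [hk, appendIndex_eq_zero]

open Classical in
lemma criterion_succ (m α d : ℕ) (γ : Finset ℕ → ℝ≥0) (t : ℕ) (p : (ZMod b)[X])
    (q : ℕ → (ZMod b)[X]) : criterion b m α d γ (t + 1) p q = criterion b m α d γ t p q +
      lastMerit b α d γ t fun l k =>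
        p ∣ ∑ i, truncPoly b m (l i) * q i + truncPoly b m k * q t := by
  have hdual : ∀ (l : Fin t → ℕ) k, appendIndex l k ∈ dualNet b m (t + 1) p q ↔
      p ∣ ∑ i, truncPoly b m (l i) * q i + truncPoly b m k * q t := by
    intro l k
    change p ∣ _ ↔ _
    rw [Fin.sum_univ_castSucc]
    simp
  have htr : truncPoly b m 0 = 0 := by simp [truncPoly, Nat.ofDigits]
  rw [criterion_eq_tsum, tsum_fin_succ, criterion_eq_tsum]
  congr 1
  · refine tsum_congr fun l => ?_
    rw [indexMerit_appendIndex_zero]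
    refine if_congr (and_congr (not_congr (by simp [appendIndex_eq_zero])) ?_) rfl rfl
    rw [hdual, htr, zero_mul, add_zero]
    rfl
  · refine tsum_congr fun k => ?_
    by_cases hk : k = 0
    · simp [hk]
    · rw [if_neg hk, if_neg hk]
      refine tsum_congr fun l => if_congr ?_ rfl rfl
      rw [hdual, ne_eq, appendIndex_eq_zero]
      simp [hk]

lemma lastMerit_dvd (α d : ℕ) (γ : Finset ℕ → ℝ≥0) (t m : ℕ) :
    lastMerit b α d γ t (fun _ k => b ^ m ∣ k) =
      ENNReal.ofReal ((b : ℝ) ^ (2 * min α d * m))⁻¹ * lastMerit b α d γ t fun _ _ => True := by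
  have hb0 : b ^ m ≠ 0 := pow_ne_zero _ (Fact.out : b.Prime).ne_zero
  have hinj : Function.Injective fun k : ℕ => b ^ m * k := fun k k' h =>
    Nat.eq_of_mul_eq_mul_left (Nat.pos_of_ne_zero hb0) h
  rw [lastMerit, ← hinj.tsum_eq, lastMerit, ← ENNReal.tsum_mul_left]
  · refine tsum_congr fun k => ?_
    by_cases hk : k = 0
    · simp [hk]
    · have h0 : ¬b ^ m * k = 0 := mul_ne_zero hb0 hk
      simp only [hk, h0, if_false, dvd_mul_right, if_true]
      rw [← ENNReal.tsum_mul_left]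
      exact tsum_congr fun l => indexMerit_appendIndex_pow_mul α d γ l m hk
  · intro k hk
    by_contra h
    refine hk ?_
    have hnd : ¬b ^ m ∣ k := fun ⟨j, hj⟩ => h ⟨j, hj.symm⟩
    simp [hnd]

lemma lastMerit_mono (b α d : ℕ) (γ : Finset ℕ → ℝ≥0) (t : ℕ) {P P' : (Fin t → ℕ) → ℕ → Prop}
    (h : ∀ l k, P l k → P' l k) : lastMerit b α d γ t P ≤ lastMerit b α d γ t P' := by
  refine ENNReal.tsum_le_tsum fun k => ?_
  split_ifs
  · exact le_rfl
  · refine ENNReal.tsum_le_tsum fun l => ?_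
    split_ifs with h1 h2
    · exact le_rfl
    · exact absurd (h l k h1) h2
    · exact zero_le
    · exact le_rfl

open Classical in
/-- The mean over the last component. -/
lemma sum_lastMerit_le {m : ℕ} {p : (ZMod b)[X]} (hp : Irreducible p) (hpm : p.natDegree = m)
    {F : Finset (ZMod b)[X]} (hF : ∀ f ∈ F, f ∈ genSet b m) (α d : ℕ) (γ : Finset ℕ → ℝ≥0)
    (t : ℕ) (S : (Fin t → ℕ) → (ZMod b)[X]) :
    ∑ f ∈ F, lastMerit b α d γ t (fun l k => p ∣ S l + truncPoly b m k * f) ≤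
      lastMerit b α d γ t (fun _ _ => True) +
        F.card * lastMerit b α d γ t fun _ k => b ^ m ∣ k := by
  simp only [lastMerit]
  rw [← Summable.tsum_finsetSum fun _ _ => ENNReal.summable, ← ENNReal.tsum_mul_left,
    ← ENNReal.tsum_add]
  refine ENNReal.tsum_le_tsum fun k => ?_
  by_cases hk : k = 0
  · simp [hk]
  · simp only [hk, if_false, if_true]
    rw [← Summable.tsum_finsetSum fun _ _ => ENNReal.summable, ← ENNReal.tsum_mul_left,
      ← ENNReal.tsum_add]
    exact ENNReal.tsum_le_tsum fun l => by
      convert sum_ite_dvd_le hp hpm hF (S l) k _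

/-- The multiples of `b ^ m` are so rare that they contribute no more than a generic component. -/
lemma sub_one_mul_lastMerit_dvd_le {α d : ℕ} (hα : 2 ≤ α) (hd : 1 ≤ d) (γ : Finset ℕ → ℝ≥0)
    (t m : ℕ) : ((b ^ m - 1 : ℕ) : ℝ≥0∞) * lastMerit b α d γ t (fun _ k => b ^ m ∣ k) ≤
      lastMerit b α d γ t fun _ _ => True := by
  have hb : (1 : ℝ) ≤ b := by exact_mod_cast (Fact.out : b.Prime).one_lt.le
  rw [lastMerit_dvd, ← mul_assoc]
  refine (mul_le_mul_left ?_ _).trans_eq (one_mul _)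
  rw [← ENNReal.ofReal_natCast, ← ENNReal.ofReal_mul (by positivity), ENNReal.ofReal_le_one,
    ← div_eq_mul_inv, div_le_one (by positivity)]
  calc ((b ^ m - 1 : ℕ) : ℝ) ≤ ((b ^ m : ℕ) : ℝ) := by exact_mod_cast Nat.sub_le _ _
    _ = (b : ℝ) ^ m := by push_cast; rfl
    _ ≤ _ := pow_le_pow_right₀ hb (Nat.le_mul_of_pos_left m (by lia))

/-- The construction yields a criterion that is at most a multiple of the mean over all
components. -/
lemma sub_one_mul_criterion_le {m s α d : ℕ} (hα : 2 ≤ α) (hd : 1 ≤ d) (γ : Finset ℕ → ℝ≥0)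
    {p : (ZMod b)[X]} {q : ℕ → (ZMod b)[X]} (h : IsCBC b m s α d γ p q) {t : ℕ}
    (ht : t ≤ d * s) : ((b ^ m - 1 : ℕ) : ℝ≥0∞) * criterion b m α d γ t p q ≤
      2 * totalMerit b α d γ t := by
  induction t with
  | zero =>
    have : criterion b m α d γ 0 p q = 0 := by
      rw [criterion_eq_tsum]
      exact ENNReal.tsum_eq_zero.2 fun l => if_neg fun h => h.1 (Subsingleton.elim _ _)
    rw [this, mul_zero]
    exact zero_le
  | succ t ih =>
    have ih' := ih (by lia)
    rw [totalMerit_succ, mul_add, two_mul (lastMerit _ _ _ _ _ _)]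
    rcases Nat.eq_zero_or_pos t with rfl | htpos
    · -- for a single component `1`, the dual net consists of the multiples of `b ^ m`
      rw [criterion_succ, mul_add]
      refine add_le_add ih' (le_add_right (le_trans (mul_le_mul_right ?_ _)
        (sub_one_mul_lastMerit_dvd_le hα hd γ 0 m)))
      refine lastMerit_mono _ _ _ _ _ fun l k hk => dvd_of_truncPoly_eq_zero ?_
      rw [Finset.univ_eq_empty, Finset.sum_empty, zero_add, h.first, mul_one] at hk
      refine eq_zero_of_dvd_of_degree_lt hk ?_
      rw [degree_eq_natDegree h.irreducible.ne_zero, h.natDegree_eq]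
      exact degree_truncPoly_lt m k
    · -- the chosen component is at least as good as the mean over all candidates
      obtain ⟨F, hF, hcard⟩ := exists_finset_genSet b m
      have h1 : ∀ f ∈ F, criterion b m α d γ (t + 1) p q ≤ criterion b m α d γ t p q +
          lastMerit b α d γ t fun l k =>
            p ∣ ∑ i, truncPoly b m (l i) * q i + truncPoly b m k * f := by
        intro f hf
        refine (h.minimal t htpos (by lia) f ((hF f).1 hf)).trans_eq ?_
        have hq : ∀ i : Fin t, Function.update q t f i = q i := fun i =>
          Function.update_of_ne i.isLt.ne _ _
        have hdual : dualNet b m t p (Function.update q t f) = dualNet b m t p q := by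
          simp only [dualNet, hq]
        rw [criterion_succ]
        simp only [Function.update_self, hq]
        congr 1
        rw [criterion, criterion, hdual]
      have h2 := Finset.sum_le_sum h1
      rw [Finset.sum_const, nsmul_eq_mul, hcard, Finset.sum_add_distrib, Finset.sum_const,
        nsmul_eq_mul, hcard] at h2
      refine h2.trans (add_le_add ih' ?_)
      refine (sum_lastMerit_le h.irreducible h.natDegree_eq (fun f hf => (hF f).1 hf) α d γ t
        _).trans (add_le_add le_rfl ?_)
      rw [hcard]
      exact sub_one_mul_lastMerit_dvd_le hα hd γ t m

end Construction

/-! ### The initial error -/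

section Initial

lemma setIntegral_fderiv_eq_zero {s : ℕ} {φ : (Fin s → ℝ) → ℝ} (hφ : ContDiff ℝ (⊤ : ℕ∞) φ)
    (hc : HasCompactSupport φ) (hsupp : tsupport φ ⊆ Set.univ.pi fun _ => Set.Ioo (0 : ℝ) 1)
    (v : Fin s → ℝ) : ∫ x, fderiv ℝ φ x v ∂(cubeMeasure s) = 0 := by
  have h0 : ∀ x, x ∉ cube s → fderiv ℝ φ x v = 0 := by
    intro x hx
    have hx' : x ∉ tsupport φ := fun h => hx (mem_cube.2 fun i =>
      Set.Ioo_subset_Ico_self (hsupp h i (Set.mem_univ i)))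
    rw [image_eq_zero_of_notMem_tsupport fun h => hx' (tsupport_fderiv_subset ℝ h),
      zero_apply]
  rw [cubeMeasure, setIntegral_eq_integral_of_forall_compl_eq_zero h0]
  have hcont : Continuous fun x => fderiv ℝ φ x v :=
    (hφ.continuous_fderiv (by simp)).clm_apply continuous_const
  have hint : Integrable (fun x => fderiv ℝ φ x v) volume :=
    hcont.integrable_of_hasCompactSupport (hc.fderiv_apply ℝ v)
  have h := integral_mul_fderiv_eq_neg_fderiv_mul_of_integrable
    (μ := (volume : Measure (Fin s → ℝ)))
    (f := fun _ => (1 : ℝ)) (g := φ) (v := v) (by simp) (by simpa using hint)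
    (by simpa using hφ.continuous.integrable_of_hasCompactSupport hc)
    (fun _ _ => differentiableAt_const _) (fun x _ => hφ.differentiable (by simp) x)
  simpa using h

/-- The constant functions as elements of the Sobolev space. -/
def constFunction (s α : ℕ) (c : ℝ) : SobolevFunction s α where
  deriv r _ := if r = 0 then c else 0
  continuousOn := continuousOn_const
  memLp _ _ := memLp_const _
  weak r _ j _ φ hφ hc hsupp := by
    have hne : Function.update r j (r j + 1) ≠ 0 := fun h => by
      have := congrFun h j
      simp at this
    rw [if_neg hne, integral_const_mul, setIntegral_fderiv_eq_zero hφ hc hsupp]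
    simp

/-- Only `u = ∅` contributes to the norm of a constant function. -/
lemma normSq_constFunction_le {s α : ℕ} (hα : 2 ≤ α) (γ : Finset ℕ → ℝ≥0) :
    (constFunction s α (Real.sqrt (γ ∅))).normSq γ ≤ 1 := by
  have hzero : ∀ v : Finset (Fin s), ∀ r : Fin s → ℕ, r ≠ 0 →
      sectionNormSq v ((constFunction s α (Real.sqrt (γ ∅))).deriv r) = 0 := by
    intro v r hr
    simp [sectionNormSq, constFunction, hr]
  rw [SobolevFunction.normSq, Finset.sum_eq_single ∅]
  · have h1 : multiIndices α (∅ : Finset (Fin s)) ∅ = {0} := by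
      ext r
      simp [multiIndices, funext_iff]
    rw [Finset.powerset_empty, Finset.sum_singleton, h1, Finset.sum_singleton, Finset.map_empty]
    have h2 : sectionNormSq ∅ ((constFunction s α (Real.sqrt (γ ∅))).deriv 0) = γ ∅ := by
      simp [sectionNormSq, constFunction]
    rw [h2]
    exact ENNReal.div_self_le_one
  · intro u _ hu
    obtain ⟨j, hj⟩ := Finset.nonempty_iff_ne_empty.2 hu
    rw [Finset.sum_eq_zero fun v hv => Finset.sum_eq_zero fun r hr => hzero v r ?_,
      ENNReal.zero_div]
    rintro rfl
    have := Fintype.mem_piFinset.1 hr j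
    split_ifs at this
    · rw [Finset.mem_singleton, Pi.zero_apply] at this
      lia
    · rw [Finset.mem_Icc, Pi.zero_apply] at this
      lia
  · simp

lemma le_initialError {α : ℕ} (hα : 2 ≤ α) (γ : Finset ℕ → ℝ≥0) (s : ℕ) :
    ENNReal.ofReal (Real.sqrt (γ ∅)) ≤ initialError α γ s := by
  refine le_trans ?_ (le_iSup₂ (f := fun (f : SobolevFunction s α) (_ : f.normSq γ ≤ 1) =>
    ENNReal.ofReal |∫ y, f y ∂(cubeMeasure s)|) (constFunction s α (Real.sqrt (γ ∅)))
    (normSq_constFunction_le hα γ))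
  simp [constFunction, abs_of_nonneg (Real.sqrt_nonneg _)]

end Initial

/-! ### The constants -/

section Constants

variable {b : ℕ} [Fact b.Prime]

lemma sin_pi_div_pos (b : ℕ) [Fact b.Prime] : 0 < Real.sin (Real.pi / b) := by
  have hb : (1 : ℝ) < b := by exact_mod_cast (Fact.out : b.Prime).one_lt
  refine Real.sin_pos_of_pos_of_lt_pi (by positivity) ?_
  rw [div_lt_iff₀ (by linarith)]
  nlinarith [Real.pi_pos]

/-- Equality holds for `b = 3`. For `b = 4` the inequality would still be true, but it does not
follow from `sin x ≤ x`. -/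
lemma four_mul_sin_sq_le (b : ℕ) [Fact b.Prime] : 4 * b * Real.sin (Real.pi / b) ^ 2 ≤ 9 := by
  have hprime : b.Prime := Fact.out
  have hb2 := hprime.two_le
  rcases (by lia : b = 2 ∨ b = 3 ∨ b = 4 ∨ 5 ≤ b) with h | h | h | h
  · subst h
    rw [Nat.cast_ofNat, Real.sin_pi_div_two]
    norm_num
  · subst h
    rw [Nat.cast_ofNat, Real.sin_pi_div_three, div_pow, Real.sq_sqrt (by norm_num)]
    norm_num
  · subst h
    norm_num at hprime
  · have hb : (5 : ℝ) ≤ b := by exact_mod_cast h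
    have h1 : Real.sin (Real.pi / b) ^ 2 ≤ (Real.pi / b) ^ 2 :=
      pow_le_pow_left₀ (sin_pi_div_pos b).le (Real.sin_le (by positivity)) 2
    calc 4 * b * Real.sin (Real.pi / b) ^ 2 ≤ 4 * b * (Real.pi / b) ^ 2 := by gcongr
      _ = 4 * Real.pi ^ 2 / b := by field_simp
      _ ≤ 9 := by
        rw [div_le_iff₀ (by linarith)]
        nlinarith [Real.pi_lt_d2, Real.pi_pos]

lemma constC_pos (b : ℕ) [Fact b.Prime] (τ : ℕ) : 0 < constC b τ := by
  have := sin_pi_div_pos b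
  rw [constC]
  split_ifs <;> positivity

/-- The comparison of the constants that makes the trivial bound for the error strictly better
than what the weights allow for. -/
lemma div_nine_lt_constD {α : ℕ} (hα : 2 ≤ α) : (b : ℝ) / 9 < constD b α := by
  have hb : (0 : ℝ) < b := by exact_mod_cast (Fact.out : b.Prime).pos
  have hsin := sin_pi_div_pos b
  have h1 : (b : ℝ) / 9 ≤ constC b 1 ^ 2 := by
    rw [constC, if_pos rfl, inv_pow, mul_pow, div_le_iff₀ (by norm_num), inv_mul_eq_div,
      le_div_iff₀ (by positivity)]
    linarith [four_mul_sin_sq_le b]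
  -- for `b = 3` equality holds in `h1`, so the term with `τ = 2` is needed for strictness
  have h2 : constC b 1 ^ 2 + constC b 2 ^ 2 * ((b : ℝ) ^ (2 * (2 - 1)))⁻¹ ≤ constC' b α 1 := by
    rw [constC']
    have hsub : ({1, 2} : Finset ℕ) ⊆ Finset.Icc 1 α := by
      intro x hx
      simp only [Finset.mem_insert, Finset.mem_singleton] at hx
      rw [Finset.mem_Icc]
      lia
    refine le_trans (le_of_eq ?_) (Finset.sum_le_sum_of_subset_of_nonneg hsub
      fun τ _ _ => by positivity)
    rw [Finset.sum_pair (by norm_num)]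
    simp
  have h3 : 0 < constC b 2 ^ 2 * ((b : ℝ) ^ (2 * (2 - 1)))⁻¹ := by
    have := constC_pos b 2
    positivity
  have h4 : 0 ≤ constCTilde b α * ((b : ℝ) ^ (2 * (α - 1)))⁻¹ := by
    rw [constCTilde]
    positivity
  have h5 := le_ciSup (f := fun ν : Finset.Icc 1 α =>
    constC' b α ν + constCTilde b α * ((b : ℝ) ^ (2 * (α - (ν : ℕ))))⁻¹)
    (Set.finite_range _).bddAbove ⟨1, Finset.mem_Icc.2 ⟨le_rfl, by lia⟩⟩
  rw [constD]
  refine lt_of_lt_of_le ?_ h5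
  simp only
  linarith

lemma constDTilde_pos {α d : ℕ} (hα : 2 ≤ α) : 0 < constDTilde b α d := by
  have hb : (0 : ℝ) < b := by exact_mod_cast (Fact.out : b.Prime).pos
  have := div_nine_lt_constD (b := b) hα
  have h1 : 0 < constD b α := by
    have : 0 < (b : ℝ) / 9 := by positivity
    linarith
  rw [constDTilde]
  positivity

lemma constG_one (b α d : ℕ) :
    constG b α d 1 d = constDTilde b α d * ((1 + constCLam b α d 1) ^ d - 1) := by
  rw [constG, Real.rpow_one]
  ring

/-- For `d = 1` this is an equality. -/
lemma inv_le_pow_mul_constCLam {α d : ℕ} (hα : 2 ≤ α) (hd : 1 ≤ d) :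
    (b : ℝ)⁻¹ ≤ (b : ℝ) ^ ((2 * d - 1) * α) * constCLam b α d 1 := by
  have hb : (1 : ℝ) < b := by exact_mod_cast (Fact.out : b.Prime).one_lt
  have hb2 : (2 : ℝ) ≤ b := by exact_mod_cast (Fact.out : b.Prime).two_le
  have hlt := lt_pow_two_mul_min (b := b) hα hd
  rw [constCLam_one]
  rcases (by lia : d = 1 ∨ 2 ≤ d) with rfl | hd2
  · have h1 : min α 1 = 1 := by lia
    rw [h1, show (2 * 1 - 1) * α = α by lia]
    have h2 : (b : ℝ) ^ (2 * 1) - b ≠ 0 := by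
      rw [h1] at hlt
      linarith
    refine le_of_eq ?_
    field_simp
    ring
  · obtain ⟨e, rfl⟩ : ∃ e, d = e + 2 := ⟨d - 2, by lia⟩
    have h1 : (b : ℝ) ^ (2 * min α (e + 2)) ≤ (b : ℝ) ^ ((2 * e + 2) * α) :=
      pow_le_pow_right₀ hb.le (by
        have h3 : min α (e + 2) ≤ α := min_le_left _ _
        nlinarith [Nat.zero_le (e * α)])
    have h2 : (b : ℝ)⁻¹ ≤ b - 1 := (inv_le_one_of_one_le₀ hb.le).trans (by linarith)
    rw [show (2 * (e + 2) - 1) * α = α + (2 * e + 2) * α by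
      rw [show 2 * (e + 2) - 1 = 1 + (2 * e + 2) by lia]; ring, pow_add]
    have h4 : (0 : ℝ) < (b : ℝ) ^ (2 * min α (e + 2)) - b := by linarith
    have h5 : (b : ℝ) ^ α ≠ 0 := by positivity
    calc (b : ℝ)⁻¹ ≤ b - 1 := h2
      _ ≤ (b : ℝ) ^ ((2 * e + 2) * α) * ((b - 1) / ((b : ℝ) ^ (2 * min α (e + 2)) - b)) := by
        rw [← mul_div_assoc, le_div_iff₀ h4, mul_comm]
        exact mul_le_mul_of_nonneg_right (by linarith) (by linarith)
      _ = _ := by field_simp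

lemma one_div_nine_lt_constG {α d : ℕ} (hα : 2 ≤ α) (hd : 1 ≤ d) :
    1 / 9 < constG b α d 1 d := by
  have hb : (0 : ℝ) < b := by exact_mod_cast (Fact.out : b.Prime).pos
  have hD := div_nine_lt_constD (b := b) hα
  have hD0 : 0 < constD b α := lt_trans (by positivity) hD
  have hc := constCLam_one_pos (b := b) hα hd
  have h1 : constCLam b α d 1 ≤ (1 + constCLam b α d 1) ^ d - 1 := by
    have h2 : (1 + constCLam b α d 1) ^ 1 ≤ (1 + constCLam b α d 1) ^ d :=
      pow_le_pow_right₀ (by linarith) hd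
    linarith
  calc (1 : ℝ) / 9 = (b : ℝ) / 9 * (b : ℝ)⁻¹ := by field_simp
    _ < constD b α * (b : ℝ)⁻¹ := by gcongr
    _ ≤ constD b α * ((b : ℝ) ^ ((2 * d - 1) * α) * constCLam b α d 1) := by
      gcongr
      exact inv_le_pow_mul_constCLam hα hd
    _ = constDTilde b α d * constCLam b α d 1 := by rw [constDTilde]; ring
    _ ≤ constDTilde b α d * ((1 + constCLam b α d 1) ^ d - 1) := by
      have := constDTilde_pos (b := b) (d := d) hα
      gcongr
    _ = _ := (constG_one b α d).symm

/-- The function `x ↦ x ^ λ` is subadditive, and the expansion of `(1 + c) ^ d - 1` has positive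
coefficients. -/
lemma rpow_pow_sub_one_le {c lam : ℝ} (hc : 0 ≤ c) (h0 : 0 < lam) (h1 : lam ≤ 1) (d : ℕ) :
    ((1 + c) ^ d - 1) ^ lam ≤ (1 + c ^ lam) ^ d - 1 := by
  induction d with
  | zero => simp [Real.zero_rpow h0.ne']
  | succ d ih =>
    have hx : 0 ≤ (1 + c) ^ d - 1 := by
      have := one_le_pow₀ (by linarith : 1 ≤ 1 + c) (n := d)
      linarith
    have hcl : 0 ≤ c ^ lam := Real.rpow_nonneg hc _
    calc ((1 + c) ^ (d + 1) - 1) ^ lam = (((1 + c) ^ d - 1) + ((1 + c) ^ d - 1) * c + c) ^ lam := by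
          congr 1
          ring
      _ ≤ ((1 + c) ^ d - 1) ^ lam + (((1 + c) ^ d - 1) * c) ^ lam + c ^ lam :=
          (Real.rpow_add_le_add_rpow (by positivity) hc h0.le h1).trans (add_le_add_left
            (Real.rpow_add_le_add_rpow hx (by positivity) h0.le h1) _)
      _ = ((1 + c) ^ d - 1) ^ lam + ((1 + c) ^ d - 1) ^ lam * c ^ lam + c ^ lam := by
          rw [Real.mul_rpow hx hc]
      _ ≤ ((1 + c ^ lam) ^ d - 1) + ((1 + c ^ lam) ^ d - 1) * c ^ lam + c ^ lam := by gcongr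
      _ = _ := by ring

lemma rpow_constG_le {α d : ℕ} (hα : 2 ≤ α) (hd : 1 ≤ d) {lam : ℝ} (h0 : 0 < lam)
    (h1 : lam ≤ 1) : constG b α d 1 d ^ lam ≤ constG b α d lam d := by
  have hb : (0 : ℝ) < b := by exact_mod_cast (Fact.out : b.Prime).pos
  have hb1 : (1 : ℝ) < b := by exact_mod_cast (Fact.out : b.Prime).one_lt
  have hD := constDTilde_pos (b := b) (d := d) hα
  have hc := constCLam_one_pos (b := b) hα hd
  have hlt := lt_pow_two_mul_min (b := b) hα hd
  have hle : constCLam b α d 1 ^ lam ≤ constCLam b α d lam := by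
    rw [constCLam_one, Real.mul_rpow (by positivity) (div_nonneg (by linarith) (by linarith)),
      constCLam, Real.inv_rpow (by positivity), ← Real.rpow_natCast_mul hb.le, one_div]
    gcongr
    exact le_max_left _ _
  have hnn : 0 ≤ (1 + constCLam b α d 1) ^ d - 1 := by
    have := one_le_pow₀ (by linarith : 1 ≤ 1 + constCLam b α d 1) (n := d)
    linarith
  have hcl : 0 ≤ constCLam b α d 1 ^ lam := Real.rpow_nonneg hc.le _
  rw [constG_one, Real.mul_rpow hD.le hnn, constG]
  refine mul_le_mul_of_nonneg_left ((rpow_pow_sub_one_le hc.le h0 h1 d).trans ?_)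
    (Real.rpow_nonneg hD.le _)
  have : (1 + constCLam b α d 1 ^ lam) ^ d ≤ (1 + constCLam b α d lam) ^ d := by gcongr
  linarith

end Constants

/-! ### Interpolation and the number of points -/

section Final

variable {b : ℕ} [Fact b.Prime]

/-- The sum of the weights `γ_u G^{|u|}` with the constant `G` that belongs to `λ = 1`. -/
def baseSum (b α d : ℕ) (γ : Finset ℕ → ℝ≥0) (s : ℕ) : ℝ≥0∞ :=
  ∑ u ∈ (Finset.range s).powerset.erase ∅, (γ u : ℝ≥0∞) * ENNReal.ofReal (constG b α d 1 d) ^ u.card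

lemma sub_one_mul_criterion_le_baseSum {m s α d : ℕ} (hα : 2 ≤ α) (hd : 1 ≤ d)
    (γ : Finset ℕ → ℝ≥0) {p : (ZMod b)[X]} {q : ℕ → (ZMod b)[X]}
    (h : IsCBC b m s α d γ p q) :
    ((b ^ m - 1 : ℕ) : ℝ≥0∞) * criterion b m α d γ (d * s) p q ≤ 2 * baseSum b α d γ s := by
  have hD := constDTilde_pos (b := b) (d := d) hα
  refine (sub_one_mul_criterion_le hα hd γ h le_rfl).trans (mul_le_mul_right ?_ _)
  refine (tsum_indexMerit_le hα hd γ s).trans_eq (Finset.sum_congr rfl fun u _ => ?_)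
  rw [← ENNReal.ofReal_mul (by positivity), mul_assoc, ← mul_pow, ← constG_one,
    ENNReal.ofReal_mul (by positivity), ENNReal.ofReal_pow, ENNReal.ofReal_coe_nnreal]
  exact (lt_trans (by norm_num) (one_div_nine_lt_constG (b := b) hα hd)).le

/-- Since `1 / 9 < G`, an interpolation parameter close to zero keeps the constants of the
interpolated bound below those of the weights. -/
lemma exists_interpolation {K G D : ℝ} (hK : 0 < K) (hD : 0 < D) (hG : 1 / 9 < G) (A : ℝ) :
    ∃ θ : ℝ, 0 < θ ∧ θ < 1 ∧ (1 / 9 : ℝ) ^ (1 - θ) * K ^ θ ≤ G ^ (1 - θ / A) * D ^ (θ / A) := by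
  have hG0 : 0 < G := lt_trans (by norm_num) hG
  have hL : Continuous fun θ : ℝ => (1 / 9 : ℝ) ^ (1 - θ) * K ^ θ :=
    ((Real.continuous_const_rpow (by norm_num)).comp (by fun_prop)).mul
      (Real.continuous_const_rpow hK.ne')
  have hR : Continuous fun θ : ℝ => G ^ (1 - θ / A) * D ^ (θ / A) :=
    ((Real.continuous_const_rpow hG0.ne').comp (by fun_prop)).mul
      ((Real.continuous_const_rpow hD.ne').comp (by fun_prop))
  have h1 : ∀ᶠ θ in 𝓝[>] (0 : ℝ),
      (1 / 9 : ℝ) ^ (1 - θ) * K ^ θ < G ^ (1 - θ / A) * D ^ (θ / A) := nhdsWithin_le_nhds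
    (hL.continuousAt.eventually_lt hR.continuousAt (by simpa using hG))
  have h2 : ∀ᶠ θ in 𝓝[>] (0 : ℝ), θ < 1 := nhdsWithin_le_nhds (eventually_lt_nhds one_pos)
  obtain ⟨θ, ⟨h3, h4⟩, h5⟩ := ((h1.and h2).and self_mem_nhdsWithin).exists
  exact ⟨θ, h5, h4, h3.le⟩

/-- Hölder's inequality with the exponents `1 / (1 - δ)` and `1 / δ`. -/
lemma sum_rpow_mul_rpow_le {ι : Type*} (S : Finset ι) (f g : ι → ℝ≥0∞) {δ : ℝ} (h0 : 0 < δ)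
    (h1 : δ < 1) : ∑ i ∈ S, f i ^ (1 - δ) * g i ^ δ ≤
      (∑ i ∈ S, f i) ^ (1 - δ) * (∑ i ∈ S, g i) ^ δ := by
  have h2 : 0 < 1 - δ := by linarith
  have hconj : Real.HolderConjugate (1 - δ)⁻¹ δ⁻¹ := by
    rw [Real.holderConjugate_iff]
    exact ⟨(one_lt_inv₀ h2).2 (by linarith), by rw [inv_inv, inv_inv]; ring⟩
  have h3 := ENNReal.inner_le_Lp_mul_Lq S (fun i => f i ^ (1 - δ)) (fun i => g i ^ δ) hconj
  simpa only [← ENNReal.rpow_mul, mul_inv_cancel₀ h2.ne', mul_inv_cancel₀ h0.ne', ENNReal.rpow_one,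
    one_div, inv_inv] using h3

/-- The interpolation of the bounds `(1 / 9) ^ n` and `K ^ n X ^ (1 / A)`, in the form to which
Hölder's inequality applies. -/
lemma interpolation_term_le {K G D A θ : ℝ} (hK : 0 < K) (hG : 0 < G) (hD : 0 < D) (hA : 1 ≤ A)
    (h0 : 0 < θ) (h1 : θ < 1)
    (h : (1 / 9 : ℝ) ^ (1 - θ) * K ^ θ ≤ G ^ (1 - θ / A) * D ^ (θ / A)) (g : ℝ≥0∞) (n : ℕ)
    (X : ℝ≥0∞) :
    g * ((ENNReal.ofReal (1 / 9) ^ n) ^ (1 - θ) * (ENNReal.ofReal K ^ n * X ^ (1 / A)) ^ θ) ≤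
      (g * ENNReal.ofReal G ^ n) ^ (1 - θ / A) * (g * ENNReal.ofReal D ^ n * X) ^ (θ / A) := by
  have hA0 : 0 < A := by linarith
  have hδ0 : 0 ≤ θ / A := by positivity
  have hδ1 : 0 ≤ 1 - θ / A := by
    have : θ / A ≤ 1 := (div_le_one hA0).2 (by linarith)
    linarith
  have hpow : ∀ (a : ℝ≥0∞) (r : ℝ), (a ^ n) ^ r = (a ^ r) ^ n := fun a r => by
    rw [← ENNReal.rpow_natCast, ← ENNReal.rpow_mul, mul_comm, ENNReal.rpow_mul,
      ENNReal.rpow_natCast]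
  have hE : ENNReal.ofReal (1 / 9) ^ (1 - θ) * ENNReal.ofReal K ^ θ ≤
      ENNReal.ofReal G ^ (1 - θ / A) * ENNReal.ofReal D ^ (θ / A) := by
    rw [ENNReal.ofReal_rpow_of_pos (by norm_num), ENNReal.ofReal_rpow_of_pos hK,
      ENNReal.ofReal_rpow_of_pos hG, ENNReal.ofReal_rpow_of_pos hD,
      ← ENNReal.ofReal_mul (by positivity), ← ENNReal.ofReal_mul (by positivity)]
    exact ENNReal.ofReal_le_ofReal h
  have hX : (X ^ (1 / A)) ^ θ = X ^ (θ / A) := by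
    rw [← ENNReal.rpow_mul]
    congr 1
    field_simp
  have hg : g = g ^ (1 - θ / A) * g ^ (θ / A) := by
    rw [← ENNReal.rpow_add_of_nonneg _ _ hδ1 hδ0, sub_add_cancel, ENNReal.rpow_one]
  rw [ENNReal.mul_rpow_of_nonneg _ _ h0.le, hX, ENNReal.mul_rpow_of_nonneg _ _ hδ1,
    ENNReal.mul_rpow_of_nonneg _ _ hδ0, ENNReal.mul_rpow_of_nonneg _ _ hδ0, hpow, hpow, hpow, hpow]
  calc g * ((ENNReal.ofReal (1 / 9) ^ (1 - θ)) ^ n * ((ENNReal.ofReal K ^ θ) ^ n * X ^ (θ / A)))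
      = g * (ENNReal.ofReal (1 / 9) ^ (1 - θ) * ENNReal.ofReal K ^ θ) ^ n * X ^ (θ / A) := by
        rw [mul_pow]
        ring
    _ ≤ g * (ENNReal.ofReal G ^ (1 - θ / A) * ENNReal.ofReal D ^ (θ / A)) ^ n * X ^ (θ / A) :=
        mul_le_mul_left (mul_le_mul_right (pow_le_pow_left' hE n) _) _
    _ = (g ^ (1 - θ / A) * g ^ (θ / A)) *
        (ENNReal.ofReal G ^ (1 - θ / A) * ENNReal.ofReal D ^ (θ / A)) ^ n * X ^ (θ / A) := by
        rw [← hg]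
    _ = _ := by
        rw [mul_pow]
        ring

/-- The mean square error of the constructed nets decays like a power of the number of points, up
to the sum of the weights. -/
lemma exists_meanSquareError_le (b : ℕ) [Fact b.Prime] {α d : ℕ} (hα : 2 ≤ α) (hd : 1 ≤ d) :
    ∃ δ : ℝ, 0 < δ ∧ ∀ (γ : Finset ℕ → ℝ≥0) (m s : ℕ), 1 ≤ m →
      ∀ (p : (ZMod b)[X]) (q : ℕ → (ZMod b)[X]), IsCBC b m s α d γ p q →
        meanSquareError b α γ (interlacedNet b m s d p q) ≤
          baseSum b α d γ s * (2 / ((b ^ m - 1 : ℕ) : ℝ≥0∞)) ^ δ := by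
  have hb : 1 < b := (Fact.out : b.Prime).one_lt
  have hK : (0 : ℝ) < α * (6 * b) ^ 2 := by
    have h1 : (0 : ℝ) < α := by exact_mod_cast (by lia : 0 < α)
    have h2 : (0 : ℝ) < b := by exact_mod_cast (by lia : 0 < b)
    positivity
  have hD := constDTilde_pos (b := b) (d := d) hα
  have hG := one_div_nine_lt_constG (b := b) hα hd
  have hG0 : 0 < constG b α d 1 d := lt_trans (by norm_num) hG
  have hA : (1 : ℝ) ≤ ((2 * min α d + α) * d : ℕ) := by
    have : 0 < (2 * min α d + α) * d := Nat.mul_pos (by lia) hd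
    exact_mod_cast this
  obtain ⟨θ, h0, h1, hθ⟩ := exists_interpolation hK hD hG (((2 * min α d + α) * d : ℕ) : ℝ)
  set A : ℝ := (((2 * min α d + α) * d : ℕ) : ℝ) with hAdef
  have hδ0 : 0 < θ / A := by positivity
  have hδ1 : θ / A < 1 := (div_lt_one (by linarith)).2 (by linarith)
  refine ⟨θ / A, hδ0, fun γ m s hm p q h => ?_⟩
  have hn : ((b ^ m - 1 : ℕ) : ℝ≥0∞) ≠ 0 := by
    have : 1 < b ^ m := Nat.one_lt_pow (by lia) hb
    exact_mod_cast (by lia : b ^ m - 1 ≠ 0)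
  have hcrit : ∑ u ∈ (Finset.range s).powerset.erase ∅, (γ u : ℝ≥0∞) *
      ENNReal.ofReal (constDTilde b α d) ^ u.card * projectionMerit b m α d (d * s) p q u ≤
        baseSum b α d γ s * (2 / ((b ^ m - 1 : ℕ) : ℝ≥0∞)) := by
    have e1 := sub_one_mul_criterion_le_baseSum hα hd γ h
    rw [criterion_eq] at e1
    have e2 : ∀ u : Finset ℕ, ENNReal.ofReal (γ u * constDTilde b α d ^ u.card) =
        (γ u : ℝ≥0∞) * ENNReal.ofReal (constDTilde b α d) ^ u.card := fun u => by
      rw [ENNReal.ofReal_mul (by positivity), ENNReal.ofReal_pow hD.le, ENNReal.ofReal_coe_nnreal]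
    simp_rw [e2] at e1
    rw [← mul_div_assoc, ENNReal.le_div_iff_mul_le (Or.inl hn) (Or.inl (ENNReal.natCast_ne_top _)),
      mul_comm, mul_comm (baseSum b α d γ s)]
    exact e1
  calc meanSquareError b α γ (interlacedNet b m s d p q)
      ≤ ∑ u ∈ (Finset.range s).powerset.erase ∅,
          ((γ u : ℝ≥0∞) * ENNReal.ofReal (constG b α d 1 d) ^ u.card) ^ (1 - θ / A) *
            ((γ u : ℝ≥0∞) * ENNReal.ofReal (constDTilde b α d) ^ u.card *
              projectionMerit b m α d (d * s) p q u) ^ (θ / A) :=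
        (meanSquareError_interlacedNet_le hα hd γ h.irreducible.ne_zero h.natDegree_eq q h0.le
          h1.le).trans (Finset.sum_le_sum fun u _ =>
            interpolation_term_le hK hG0 hD hA h0 h1 hθ _ _ _)
    _ ≤ baseSum b α d γ s ^ (1 - θ / A) *
          (baseSum b α d γ s * (2 / ((b ^ m - 1 : ℕ) : ℝ≥0∞))) ^ (θ / A) :=
        (sum_rpow_mul_rpow_le _ _ _ hδ0 hδ1).trans
          (mul_le_mul_right (ENNReal.rpow_le_rpow hcrit hδ0.le) _)
    _ = _ := by
        rw [ENNReal.mul_rpow_of_nonneg _ _ hδ0.le, ← mul_assoc,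
          ← ENNReal.rpow_add_of_nonneg _ _ (by linarith) hδ0.le, sub_add_cancel, ENNReal.rpow_one]

/-- Jensen's inequality for sums compares the weights for `λ` with those for `1`. -/
lemma baseSum_le {α d : ℕ} (hα : 2 ≤ α) (hd : 1 ≤ d) (γ : Finset ℕ → ℝ≥0) {lam : ℝ}
    (h0 : 0 < lam) (h1 : lam ≤ 1) (s : ℕ) :
    baseSum b α d γ s ≤ ENNReal.ofReal (weightSum b α d γ lam s ^ lam⁻¹) := by
  have hG0 : 0 ≤ constG b α d 1 d :=
    (lt_trans (by norm_num) (one_div_nine_lt_constG (b := b) hα hd)).le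
  set G : ℝ≥0 := ⟨constG b α d 1 d, hG0⟩ with hG
  have hsum : baseSum b α d γ s =
      ((∑ u ∈ (Finset.range s).powerset.erase ∅, γ u * G ^ u.card : ℝ≥0) : ℝ≥0∞) := by
    rw [baseSum, ENNReal.ofNNReal_finsetSum]
    refine Finset.sum_congr rfl fun u _ => ?_
    rw [ENNReal.coe_mul, ENNReal.coe_pow, ENNReal.ofReal_eq_coe_nnreal hG0]
    rfl
  rw [hsum, ← ENNReal.ofReal_coe_nnreal]
  refine ENNReal.ofReal_le_ofReal ?_
  set T : ℝ≥0 := ∑ u ∈ (Finset.range s).powerset.erase ∅, γ u * G ^ u.card with hT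
  have h2 : T ^ lam ≤ ∑ u ∈ (Finset.range s).powerset.erase ∅, (γ u * G ^ u.card) ^ lam :=
    Finset.le_sum_of_subadditive (fun x : ℝ≥0 => x ^ lam) (by simp [h0.ne'])
      (fun x y => NNReal.rpow_add_le_add_rpow x y h0.le h1) _ _
  have h3 : (T : ℝ) ^ lam ≤ weightSum b α d γ lam s := by
    have h4 : ((T ^ lam : ℝ≥0) : ℝ) ≤ ((∑ u ∈ (Finset.range s).powerset.erase ∅,
        (γ u * G ^ u.card) ^ lam : ℝ≥0) : ℝ) := NNReal.coe_le_coe.2 h2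
    rw [NNReal.coe_rpow] at h4
    refine h4.trans ?_
    rw [NNReal.coe_sum]
    refine Finset.sum_le_sum fun u _ => ?_
    rw [NNReal.coe_rpow, NNReal.coe_mul, NNReal.coe_pow,
      Real.mul_rpow (NNReal.coe_nonneg _) (by positivity)]
    have h5 : ((G : ℝ) ^ u.card) ^ lam = ((G : ℝ) ^ lam) ^ u.card := by
      rw [← Real.rpow_natCast, ← Real.rpow_mul G.coe_nonneg, mul_comm,
        Real.rpow_mul G.coe_nonneg, Real.rpow_natCast]
    rw [h5]
    refine mul_le_mul_of_nonneg_left ?_ (Real.rpow_nonneg (NNReal.coe_nonneg _) _)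
    exact pow_le_pow_left₀ (Real.rpow_nonneg hG0 _) (rpow_constG_le hα hd h0 h1) _
  calc (T : ℝ) = ((T : ℝ) ^ lam) ^ lam⁻¹ := by
        rw [← Real.rpow_mul (NNReal.coe_nonneg _), mul_inv_cancel₀ h0.ne', Real.rpow_one]
    _ ≤ _ := Real.rpow_le_rpow (Real.rpow_nonneg (NNReal.coe_nonneg _) _) h3 (inv_nonneg.2 h0.le)

/-- The number of points that suffice, in terms of a bound for the sum of the weights. -/
lemma exists_minPoints_le (b : ℕ) [Fact b.Prime] {α d : ℕ} (hα : 2 ≤ α) (hd : 1 ≤ d)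
    (γ : Finset ℕ → ℝ≥0) (hγ : 0 < γ ∅) :
    ∃ (τ : ℝ) (κ : ℕ), 0 < τ ∧ ∀ (s : ℕ) (p : ℕ → (ZMod b)[X]) (q : ℕ → ℕ → (ZMod b)[X]),
      (∀ m, 1 ≤ m → IsCBC b m s α d γ (p m) (q m)) → ∀ S : ℝ, 0 ≤ S →
        baseSum b α d γ s ≤ ENNReal.ofReal S → ∀ ε : ℝ, 0 < ε →
          minPoints b s α d γ p q ε ≤
            ENNReal.ofReal (b * (1 + 4 * (S / γ ∅) ^ τ) * (1 + ε⁻¹) ^ κ) := by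
  obtain ⟨δ, hδ, hmse⟩ := exists_meanSquareError_le b hα hd
  refine ⟨δ⁻¹, ⌈2 * δ⁻¹⌉₊, inv_pos.2 hδ, fun s p q hcbc S hS hbase ε hε => ?_⟩
  have hb : 1 < b := (Fact.out : b.Prime).one_lt
  have hb' : (1 : ℝ) < b := by exact_mod_cast hb
  have hγ' : (0 : ℝ) < γ ∅ := hγ
  set thr : ℝ := 4 * (S / γ ∅) ^ δ⁻¹ * (ε⁻¹) ^ (2 * δ⁻¹) with hthr
  have hthr0 : 0 ≤ thr := by positivity
  -- the exponent `n + 1` is at least `1`, and `b ^ (n + 1)` exceeds the threshold at most `b`-fold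
  obtain ⟨n, hn1, hn2⟩ := exists_nat_pow_near (by linarith : 1 ≤ 1 + thr) hb'
  have hbm : thr ≤ (b : ℝ) ^ (n + 1) := by linarith
  have hbm2 : (2 : ℝ) ≤ (b : ℝ) ^ (n + 1) := by
    have h2 : (2 : ℝ) ≤ b := by exact_mod_cast hb
    exact h2.trans (le_self_pow₀ hb'.le (by lia))
  have hpos : (0 : ℝ) < (b : ℝ) ^ (n + 1) := by linarith
  have herr : rootMeanSquareError b α γ (interlacedNet b (n + 1) s d (p (n + 1)) (q (n + 1))) ≤
      ENNReal.ofReal ε * initialError α γ s := by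
    refine le_trans ?_ (mul_le_mul_right (le_initialError hα γ s) _)
    have h1 : ((b ^ (n + 1) - 1 : ℕ) : ℝ) = (b : ℝ) ^ (n + 1) - 1 := by
      rw [Nat.cast_sub (Nat.one_le_pow _ _ (by lia))]
      push_cast
      rfl
    have h2 : (2 : ℝ≥0∞) / ((b ^ (n + 1) - 1 : ℕ) : ℝ≥0∞) ≤
        ENNReal.ofReal (4 / (b : ℝ) ^ (n + 1)) := by
      rw [← ENNReal.ofReal_natCast, h1, ← ENNReal.ofReal_ofNat 2,
        ← ENNReal.ofReal_div_of_pos (by linarith)]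
      refine ENNReal.ofReal_le_ofReal ?_
      rw [div_le_div_iff₀ (by linarith) hpos]
      linarith
    have h3 : S * (4 / (b : ℝ) ^ (n + 1)) ^ δ ≤ ε ^ 2 * γ ∅ := by
      have e1 : ((S / γ ∅) ^ δ⁻¹ * (ε⁻¹) ^ (2 * δ⁻¹)) ^ δ = S / γ ∅ * (ε⁻¹) ^ 2 := by
        rw [Real.mul_rpow (by positivity) (by positivity), ← Real.rpow_mul (by positivity),
          ← Real.rpow_mul (by positivity), inv_mul_cancel₀ hδ.ne', Real.rpow_one, mul_assoc,
          inv_mul_cancel₀ hδ.ne', mul_one]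
        norm_cast
      have e2 : (S / γ ∅) ^ δ⁻¹ * (ε⁻¹) ^ (2 * δ⁻¹) ≤ (b : ℝ) ^ (n + 1) / 4 := by
        rw [le_div_iff₀ (by norm_num)]
        rw [hthr] at hbm
        linarith
      have e3 : S / γ ∅ * (ε⁻¹) ^ 2 ≤ ((b : ℝ) ^ (n + 1) / 4) ^ δ := by
        rw [← e1]
        exact Real.rpow_le_rpow (by positivity) e2 hδ.le
      have e4 : (4 / (b : ℝ) ^ (n + 1)) ^ δ = (((b : ℝ) ^ (n + 1) / 4) ^ δ)⁻¹ := by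
        rw [← Real.inv_rpow (by positivity), inv_div]
      rw [e4, ← div_eq_mul_inv, div_le_iff₀ (by positivity)]
      calc S = ε ^ 2 * γ ∅ * (S / γ ∅ * (ε⁻¹) ^ 2) := by field_simp
        _ ≤ _ := by gcongr
    have h4 : meanSquareError b α γ (interlacedNet b (n + 1) s d (p (n + 1)) (q (n + 1))) ≤
        ENNReal.ofReal (ε ^ 2 * γ ∅) := by
      refine (hmse γ (n + 1) s (by lia) _ _ (hcbc (n + 1) (by lia))).trans ?_
      calc _ ≤ ENNReal.ofReal S * ENNReal.ofReal (4 / (b : ℝ) ^ (n + 1)) ^ δ :=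
            mul_le_mul' hbase (ENNReal.rpow_le_rpow h2 hδ.le)
        _ = ENNReal.ofReal (S * (4 / (b : ℝ) ^ (n + 1)) ^ δ) := by
            rw [ENNReal.ofReal_rpow_of_pos (by positivity), ENNReal.ofReal_mul hS]
        _ ≤ _ := ENNReal.ofReal_le_ofReal h3
    rw [rootMeanSquareError, ← ENNReal.ofReal_mul hε.le]
    refine (ENNReal.rpow_le_rpow h4 (by norm_num)).trans_eq ?_
    rw [ENNReal.ofReal_rpow_of_pos (by positivity), ← Real.sqrt_eq_rpow,
      Real.sqrt_mul (by positivity), Real.sqrt_sq hε.le]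
  refine (iInf_le_of_le (n + 1) (iInf_le_of_le (Nat.le_add_left 1 n) (iInf_le _ herr))).trans ?_
  rw [← ENNReal.ofReal_natCast, ← ENNReal.ofReal_pow (by positivity)]
  refine ENNReal.ofReal_le_ofReal ?_
  have hone : 1 ≤ 1 + ε⁻¹ := by
    have : 0 < ε⁻¹ := inv_pos.2 hε
    linarith
  have hεpow : (ε⁻¹) ^ (2 * δ⁻¹) ≤ (1 + ε⁻¹) ^ ⌈2 * δ⁻¹⌉₊ := by
    rw [← Real.rpow_natCast]
    exact (Real.rpow_le_rpow (by positivity) (by linarith) (by positivity)).trans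
      (Real.rpow_le_rpow_of_exponent_le hone (Nat.le_ceil _))
  have hκ : 1 ≤ (1 + ε⁻¹) ^ ⌈2 * δ⁻¹⌉₊ := one_le_pow₀ hone
  calc (b : ℝ) ^ (n + 1) = b * (b : ℝ) ^ n := by ring
    _ ≤ b * (1 + thr) := by gcongr
    _ ≤ b * ((1 + ε⁻¹) ^ ⌈2 * δ⁻¹⌉₊ + 4 * (S / γ ∅) ^ δ⁻¹ * (1 + ε⁻¹) ^ ⌈2 * δ⁻¹⌉₊) := by
        rw [hthr]
        gcongr
    _ = _ := by ring

lemma weightSum_nonneg {α d : ℕ} (hα : 2 ≤ α) (hd : 1 ≤ d) (γ : Finset ℕ → ℝ≥0) {lam : ℝ}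
    (h0 : 0 < lam) (h1 : lam ≤ 1) (s : ℕ) : 0 ≤ weightSum b α d γ lam s := by
  refine Finset.sum_nonneg fun u _ => mul_nonneg (by positivity) (pow_nonneg ?_ _)
  refine (Real.rpow_nonneg ?_ lam).trans (rpow_constG_le hα hd h0 h1)
  exact (lt_trans (by norm_num) (one_div_nine_lt_constG (b := b) hα hd)).le

/-- A sequence that grows at most polynomially in the sense of the upper limit is bounded by a
multiple of the power for all positive arguments. -/
lemma exists_le_mul_rpow {f : ℕ → ℝ} {Q : ℝ} (h : limsup (fun s : ℕ =>
    ENNReal.ofReal (1 / (s : ℝ) ^ Q * f s)) atTop < ⊤) :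
    ∃ M : ℝ, 0 ≤ M ∧ ∀ s : ℕ, 1 ≤ s → f s ≤ M * (s : ℝ) ^ Q := by
  obtain ⟨c, hc1, hc2⟩ := exists_between h
  obtain ⟨s₀, hs₀⟩ := eventually_atTop.1 (eventually_lt_of_limsup_lt hc1)
  refine ⟨c.toReal + ∑ s ∈ Finset.range s₀, |1 / (s : ℝ) ^ Q * f s|, by positivity, fun s hs => ?_⟩
  have hspos : (0 : ℝ) < (s : ℝ) ^ Q := Real.rpow_pos_of_pos (by exact_mod_cast hs) _
  rw [← div_le_iff₀ hspos, ← one_div_mul_eq_div]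
  rcases lt_or_ge s s₀ with hlt | hge
  · have h1 := Finset.single_le_sum (f := fun s : ℕ => |1 / (s : ℝ) ^ Q * f s|)
      (fun _ _ => abs_nonneg _) (Finset.mem_range.2 hlt)
    have h2 := le_abs_self (1 / (s : ℝ) ^ Q * f s)
    have h3 : 0 ≤ c.toReal := ENNReal.toReal_nonneg
    linarith
  · have h1 := (ENNReal.ofReal_le_iff_le_toReal hc2.ne).1 (hs₀ s hge).le
    have h2 : 0 ≤ ∑ s ∈ Finset.range s₀, |1 / (s : ℝ) ^ Q * f s| :=
      Finset.sum_nonneg fun _ _ => abs_nonneg _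
    linarith

end Final

end InterlacedQMC

end

theorem corollary2 (b : ℕ) [Fact b.Prime] (α d : ℕ) (hα : 2 ≤ α) (hd : 1 ≤ d)
    (γ : Finset ℕ → ℝ≥0) (hγ : 0 < γ ∅) :
    ((∃ lam : ℝ, 1 / (2 * ((min α d : ℕ) : ℝ)) < lam ∧ lam ≤ 1 ∧
        ∃ L : ℝ, Tendsto (InterlacedQMC.weightSum b α d γ lam) atTop (𝓝 L)) →
      ∃ (C : ℝ) (κ : ℕ), ∀ s : ℕ, 1 ≤ s →
        ∀ (p : ℕ → (ZMod b)[X]) (q : ℕ → ℕ → (ZMod b)[X]),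
          (∀ m, 1 ≤ m → InterlacedQMC.IsCBC b m s α d γ (p m) (q m)) →
          ∀ ε : ℝ, 0 < ε →
            InterlacedQMC.minPoints b s α d γ p q ε ≤ ENNReal.ofReal (C * (1 + ε⁻¹) ^ κ)) ∧
    ((∃ lam : ℝ, 1 / (2 * ((min α d : ℕ) : ℝ)) < lam ∧ lam ≤ 1 ∧ ∃ Q : ℝ, 0 < Q ∧
        limsup (fun s : ℕ => ENNReal.ofReal
          (1 / (s : ℝ) ^ Q * InterlacedQMC.weightSum b α d γ lam s)) atTop < ⊤) →
      ∃ (C : ℝ) (κ t : ℕ), ∀ s : ℕ, 1 ≤ s →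
        ∀ (p : ℕ → (ZMod b)[X]) (q : ℕ → ℕ → (ZMod b)[X]),
          (∀ m, 1 ≤ m → InterlacedQMC.IsCBC b m s α d γ (p m) (q m)) →
          ∀ ε : ℝ, 0 < ε →
            InterlacedQMC.minPoints b s α d γ p q ε ≤
              ENNReal.ofReal (C * (1 + ε⁻¹) ^ κ * (s : ℝ) ^ t)) := by
  obtain ⟨τ, κ, hτ, hmain⟩ := InterlacedQMC.exists_minPoints_le b hα hd γ hγ
  have hγ' : (0 : ℝ) < γ ∅ := hγ
  have hpos : ∀ lam : ℝ, 1 / (2 * ((min α d : ℕ) : ℝ)) < lam → 0 < lam := fun lam h =>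
    lt_of_le_of_lt (by positivity) h
  constructor
  · rintro ⟨lam, hlam, hlam1, L, hL⟩
    have hlam0 := hpos lam hlam
    obtain ⟨M, hM⟩ := hL.bddAbove_range
    have hM' : ∀ s, InterlacedQMC.weightSum b α d γ lam s ≤ M := fun s => hM ⟨s, rfl⟩
    have hM0 : 0 ≤ M := (InterlacedQMC.weightSum_nonneg hα hd γ hlam0 hlam1 0).trans (hM' 0)
    refine ⟨b * (1 + 4 * (M ^ lam⁻¹ / γ ∅) ^ τ), κ, fun s _ p q hcbc ε hε => ?_⟩
    refine hmain s p q hcbc _ (by positivity)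
      ((InterlacedQMC.baseSum_le hα hd γ hlam0 hlam1 s).trans (ENNReal.ofReal_le_ofReal ?_)) ε hε
    exact Real.rpow_le_rpow (InterlacedQMC.weightSum_nonneg hα hd γ hlam0 hlam1 s) (hM' s)
      (inv_nonneg.2 hlam0.le)
  · rintro ⟨lam, hlam, hlam1, Q, hQ, hlim⟩
    have hlam0 := hpos lam hlam
    obtain ⟨M, hM0, hM⟩ := InterlacedQMC.exists_le_mul_rpow hlim
    refine ⟨b * (1 + 4 * (M ^ lam⁻¹ / γ ∅) ^ τ), κ, ⌈Q * lam⁻¹ * τ⌉₊, fun s hs p q hcbc ε hε => ?_⟩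
    have hs1 : (1 : ℝ) ≤ s := by exact_mod_cast hs
    have hs0 : (0 : ℝ) ≤ s := by linarith
    refine (hmain s p q hcbc ((M * (s : ℝ) ^ Q) ^ lam⁻¹) (by positivity)
      ((InterlacedQMC.baseSum_le hα hd γ hlam0 hlam1 s).trans (ENNReal.ofReal_le_ofReal
        (Real.rpow_le_rpow (InterlacedQMC.weightSum_nonneg hα hd γ hlam0 hlam1 s) (hM s hs)
          (inv_nonneg.2 hlam0.le)))) ε hε).trans (ENNReal.ofReal_le_ofReal ?_)
    have h1 : ((M * (s : ℝ) ^ Q) ^ lam⁻¹ / γ ∅) ^ τ =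
        (M ^ lam⁻¹ / γ ∅) ^ τ * (s : ℝ) ^ (Q * lam⁻¹ * τ) := by
      rw [Real.mul_rpow hM0 (by positivity), ← Real.rpow_mul hs0, mul_div_right_comm,
        Real.mul_rpow (by positivity) (by positivity), ← Real.rpow_mul hs0]
    have h2 : (s : ℝ) ^ (Q * lam⁻¹ * τ) ≤ (s : ℝ) ^ ⌈Q * lam⁻¹ * τ⌉₊ := by
      rw [← Real.rpow_natCast]
      exact Real.rpow_le_rpow_of_exponent_le hs1 (Nat.le_ceil _)
    have h3 : (1 : ℝ) ≤ (s : ℝ) ^ ⌈Q * lam⁻¹ * τ⌉₊ := one_le_pow₀ hs1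
    rw [h1]
    calc b * (1 + 4 * ((M ^ lam⁻¹ / γ ∅) ^ τ * (s : ℝ) ^ (Q * lam⁻¹ * τ))) * (1 + ε⁻¹) ^ κ
        ≤ b * ((s : ℝ) ^ ⌈Q * lam⁻¹ * τ⌉₊ + 4 * ((M ^ lam⁻¹ / γ ∅) ^ τ *
            (s : ℝ) ^ ⌈Q * lam⁻¹ * τ⌉₊)) * (1 + ε⁻¹) ^ κ := by gcongr
      _ = _ := by ring
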